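/- Throughout, $S(\rho)=-\mathrm{tr}[\rho\log_2\rho]$, Hilbert spaces are finite-dimensional and channels are completely positive trace-preserving maps. For a channel $\Phi$ put $$\mathcal C^{(1)}(\Phi)=\max_{\{p_i,\rho_i\}} S\Big(\sum_i p_i\Phi(\rho_i)\Big)-\sum_i p_iS(\Phi(\rho_i)),\quad \mathcal C^{(n)}(\Phi)=\tfrac1n\mathcal C^{(1)}(\Phi^{\otimes n}),\quad \mathcal C(\Phi)=\lim_{n\to\infty}\mathcal C^{(n)}(\Phi),$$ where $\{p_i,\rho_i\}$ ranges over finite ensembles of input states, and for $P\ge 0$ $$\mathcal C^{(1)}_P(\Phi)=\max_{\{p_i,\rho_i\}:\ \sum_ip_iS(\rho_i)\le P}\ \sum_ip_iS(\rho_i)+S\Big(\Phi\Big(\sum_ip_i\rho_i\Big)\Big)-\sum_ip_iS\big((\Phi\otimes\mathcal I)(\phi_i)\big),$$ where $\phi_i$ is a purification of $\rho_i$, and $\mathcal C^{(n)}_P(\Phi)=\frac1n\mathcal C^{(1)}_{nP}(\Phi^{\otimes n})$, $\mathcal C_P(\Phi)=\lim_{n\to\infty}\mathcal C^{(n)}_P(\Phi)$.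 Let $\mathcal N_0,\mathcal N_1$ be channels from $A$ to $B$, $A\neq 0$, such that: (i) $\mathcal N_0$ has classical input (as every classical channel has): there is an orthonormal basis $\{|e_j\rangle\}$ of $A$ with $\mathcal N_0(\rho)=\mathcal N_0\big(\sum_j|e_j\rangle\langle e_j|\rho|e_j\rangle\langle e_j|\big)$ for all $\rho$; (ii) $\mathcal C(\mathcal N_0)=\log_2|B|-\min_\rho S(\mathcal N_0(\rho))$; (iii) for all $n\ge1$ and $P\ge0$, $\mathcal C^{(n)}_P(\mathcal N_1)=\log_2|B|-\min_{S(\rho)\le nP}\frac1n\{S((\mathcal N_1^{\otimes n}\otimes\mathcal I)(\phi_\rho))-S(\rho)\}$, where $\phi_\rho$ is a purification of $\rho$. Let $\mathcal N$ be the channel from $M\otimes A$ to $B$, $M$ a qubit, given by $\mathcal N(\rho^{MA})=\mathcal N_0(\langle0|\rho^{MA}|0\rangle^M)+\mathcal N_1(\langle1|\rho^{MA}|1\rangle^M)$. Then for every $P\ge 0$ $$\mathcal C^{(1)}_P(\mathcal N)=\sup_{(1-q)P'=P} q\,\mathcal C(\mathcal N_0)+(1-q)\,\mathcal C^{(1)}_{P'}(\mathcal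 N_1),$$ $$\mathcal C_P(\mathcal N)=\sup_{(1-q)P'=P} q\,\mathcal C(\mathcal N_0)+(1-q)\,\mathcal C_{P'}(\mathcal N_1),$$ over $q\in[0,1]$ and $P'\ge0$. The first (respectively second) supremum is a maximum if $P=0$ or if $\mathcal C(\mathcal N_0)\le\mathcal C^{(1)}_{P'}(\mathcal N_1)$ (respectively $\mathcal C(\mathcal N_0)\le\mathcal C_{P'}(\mathcal N_1)$) for some $P'\ge 0$. The limits that define $\mathcal C(\mathcal N_0)$, $\mathcal C_{P'}(\mathcal N_1)$ for $P'\ge 0$, and $\mathcal C_P(\mathcal N)$ exist. -/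

import Mathlib

open Filter Topology
open scoped ComplexOrder

noncomputable section

namespace CECapacity

/-- `ρ` is a density matrix. -/
def IsDensity {A : Type*} [Fintype A] (ρ : Matrix A A ℂ) : Prop :=
  ρ.PosSemidef ∧ ρ.trace = 1

/-- The von Neumann entropy `S(ρ) = -tr (ρ log ρ)`, in bits: the sum of `-x log₂ x` over the
eigenvalues `x` of the Hermitian matrix `ρ`, with `0 log 0 = 0`. -/
def entropy {A : Type*} [Fintype A] [DecidableEq A] (ρ : Matrix A A ℂ) : ℝ :=
  open Classical in
  if h : ρ.IsHermitian then ∑ i, -(h.eigenvalues i * Real.logb 2 (h.eigenvalues i)) else 0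

/-- The map `Φ ⊗ id` on operators of `A ⊗ E`, the identity acting on the reference system `E`. -/
def ampliate {A B : Type*} (Φ : Matrix A A ℂ →ₗ[ℂ] Matrix B B ℂ) (E : Type*)
    (X : Matrix (A × E) (A × E) ℂ) : Matrix (B × E) (B × E) ℂ :=
  Matrix.of fun x y => Φ (Matrix.of fun a a' => X (a, x.2) (a', y.2)) x.1 y.1

/-- A quantum channel: a completely positive trace-preserving linear map. -/
structure IsChannel {A B : Type*} [Fintype A] [Fintype B]
    (Φ : Matrix A A ℂ →ₗ[ℂ] Matrix B B ℂ) : Prop where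
  completely_positive : ∀ (k : ℕ) (X : Matrix (A × Fin k) (A × Fin k) ℂ),
    X.PosSemidef → (ampliate Φ (Fin k) X).PosSemidef
  trace_preserving : ∀ X : Matrix A A ℂ, (Φ X).trace = X.trace

/-- The tensor power `Φ^{⊗ n}`, on the basis indexed by words `Fin n → A`: it is the linear map
that sends the matrix unit `|a⟩⟨a'| = ⨂ᵢ |aᵢ⟩⟨a'ᵢ|` to `⨂ᵢ Φ(|aᵢ⟩⟨a'ᵢ|)`. -/
def tensorPower {A B : Type*} [Fintype A] [DecidableEq A]
    (Φ : Matrix A A ℂ →ₗ[ℂ] Matrix B B ℂ) (n : ℕ) :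
    Matrix (Fin n → A) (Fin n → A) ℂ →ₗ[ℂ] Matrix (Fin n → B) (Fin n → B) ℂ where
  toFun X := Matrix.of fun b b' =>
    ∑ a : Fin n → A, ∑ a' : Fin n → A,
      X a a' * ∏ i, Φ (Matrix.single (a i) (a' i) (1 : ℂ)) (b i) (b' i)
  map_add' X Y := by
    ext b b'
    simp [add_mul, Finset.sum_add_distrib]
  map_smul' c X := by
    ext b b'
    simp [Finset.mul_sum, mul_assoc]

/-- The rank-one operator `|ψ⟩⟨ψ|`. -/
def ketbra {A : Type*} (ψ : A → ℂ) : Matrix A A ℂ :=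
  Matrix.vecMulVec ψ (star ψ)

/-- The vector `ψ` of `A ⊗ E` purifies `ρ`: the partial trace of `|ψ⟩⟨ψ|` over `E` is `ρ`. -/
def IsPurification {A E : Type*} [Fintype E] (ψ : A × E → ℂ) (ρ : Matrix A A ℂ) : Prop :=
  ∀ a a', ∑ e, ketbra ψ (a, e) (a', e) = ρ a a'

/-- `{p i, ρ i}` is an ensemble of `m` states of `A`. -/
structure IsEnsemble {A : Type*} [Fintype A] {m : ℕ} (p : Fin m → ℝ)
    (ρ : Fin m → Matrix A A ℂ) : Prop where
  nonneg : ∀ i, 0 ≤ p i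
  sum_eq_one : ∑ i, p i = 1
  density : ∀ i, IsDensity (ρ i)

section Capacities

variable {A B : Type*} [Fintype A] [DecidableEq A] [Fintype B] [DecidableEq B]

/-- The one-shot classical (Holevo) capacity `C⁽¹⁾(Φ)`. -/
def oneShotCapacity (Φ : Matrix A A ℂ →ₗ[ℂ] Matrix B B ℂ) : ℝ :=
  sSup {x : ℝ | ∃ (m : ℕ) (p : Fin m → ℝ) (ρ : Fin m → Matrix A A ℂ), IsEnsemble p ρ ∧
    x = entropy (∑ i, (p i : ℂ) • Φ (ρ i)) - ∑ i, p i * entropy (Φ (ρ i))}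

/-- The `n`-shot classical capacity `C⁽ⁿ⁾(Φ) = C⁽¹⁾(Φ^{⊗ n}) / n`. -/
def nShotCapacity (Φ : Matrix A A ℂ →ₗ[ℂ] Matrix B B ℂ) (n : ℕ) : ℝ :=
  oneShotCapacity (tensorPower Φ n) / n

/-- The (regularized) classical capacity `C(Φ) = lim C⁽ⁿ⁾(Φ)`. -/
def capacity (Φ : Matrix A A ℂ →ₗ[ℂ] Matrix B B ℂ) : ℝ :=
  limUnder atTop (nShotCapacity Φ)

/-- The one-shot classical capacity `C⁽¹⁾_P(Φ)` with entanglement assistance `P`: the supremum of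
`∑ pᵢ S(ρᵢ) + S(Φ(∑ pᵢ ρᵢ)) - ∑ pᵢ S((Φ ⊗ id)(φᵢ))` over the ensembles with `∑ pᵢ S(ρᵢ) ≤ P`,
where `φᵢ = |ψᵢ⟩⟨ψᵢ|` is a purification of `ρᵢ` (the value does not depend on which one). -/
def oneShotAssisted (Φ : Matrix A A ℂ →ₗ[ℂ] Matrix B B ℂ) (P : ℝ) : ℝ :=
  sSup {x : ℝ | ∃ (m : ℕ) (p : Fin m → ℝ) (ρ : Fin m → Matrix A A ℂ)
      (k : Fin m → ℕ) (ψ : ∀ i, A × Fin (k i) → ℂ),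
    IsEnsemble p ρ ∧ (∀ i, IsPurification (ψ i) (ρ i)) ∧ ∑ i, p i * entropy (ρ i) ≤ P ∧
    x = ∑ i, p i * entropy (ρ i) + entropy (Φ (∑ i, (p i : ℂ) • ρ i))
      - ∑ i, p i * entropy (ampliate Φ (Fin (k i)) (ketbra (ψ i)))}

/-- The `n`-shot capacity with assistance `P` per use, `C⁽ⁿ⁾_P(Φ) = C⁽¹⁾_{nP}(Φ^{⊗ n}) / n`. -/
def nShotAssisted (Φ : Matrix A A ℂ →ₗ[ℂ] Matrix B B ℂ) (P : ℝ) (n : ℕ) : ℝ :=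
  oneShotAssisted (tensorPower Φ n) (n * P) / n

/-- The (regularized) classical capacity with assistance `P`, `C_P(Φ) = lim C⁽ⁿ⁾_P(Φ)`. -/
def assistedCapacity (Φ : Matrix A A ℂ →ₗ[ℂ] Matrix B B ℂ) (P : ℝ) : ℝ :=
  limUnder atTop (nShotAssisted Φ P)

/-- The minimum output entropy `min_ρ S(Φ(ρ))`. -/
def minOutputEntropy (Φ : Matrix A A ℂ →ₗ[ℂ] Matrix B B ℂ) : ℝ :=
  sInf {x : ℝ | ∃ ρ : Matrix A A ℂ, IsDensity ρ ∧ x = entropy (Φ ρ)}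

/-- `min_{S(ρ) ≤ P} (S((Φ ⊗ id)(φ_ρ)) - S(ρ))`, where `φ_ρ` is a purification of `ρ`. -/
def minEntropyGap (Φ : Matrix A A ℂ →ₗ[ℂ] Matrix B B ℂ) (P : ℝ) : ℝ :=
  sInf {x : ℝ | ∃ (ρ : Matrix A A ℂ) (k : ℕ) (ψ : A × Fin k → ℂ),
    IsDensity ρ ∧ IsPurification ψ ρ ∧ entropy ρ ≤ P ∧
    x = entropy (ampliate Φ (Fin k) (ketbra ψ)) - entropy ρ}

/-- The input of `Φ` is classical: for some orthonormal basis `e` of the input space, `Φ = Φ ∘ Π`,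
where `Π(X) = ∑ⱼ |eⱼ⟩⟨eⱼ| X |eⱼ⟩⟨eⱼ|`. Every classical channel has this property. -/
def HasClassicalInput (Φ : Matrix A A ℂ →ₗ[ℂ] Matrix B B ℂ) : Prop :=
  ∃ e : OrthonormalBasis A ℂ (EuclideanSpace ℂ A), ∀ X : Matrix A A ℂ,
    Φ X = Φ (∑ j, ketbra (fun a => e j a) * X * ketbra (fun a => e j a))

end Capacities

/-- The conditional channel `N(X) = N₀(⟨0|X|0⟩) + N₁(⟨1|X|1⟩)` with input `M ⊗ A`, where the qubit
register `M` has the basis `Fin 2`. -/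
def condChannel {A B : Type*} (N₀ N₁ : Matrix A A ℂ →ₗ[ℂ] Matrix B B ℂ) :
    Matrix (Fin 2 × A) (Fin 2 × A) ℂ →ₗ[ℂ] Matrix B B ℂ where
  toFun X := N₀ (Matrix.of fun a a' => X (0, a) (0, a'))
    + N₁ (Matrix.of fun a a' => X (1, a) (1, a'))
  map_add' X Y := by
    have h : ∀ j : Fin 2, (Matrix.of fun a a' => (X + Y) (j, a) (j, a')) =
        (Matrix.of fun a a' => X (j, a) (j, a')) + Matrix.of fun a a' => Y (j, a) (j, a') :=
      fun _ => rfl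
    rw [h, h, map_add, map_add]
    abel
  map_smul' c X := by
    have h : ∀ j : Fin 2, (Matrix.of fun a a' => (c • X) (j, a) (j, a')) =
        c • (Matrix.of fun a a' => X (j, a) (j, a')) :=
      fun _ => rfl
    rw [h, h, map_smul, map_smul]
    simp

/-- The values `q c + (1 - q) f(P')` of the time-sharing expression over all `q ∈ [0, 1]` and
`P' ≥ 0` with `(1 - q) P' = P`. -/
def timeSharingValues (c : ℝ) (f : ℝ → ℝ) (P : ℝ) : Set ℝ :=
  {x | ∃ q P' : ℝ, 0 ≤ q ∧ q ≤ 1 ∧ 0 ≤ P' ∧ (1 - q) * P' = P ∧ x = q * c + (1 - q) * f P'}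

end CECapacity

end

open CECapacity

open CECapacity

namespace CECapacity

open Matrix
open scoped Kronecker

set_option linter.unusedSectionVars false

/-! Write `d = log₂ |B|` and `c = C(N₀)`, and let `G(P)` be the supremum of the time-sharing values
for a curve `F`, which is the one-shot or the regularized assisted capacity of `N₁`. The two
marginals of a pure state have equal entropy and a channel leaves the reference `E` alone, so `S((Φ
⊗ id)φ_ρ) - S(ρ)` is the conditional entropy `S(B|E)` of the output. The assisted capacity is thus a
supremum of output entropy minus average conditional entropy.

Achievability. Fixing the register `M` to `0` or `1` embeds the inputs of `N₀` and `N₁`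
isometrically into those of the conditional channel. With classical input, `N₀` measures in a basis
and prepares states `T j`; its Holevo quantity is additive, so `c` is the one-shot value, and pure
inputs reach it without assistance. The assisted capacity is concave in the assistance, since
ensembles can be merged. Interpolating between assistance `0` (branch `N₀`) and `P'` (branch `N₁`)
gives `timeSharing_le_nShotAssisted`.

Converse. The output entropy of `n` uses is at most `n d`, so a lower bound on `S(Bⁿ|E)` is needed.
Each use of the conditional channel is a sum over letters: `none` (the input goes to `N₁`) or `some
j` (`N₀` measures `j` and prepares `T j`). Expanding, the output is a sum over words. The word `x`
with `k` letters `none` contributes a product of states `T j` times the output of `k` uses of `N₁`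
on a vector that is still pure, because the measurement has rank one. If this branch has weight `w
x` and reference state `σ x`, its conditional entropy is at least `w x` times `(n - k) μ` plus the
minimal entropy gap of `N₁^{⊗k}` at `S(σ x)`, with `μ = d - c` the minimum output entropy of `N₀`,
by (ii). By (iii) this gap is at least `k d - k F(S(σ x)/k)`, so the bracket is at least `g(S(σ x))`
with `g(S) = n d - n G(S/n)`. Concavity of the conditional entropy (strong subadditivity) lets the
branches be added. Since `g` is convex and antitone and `∑ w x S(σ x) ≤ S(ρ)`, the total is at least
`g(S(ρ))`; a second Jensen step over the ensemble gives `n G(P)`. This is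
`nShotAssisted_condChannel_le`.

For the regularized formula, the gaps of the powers of `N₁` are subadditive, so by Fekete's lemma
the `k`-shot capacities converge to a limit that bounds them all.

Strong subadditivity is proved from an integral formula for the relative entropy, whose integrand is
a supremum of functionals linear in the pair of operators. -/

/-- The contribution `-x log₂ x` of an eigenvalue `x` to the entropy. -/
noncomputable def shannon (x : ℝ) : ℝ := -(x * Real.logb 2 x)

lemma shannon_eq (x : ℝ) : shannon x = Real.negMulLog x / Real.log 2 := by
  simp [shannon, Real.negMulLog, Real.logb]; ring

@[simp] lemma shannon_zero : shannon 0 = 0 := by simp [shannon]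

lemma shannon_nonneg {x : ℝ} (h₀ : 0 ≤ x) (h₁ : x ≤ 1) : 0 ≤ shannon x := by
  rw [shannon_eq]
  exact div_nonneg (Real.negMulLog_nonneg h₀ h₁) (Real.log_nonneg (by norm_num))

lemma shannon_mul (x y : ℝ) : shannon (x * y) = x * shannon y + y * shannon x := by
  simp only [shannon_eq, Real.negMulLog_mul]; ring

/-! ### Entropy through an arbitrary unitary diagonalization -/

section Diagonalization

variable {n m ι : Type*} [Fintype n] [DecidableEq n] [Fintype m] [DecidableEq m]

/-- The characteristic polynomial determines the entropy, which frees it from the particular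
eigenbasis in the definition. -/
lemma entropy_eq_roots {ρ : Matrix n n ℂ} (h : ρ.IsHermitian) :
    entropy ρ = (ρ.charpoly.roots.map (fun z : ℂ => shannon z.re)).sum := by
  rw [entropy, dif_pos h, h.roots_charpoly_eq_eigenvalues, Multiset.map_map]
  rfl

lemma entropy_eq_of_charpoly {ρ : Matrix n n ℂ} {σ : Matrix m m ℂ} (hρ : ρ.IsHermitian)
    (hσ : σ.IsHermitian) (h : ρ.charpoly = σ.charpoly) : entropy ρ = entropy σ := by
  rw [entropy_eq_roots hρ, entropy_eq_roots hσ, h]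

/-- `ρ = U diag(l) U*` with `U` unitary and `l` real. -/
structure Diagonalizes (U : Matrix n n ℂ) (l : n → ℝ) (ρ : Matrix n n ℂ) : Prop where
  star_mul : Uᴴ * U = 1
  mul_star : U * Uᴴ = 1
  eq : ρ = U * diagonal (fun i => (l i : ℂ)) * Uᴴ

lemma exists_diagonalizes {ρ : Matrix n n ℂ} (h : ρ.IsHermitian) :
    Diagonalizes (h.eigenvectorUnitary : Matrix n n ℂ) h.eigenvalues ρ where
  star_mul := by simpa [star_eq_conjTranspose] using Unitary.coe_star_mul_self h.eigenvectorUnitary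
  mul_star := by simpa [star_eq_conjTranspose] using Unitary.coe_mul_star_self h.eigenvectorUnitary
  eq := by
    conv_lhs => rw [h.spectral_theorem, Unitary.conjStarAlgAut_apply]
    rfl

namespace Diagonalizes

variable {U : Matrix n n ℂ} {l : n → ℝ} {ρ : Matrix n n ℂ}

lemma isHermitian (h : Diagonalizes U l ρ) : ρ.IsHermitian := by
  rw [h.eq, IsHermitian, conjTranspose_mul, conjTranspose_mul, conjTranspose_conjTranspose,
    diagonal_conjTranspose, Matrix.mul_assoc]
  congr 3
  ext i; simp

lemma charpoly (h : Diagonalizes U l ρ) :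
    ρ.charpoly = (diagonal (fun i => (l i : ℂ))).charpoly := by
  rw [h.eq, charpoly_mul_comm, ← Matrix.mul_assoc, h.star_mul, Matrix.one_mul]

lemma entropy_eq (h : Diagonalizes U l ρ) : entropy ρ = ∑ i, shannon (l i) := by
  rw [entropy_eq_roots h.isHermitian, h.charpoly, charpoly_diagonal, Polynomial.roots_prod]
  · simp only [Polynomial.roots_X_sub_C, Multiset.bind_singleton, Multiset.map_map]
    rfl
  · exact Finset.prod_ne_zero_iff.mpr fun i _ => Polynomial.X_sub_C_ne_zero _

lemma trace_eq (h : Diagonalizes U l ρ) : ρ.trace = ((∑ i, l i : ℝ) : ℂ) := by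
  rw [h.eq, trace_mul_comm, ← Matrix.mul_assoc, h.star_mul, Matrix.one_mul, trace_diagonal]
  simp

lemma diag_eq (h : Diagonalizes U l ρ) :
    Uᴴ * ρ * U = diagonal (fun i => (l i : ℂ)) := by
  rw [h.eq]
  calc Uᴴ * (U * diagonal (fun i => (l i : ℂ)) * Uᴴ) * U
      = (Uᴴ * U) * diagonal (fun i => (l i : ℂ)) * (Uᴴ * U) := by simp only [Matrix.mul_assoc]
    _ = _ := by simp [h.star_mul]

lemma posSemidef (h : Diagonalizes U l ρ) (hl : ∀ i, 0 ≤ l i) : ρ.PosSemidef := by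
  rw [h.eq]
  exact (PosSemidef.diagonal (fun i => by simpa using hl i)).mul_mul_conjTranspose_same U

lemma smul (h : Diagonalizes U l ρ) (c : ℝ) : Diagonalizes U (fun i => c * l i) ((c : ℂ) • ρ) where
  star_mul := h.star_mul
  mul_star := h.mul_star
  eq := by
    rw [h.eq, ← Matrix.smul_mul, ← Matrix.mul_smul, ← diagonal_smul]
    congr 3
    ext i; simp

lemma kronecker {V : Matrix m m ℂ} {k : m → ℝ} {σ : Matrix m m ℂ}
    (h : Diagonalizes U l ρ) (h' : Diagonalizes V k σ) :
    Diagonalizes (U ⊗ₖ V) (fun x => l x.1 * k x.2) (ρ ⊗ₖ σ) where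
  star_mul := by rw [conjTranspose_kronecker, ← mul_kronecker_mul, h.star_mul, h'.star_mul,
    one_kronecker_one]
  mul_star := by rw [conjTranspose_kronecker, ← mul_kronecker_mul, h.mul_star, h'.mul_star,
    one_kronecker_one]
  eq := by
    rw [conjTranspose_kronecker, h.eq, h'.eq, mul_kronecker_mul, mul_kronecker_mul,
      diagonal_kronecker_diagonal]
    congr 3
    ext i; simp

end Diagonalizes

lemma diagonalizes_one : Diagonalizes (1 : Matrix n n ℂ) (fun _ => 1) 1 := by
  constructor <;> simp

end Diagonalization

/-! ### Tensor products of families of matrices -/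

section PiMat

variable {ι A B C : Type*} [Fintype ι]

/-- The tensor product `⨂ᵢ Mᵢ` of a family of matrices, on the bases of words. -/
def piMat (M : ι → Matrix A B ℂ) : Matrix (ι → A) (ι → B) ℂ :=
  Matrix.of fun a b => ∏ i, M i (a i) (b i)

@[simp] lemma piMat_apply (M : ι → Matrix A B ℂ) (a : ι → A) (b : ι → B) :
    piMat M a b = ∏ i, M i (a i) (b i) := rfl

lemma piMat_mul [Fintype B] [DecidableEq ι] (M : ι → Matrix A B ℂ) (N : ι → Matrix B C ℂ) :
    piMat M * piMat N = piMat (fun i => M i * N i) := by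
  ext a c
  simp only [Matrix.mul_apply, piMat_apply, ← Finset.prod_mul_distrib]
  rw [Fintype.prod_sum]

lemma piMat_conjTranspose (M : ι → Matrix A B ℂ) : (piMat M)ᴴ = piMat fun i => (M i)ᴴ := by
  ext a b
  simp [conjTranspose_apply]

lemma piMat_diagonal [DecidableEq A] [DecidableEq ι] (d : ι → A → ℂ) :
    piMat (fun i => diagonal (d i)) = diagonal fun a : ι → A => ∏ i, d i (a i) := by
  ext a b
  by_cases h : a = b
  · subst h; simp
  · rw [diagonal_apply_ne _ h]
    obtain ⟨i, hi⟩ := Function.ne_iff.mp h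
    exact Finset.prod_eq_zero (Finset.mem_univ i) (diagonal_apply_ne _ hi)

lemma piMat_one [DecidableEq A] [DecidableEq ι] :
    piMat (fun _ : ι => (1 : Matrix A A ℂ)) = 1 := by
  have := piMat_diagonal (ι := ι) (fun _ (_ : A) => (1 : ℂ))
  simpa using this

variable [Fintype A] [DecidableEq A] [DecidableEq ι]

lemma Diagonalizes.piMat {U : ι → Matrix A A ℂ} {l : ι → A → ℝ} {ρ : ι → Matrix A A ℂ}
    (h : ∀ i, Diagonalizes (U i) (l i) (ρ i)) :
    Diagonalizes (piMat U) (fun a => ∏ i, l i (a i)) (piMat ρ) where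
  star_mul := by
    rw [piMat_conjTranspose, piMat_mul]; simp only [(h _).star_mul, piMat_one]
  mul_star := by
    rw [piMat_conjTranspose, piMat_mul]; simp only [(h _).mul_star, piMat_one]
  eq := by
    have : (fun a : ι → A => ((∏ i, l i (a i) : ℝ) : ℂ)) = fun a => ∏ i, (l i (a i) : ℂ) := by
      ext a; simp
    rw [this, ← piMat_diagonal (fun i a => (l i a : ℂ)), piMat_conjTranspose, piMat_mul, piMat_mul]
    congr 1
    ext1 i
    exact (h i).eq

lemma trace_piMat (M : ι → Matrix A A ℂ) : (piMat M).trace = ∏ i, (M i).trace := by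
  simp [Matrix.trace, Fintype.prod_sum]

lemma posSemidef_piMat {ρ : ι → Matrix A A ℂ} (h : ∀ i, (ρ i).PosSemidef) :
    (piMat ρ).PosSemidef :=
  (Diagonalizes.piMat fun i => exists_diagonalizes (h i).1).posSemidef fun _ =>
    Finset.prod_nonneg fun i _ => (h i).eigenvalues_nonneg _

/-- Sums over words of a product of weights against a function of one letter. -/
lemma sum_prod_mul_apply {R : Type*} [CommSemiring R] (f : ι → A → R) (i₀ : ι) (g : A → R)
    (hf : ∀ i, i ≠ i₀ → ∑ a, f i a = 1) :
    ∑ x : ι → A, (∏ i, f i (x i)) * g (x i₀) = ∑ a, f i₀ a * g a := by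
  have h1 : ∀ x : ι → A, (∏ i, f i (x i)) * g (x i₀)
      = ∏ i, (if i = i₀ then f i (x i) * g (x i) else f i (x i)) := by
    intro x
    rw [← Finset.mul_prod_erase _ _ (Finset.mem_univ i₀),
      ← Finset.mul_prod_erase Finset.univ (fun i => if i = i₀ then f i (x i) * g (x i)
        else f i (x i)) (Finset.mem_univ i₀)]
    rw [if_pos rfl, Finset.prod_congr rfl (g := fun i => if i = i₀ then f i (x i) * g (x i)
        else f i (x i)) (fun i hi => by rw [if_neg (Finset.ne_of_mem_erase hi)])]
    ring
  simp only [h1]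
  rw [← Fintype.prod_sum (fun i a => if i = i₀ then f i a * g a else f i a)]
  rw [← Finset.mul_prod_erase _ _ (Finset.mem_univ i₀), Finset.prod_eq_one]
  · simp
  · intro i hi
    simp [Finset.ne_of_mem_erase hi, hf i (Finset.ne_of_mem_erase hi)]

end PiMat

/-! ### Basic properties of the entropy -/

section Entropy

variable {n m : Type*} [Fintype n] [DecidableEq n] [Fintype m] [DecidableEq m]

lemma entropy_zero : entropy (0 : Matrix n n ℂ) = 0 := by
  have h : Diagonalizes (1 : Matrix n n ℂ) (fun _ => 0) 0 := by constructor <;> simp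
  simp [h.entropy_eq]

lemma entropy_submatrix (e : m ≃ n) {ρ : Matrix n n ℂ} (h : ρ.IsHermitian) :
    entropy (ρ.submatrix e e) = entropy ρ := by
  refine entropy_eq_of_charpoly (h.submatrix _) h ?_
  simpa using charpoly_reindex e.symm ρ

lemma entropy_transpose {ρ : Matrix n n ℂ} (h : ρ.IsHermitian) : entropy ρᵀ = entropy ρ :=
  entropy_eq_of_charpoly h.transpose h (charpoly_transpose _)

/-- The two marginals of a pure state have the same entropy. -/
lemma entropy_mul_conjTranspose (M : Matrix n m ℂ) : entropy (M * Mᴴ) = entropy (Mᴴ * M) := by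
  rw [entropy_eq_roots (isHermitian_mul_conjTranspose_self M),
    entropy_eq_roots (isHermitian_conjTranspose_mul_self M)]
  have h := congrArg Polynomial.roots (charpoly_mul_comm' M Mᴴ)
  rw [Polynomial.roots_mul (mul_ne_zero (pow_ne_zero _ Polynomial.X_ne_zero)
      (charpoly_monic _).ne_zero),
    Polynomial.roots_mul (mul_ne_zero (pow_ne_zero _ Polynomial.X_ne_zero)
      (charpoly_monic _).ne_zero), Polynomial.roots_X_pow, Polynomial.roots_X_pow] at h
  -- The two spectra differ only by zeros, which contribute nothing to the entropy.
  have h' := congrArg (fun s : Multiset ℂ => (s.map fun z : ℂ => shannon z.re).sum) h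
  simpa [Multiset.map_nsmul, Multiset.sum_nsmul] using h'

lemma entropy_smul {ρ : Matrix n n ℂ} (h : ρ.IsHermitian) (c : ℝ) :
    entropy ((c : ℂ) • ρ) = c * entropy ρ + shannon c * ρ.trace.re := by
  have hd := exists_diagonalizes h
  rw [(hd.smul c).entropy_eq, hd.entropy_eq, hd.trace_eq, Complex.ofReal_re]
  simp only [shannon_mul, Finset.sum_add_distrib, Finset.mul_sum, mul_comm]

lemma entropy_kronecker {ρ : Matrix n n ℂ} {σ : Matrix m m ℂ} (h : ρ.IsHermitian)
    (h' : σ.IsHermitian) :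
    entropy (ρ ⊗ₖ σ) = ρ.trace.re * entropy σ + σ.trace.re * entropy ρ := by
  have hd := exists_diagonalizes h
  have hd' := exists_diagonalizes h'
  rw [(hd.kronecker hd').entropy_eq, hd.entropy_eq, hd'.entropy_eq, hd.trace_eq, hd'.trace_eq,
    Complex.ofReal_re, Complex.ofReal_re, Fintype.sum_prod_type]
  simp only [shannon_mul, Finset.sum_add_distrib, Finset.sum_mul, Finset.mul_sum]
  congr 1
  rw [Finset.sum_comm]

lemma IsDensity.sum_eigenvalues {ρ : Matrix n n ℂ} (h : IsDensity ρ) :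
    ∑ i, h.1.1.eigenvalues i = 1 := by
  have := (exists_diagonalizes h.1.1).trace_eq.symm.trans h.2
  exact_mod_cast this

lemma entropy_nonneg {ρ : Matrix n n ℂ} (h : IsDensity ρ) : 0 ≤ entropy ρ := by
  rw [(exists_diagonalizes h.1.1).entropy_eq]
  refine Finset.sum_nonneg fun i _ => shannon_nonneg (h.1.eigenvalues_nonneg i) ?_
  rw [← h.sum_eigenvalues]
  exact Finset.single_le_sum (fun i _ => h.1.eigenvalues_nonneg i) (Finset.mem_univ i)

lemma IsDensity.nonempty {ρ : Matrix n n ℂ} (h : IsDensity ρ) : Nonempty n := by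
  by_contra hn
  rw [not_nonempty_iff] at hn
  simpa [Matrix.trace] using h.2

/-- Jensen's inequality for `-x log x` with uniform weights on the eigenvalues. -/
lemma entropy_le_logb_card {ρ : Matrix n n ℂ} (h : IsDensity ρ) :
    entropy ρ ≤ Real.logb 2 (Fintype.card n) := by
  have := h.nonempty
  have hn : (0 : ℝ) < Fintype.card n := by exact_mod_cast Fintype.card_pos
  rw [(exists_diagonalizes h.1.1).entropy_eq]
  have hj := Real.concaveOn_negMulLog.le_map_sum (t := Finset.univ)
    (w := fun _ : n => (Fintype.card n : ℝ)⁻¹) (p := h.1.1.eigenvalues)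
    (fun _ _ => by positivity) (by simp) (fun i _ => h.1.eigenvalues_nonneg i)
  simp only [smul_eq_mul, ← Finset.mul_sum, h.sum_eigenvalues, mul_one] at hj
  simp only [shannon_eq, ← Finset.sum_div, Real.logb]
  refine div_le_div_of_nonneg_right ?_ (Real.log_nonneg (by norm_num))
  · rw [inv_mul_le_iff₀ hn, Real.negMulLog, Real.log_inv] at hj
    convert hj using 1
    field_simp

/-- The eigenvalues of the product form a product distribution: the logarithm splits into a sum, and
in each term the other factors sum to one. A vanishing factor is treated apart, because the
logarithm then does not split. -/
lemma entropy_piMat {ι A : Type*} [Fintype ι] [DecidableEq ι] [Fintype A] [DecidableEq A]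
    {ρ : ι → Matrix A A ℂ} (h : ∀ i, IsDensity (ρ i)) :
    entropy (piMat ρ) = ∑ i, entropy (ρ i) := by
  have hd := fun i => exists_diagonalizes (h i).1.1
  rw [(Diagonalizes.piMat hd).entropy_eq]
  have key : ∀ x : ι → A, shannon (∏ i, (h i).1.1.eigenvalues (x i))
      = ∑ i₀, (∏ i, (h i).1.1.eigenvalues (x i)) * -Real.logb 2 ((h i₀).1.1.eigenvalues (x i₀)) := by
    intro x
    by_cases h0 : ∃ i, (h i).1.1.eigenvalues (x i) = 0
    · obtain ⟨i, hi⟩ := h0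
      rw [Finset.prod_eq_zero (Finset.mem_univ i) hi]; simp
    · push Not at h0
      rw [shannon, Real.logb_prod _ _ (fun i _ => h0 i), Finset.mul_sum, ← Finset.sum_neg_distrib]
      simp
  simp only [key]
  rw [Finset.sum_comm]
  refine Finset.sum_congr rfl fun i₀ _ => ?_
  rw [sum_prod_mul_apply (fun i a => (h i).1.1.eigenvalues a) i₀
    (fun a => -Real.logb 2 ((h i₀).1.1.eigenvalues a)) (fun i _ => (h i).sum_eigenvalues),
    (hd i₀).entropy_eq]
  exact Finset.sum_congr rfl fun a _ => by simp [shannon]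

end Entropy

/-! ### Integral formula for the scalar relative entropy -/

section RelativeEntropyIntegral

open MeasureTheory Set

/-- The integrand in `l log (l / k) + k - l = ∫₀^∞ (k - l)² / ((k + t l) (1 + t)²) dt`. -/
noncomputable def divergenceIntegrand (k l t : ℝ) : ℝ := (k - l) ^ 2 / (k + t * l) / (1 + t) ^ 2

variable {k l : ℝ}

/-- This antiderivative equals `l log k - (k - l)` at `0` and tends to `l log l` at infinity, which
yields the integral. -/
lemma hasDerivAt_divergence (hk : 0 < k) (hl : 0 ≤ l) {t : ℝ} (ht : 0 ≤ t) :
    HasDerivAt (fun t => l * (Real.log (k + t * l) - Real.log (1 + t)) - (k - l) / (1 + t))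
      (divergenceIntegrand k l t) t := by
  have h1 : k + t * l ≠ 0 := by positivity
  have h2 : 1 + t ≠ 0 := by positivity
  have d1 : HasDerivAt (fun t => k + t * l) l t := by
    simpa using ((hasDerivAt_id t).mul_const l).const_add k
  have d2 : HasDerivAt (fun t => 1 + t) 1 t := by simpa using (hasDerivAt_id t).const_add 1
  have d := (((d1.log h1).sub (d2.log h2)).const_mul l).sub ((hasDerivAt_const t (k - l)).div d2 h2)
  refine d.congr_deriv ?_
  rw [divergenceIntegrand]
  field_simp
  ring

lemma tendsto_divergence (hk : 0 < k) (hl : 0 ≤ l) :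
    Tendsto (fun t => l * (Real.log (k + t * l) - Real.log (1 + t)) - (k - l) / (1 + t)) atTop
      (𝓝 (l * Real.log l)) := by
  have h0 : Tendsto (fun t : ℝ => (1 + t)) atTop atTop := tendsto_atTop_add_const_left _ _ tendsto_id
  have h1 : Tendsto (fun t : ℝ => (k - l) / (1 + t)) atTop (𝓝 0) := h0.const_div_atTop _
  rcases hl.eq_or_lt with rfl | hl
  · simpa using h1.neg
  have h2 : Tendsto (fun t : ℝ => l + (k - l) / (1 + t)) atTop (𝓝 l) := by
    simpa using h1.const_add l
  have h3 := ((h2.log hl.ne').const_mul l).sub h1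
  rw [sub_zero] at h3
  -- The quotient `(k + t l) / (1 + t)` equals `l + (k - l) / (1 + t)`.
  refine h3.congr' ?_
  filter_upwards [eventually_ge_atTop 0] with t ht
  have h4 : 1 + t ≠ 0 := by positivity
  rw [← Real.log_div (by positivity) h4]
  congr 3
  field_simp
  ring

lemma divergenceIntegrand_nonneg (hk : 0 < k) (hl : 0 ≤ l) {t : ℝ} (ht : 0 ≤ t) :
    0 ≤ divergenceIntegrand k l t := by
  unfold divergenceIntegrand; positivity

lemma integrableOn_divergenceIntegrand (hk : 0 < k) (hl : 0 ≤ l) :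
    IntegrableOn (divergenceIntegrand k l) (Ioi 0) :=
  integrableOn_Ioi_deriv_of_nonneg
    (hasDerivAt_divergence hk hl le_rfl).continuousAt.continuousWithinAt
    (fun _ ht => hasDerivAt_divergence hk hl (le_of_lt ht))
    (fun _ ht => divergenceIntegrand_nonneg hk hl (le_of_lt ht)) (tendsto_divergence hk hl)

lemma integral_divergenceIntegrand (hk : 0 < k) (hl : 0 ≤ l) :
    ∫ t in Ioi (0 : ℝ), divergenceIntegrand k l t
      = l * Real.log l - l * Real.log k + k - l := by
  rw [integral_Ioi_of_hasDerivAt_of_nonneg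
    (hasDerivAt_divergence hk hl le_rfl).continuousAt.continuousWithinAt
    (fun _ ht => hasDerivAt_divergence hk hl (le_of_lt ht))
    (fun _ ht => divergenceIntegrand_nonneg hk hl (le_of_lt ht)) (tendsto_divergence hk hl)]
  simp
  ring

lemma divergence_nonneg (hk : 0 < k) (hl : 0 ≤ l) :
    0 ≤ l * Real.log l - l * Real.log k + k - l := by
  rw [← integral_divergenceIntegrand hk hl]
  exact setIntegral_nonneg measurableSet_Ioi
    fun _ ht => divergenceIntegrand_nonneg hk hl (le_of_lt ht)

end RelativeEntropyIntegral

/-! ### Relative entropy: Klein's inequality and joint convexity -/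

section Divergence

variable {n : Type*} [Fintype n] [DecidableEq n]

/-- `|⟨wⱼ|uᵢ⟩|²` for the columns of `W` and `U`. -/
noncomputable def overlap (W U : Matrix n n ℂ) (j i : n) : ℝ := Complex.normSq ((Wᴴ * U) j i)

lemma overlap_nonneg (W U : Matrix n n ℂ) (j i : n) : 0 ≤ overlap W U j i := Complex.normSq_nonneg _

variable {U W X σ : Matrix n n ℂ} {l k : n → ℝ}

lemma Diagonalizes.sum_overlap_right (h : Diagonalizes U l X) (h' : Diagonalizes W k σ) (j : n) :
    ∑ i, overlap W U j i = 1 := by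
  have h1 : (Wᴴ * U) * (Wᴴ * U)ᴴ = 1 := by
    rw [conjTranspose_mul, conjTranspose_conjTranspose, Matrix.mul_assoc, ← Matrix.mul_assoc U,
      h.mul_star, Matrix.one_mul, h'.star_mul]
  have h2 := congrFun (congrFun h1 j) j
  rw [Matrix.mul_apply, one_apply_eq] at h2
  simp only [conjTranspose_apply, RCLike.star_def, Complex.mul_conj] at h2
  exact_mod_cast h2

lemma Diagonalizes.sum_overlap_left (h : Diagonalizes U l X) (h' : Diagonalizes W k σ) (i : n) :
    ∑ j, overlap W U j i = 1 := by
  rw [← h'.sum_overlap_right h i]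
  refine Finset.sum_congr rfl fun j _ => ?_
  have : (Wᴴ * U) j i = star ((Uᴴ * W) i j) := by
    rw [← conjTranspose_apply, conjTranspose_mul, conjTranspose_conjTranspose]
  rw [overlap, overlap, this]
  exact Complex.normSq_conj _

lemma Diagonalizes.diag_conj (h : Diagonalizes U l X) (W : Matrix n n ℂ) (j : n) :
    (Wᴴ * X * W) j j = ((∑ i, overlap W U j i * l i : ℝ) : ℂ) := by
  have h1 : Wᴴ * X * W = (Wᴴ * U) * diagonal (fun i => (l i : ℂ)) * (Wᴴ * U)ᴴ := by
    rw [h.eq, conjTranspose_mul, conjTranspose_conjTranspose]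
    simp only [Matrix.mul_assoc]
  rw [h1, Matrix.mul_apply]
  push_cast
  refine Finset.sum_congr rfl fun i _ => ?_
  rw [mul_diagonal, conjTranspose_apply, mul_right_comm, RCLike.star_def, Complex.mul_conj]
  rfl

/-- The relative entropy (in nats) of the operators with the given spectral decompositions. -/
noncomputable def divergence (U : Matrix n n ℂ) (l : n → ℝ) (W : Matrix n n ℂ) (k : n → ℝ) : ℝ :=
  ∑ j, ∑ i, overlap W U j i * (l i * Real.log (l i) - l i * Real.log (k j) + k j - l i)

/-- Rows and columns of the overlap matrix sum to one, so only the cross term still involves both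
bases; it is linear in `X`. -/
lemma divergence_eq (h : Diagonalizes U l X) (h' : Diagonalizes W k σ) :
    divergence U l W k = ∑ i, l i * Real.log (l i)
      - ∑ j, ((Wᴴ * X * W) j j).re * Real.log (k j) + ∑ j, k j - ∑ i, l i := by
  have e1 : ∑ j, ∑ i, overlap W U j i * (l i * Real.log (l i)) = ∑ i, l i * Real.log (l i) := by
    rw [Finset.sum_comm]
    simp only [← Finset.sum_mul, h.sum_overlap_left h', one_mul]
  have e2 : ∑ j, ∑ i, overlap W U j i * l i = ∑ i, l i := by
    rw [Finset.sum_comm]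
    simp only [← Finset.sum_mul, h.sum_overlap_left h', one_mul]
  have e3 : ∑ j, ∑ i, overlap W U j i * k j = ∑ j, k j := by
    simp only [← Finset.sum_mul, h.sum_overlap_right h', one_mul]
  have e4 : ∑ j, ∑ i, overlap W U j i * (l i * Real.log (k j))
      = ∑ j, ((Wᴴ * X * W) j j).re * Real.log (k j) := by
    refine Finset.sum_congr rfl fun j _ => ?_
    rw [h.diag_conj, Complex.ofReal_re, Finset.sum_mul]
    exact Finset.sum_congr rfl fun i _ => by ring
  rw [divergence, ← e1, ← e2, ← e3, ← e4]
  simp only [mul_sub, mul_add, Finset.sum_sub_distrib, Finset.sum_add_distrib]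

/-- The support of `X` is contained in that of `σ = W diag(k) W*`. -/
def SupportedOn (X W : Matrix n n ℂ) (k : n → ℝ) : Prop := ∀ j, k j = 0 → (Wᴴ * X * W) j j = 0

/-- The vanishing diagonal entry is a sum of these nonnegative terms. Hence the terms with `k j =
0`, where `log (k j)` is a default value, drop out. -/
lemma Diagonalizes.overlap_mul_eq_zero (h : Diagonalizes U l X) (hl : ∀ i, 0 ≤ l i)
    (hs : SupportedOn X W k) {j : n} (hj : k j = 0) (i : n) : overlap W U j i * l i = 0 := by
  have h1 := hs j hj
  rw [h.diag_conj W j, Complex.ofReal_eq_zero] at h1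
  exact (Finset.sum_eq_zero_iff_of_nonneg fun i _ =>
    mul_nonneg (overlap_nonneg _ _ _ _) (hl i)).mp h1 i (Finset.mem_univ i)

lemma divergence_term_nonneg (h : Diagonalizes U l X) (hl : ∀ i, 0 ≤ l i) (hk : ∀ j, 0 ≤ k j)
    (hs : SupportedOn X W k) (j i : n) :
    0 ≤ overlap W U j i * (l i * Real.log (l i) - l i * Real.log (k j) + k j - l i) := by
  rcases (hk j).eq_or_lt with hj | hj
  · rcases mul_eq_zero.mp (h.overlap_mul_eq_zero hl hs hj.symm i) with h0 | h0 <;> simp [h0, ← hj]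
  · exact mul_nonneg (overlap_nonneg _ _ _ _) (divergence_nonneg hj (hl i))

/-- Klein's inequality. -/
lemma neg_sum_mul_log_le (h : Diagonalizes U l X) (h' : Diagonalizes W k σ) (hl : ∀ i, 0 ≤ l i)
    (hk : ∀ j, 0 ≤ k j) (hs : SupportedOn X W k) (hlk : ∑ j, k j ≤ ∑ i, l i) :
    entropy X ≤ -∑ j, ((Wᴴ * X * W) j j).re * Real.logb 2 (k j) := by
  have h0 : 0 ≤ divergence U l W k := Finset.sum_nonneg fun j _ => Finset.sum_nonneg fun i _ =>
    divergence_term_nonneg h hl hk hs j i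
  rw [divergence_eq h h'] at h0
  rw [h.entropy_eq]
  simp only [shannon_eq, Real.logb, ← mul_div_assoc, ← Finset.sum_div, ← neg_div]
  refine div_le_div_of_nonneg_right ?_ (Real.log_nonneg (by norm_num))
  simp only [Real.negMulLog, neg_mul, Finset.sum_neg_distrib]
  linarith

/-- The quadratic form whose integral over `t` is the relative entropy. -/
noncomputable def quasiEntropy (U : Matrix n n ℂ) (l : n → ℝ) (W : Matrix n n ℂ) (k : n → ℝ)
    (t : ℝ) : ℝ :=
  ∑ j, ∑ i, overlap W U j i * ((k j - l i) ^ 2 / (k j + t * l i))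

lemma quasiEntropy_div_eq (t : ℝ) : quasiEntropy U l W k t / (1 + t) ^ 2
    = ∑ j, ∑ i, overlap W U j i * divergenceIntegrand (k j) (l i) t := by
  simp only [quasiEntropy, Finset.sum_div, mul_div_assoc, divergenceIntegrand]

lemma overlap_mul_integrand (h : Diagonalizes U l X) (hl : ∀ i, 0 ≤ l i) (hk : ∀ j, 0 ≤ k j)
    (hs : SupportedOn X W k) (j i : n) :
    MeasureTheory.IntegrableOn (fun t => overlap W U j i * divergenceIntegrand (k j) (l i) t)
      (Set.Ioi 0) ∧
    ∫ t in Set.Ioi (0 : ℝ), overlap W U j i * divergenceIntegrand (k j) (l i) t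
      = overlap W U j i * (l i * Real.log (l i) - l i * Real.log (k j) + k j - l i) := by
  rcases (hk j).eq_or_lt with hj | hj
  · rcases mul_eq_zero.mp (h.overlap_mul_eq_zero hl hs hj.symm i) with h0 | h0 <;>
      simp [h0, ← hj, divergenceIntegrand]
  · exact ⟨(integrableOn_divergenceIntegrand hj (hl i)).const_mul _, by
      rw [MeasureTheory.integral_const_mul, integral_divergenceIntegrand hj (hl i)]⟩

lemma integrableOn_quasiEntropy (h : Diagonalizes U l X) (hl : ∀ i, 0 ≤ l i) (hk : ∀ j, 0 ≤ k j)
    (hs : SupportedOn X W k) :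
    MeasureTheory.IntegrableOn (fun t => quasiEntropy U l W k t / (1 + t) ^ 2) (Set.Ioi 0) := by
  simp only [quasiEntropy_div_eq]
  exact MeasureTheory.integrable_finsetSum _ fun j _ => MeasureTheory.integrable_finsetSum _
    fun i _ => (overlap_mul_integrand h hl hk hs j i).1

lemma integral_quasiEntropy (h : Diagonalizes U l X) (hl : ∀ i, 0 ≤ l i) (hk : ∀ j, 0 ≤ k j)
    (hs : SupportedOn X W k) :
    ∫ t in Set.Ioi (0 : ℝ), quasiEntropy U l W k t / (1 + t) ^ 2 = divergence U l W k := by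
  simp only [quasiEntropy_div_eq]
  rw [MeasureTheory.integral_finsetSum _ fun j _ => MeasureTheory.integrable_finsetSum _
    fun i _ => (overlap_mul_integrand h hl hk hs j i).1]
  refine Finset.sum_congr rfl fun j _ => ?_
  rw [MeasureTheory.integral_finsetSum _ fun i _ => (overlap_mul_integrand h hl hk hs j i).1]
  exact Finset.sum_congr rfl fun i _ => (overlap_mul_integrand h hl hk hs j i).2

/-- A functional, linear in `(X, σ)`, whose supremum over `Y` is the quasi-entropy. -/
noncomputable def dualFunctional (Y X σ : Matrix n n ℂ) (t : ℝ) : ℝ :=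
  2 * (Yᴴ * (σ - X)).trace.re - (Yᴴ * σ * Y).trace.re - t * (Y * X * Yᴴ).trace.re

lemma dualFunctional_sum {κ : Type*} [Fintype κ] (Y : Matrix n n ℂ) (X σ : κ → Matrix n n ℂ)
    (t : ℝ) : dualFunctional Y (∑ x, X x) (∑ x, σ x) t = ∑ x, dualFunctional Y (X x) (σ x) t := by
  simp only [dualFunctional, ← Finset.sum_sub_distrib, Matrix.sum_mul, trace_sum,
    Complex.re_sum, Finset.mul_sum]

lemma trace_conjTranspose_mul_diagonal (Z : Matrix n n ℂ) (k : n → ℝ) :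
    (Zᴴ * diagonal (fun i => (k i : ℂ)) * Z).trace.re
      = ∑ j, ∑ i, k j * Complex.normSq (Z j i) := by
  rw [Finset.sum_comm]
  simp only [Matrix.trace, diag_apply, Matrix.mul_apply (M := _ * _), mul_diagonal,
    conjTranspose_apply, Complex.re_sum]
  refine Finset.sum_congr rfl fun i _ => Finset.sum_congr rfl fun j _ => ?_
  simp [Complex.normSq_apply]; ring

/-- In the coordinates `Y = W Z U*` the functional splits into independent scalar quadratic
problems, one for each entry of `Z`. -/
lemma dualFunctional_eq (h : Diagonalizes U l X) (h' : Diagonalizes W k σ) (Z : Matrix n n ℂ)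
    (t : ℝ) : dualFunctional (W * Z * Uᴴ) X σ t
      = ∑ j, ∑ i, (2 * (k j - l i) * (star (Z j i) * (Wᴴ * U) j i).re
          - (k j + t * l i) * Complex.normSq (Z j i)) := by
  have e1 : ((W * Z * Uᴴ)ᴴ * (σ - X)).trace
      = (Zᴴ * (diagonal (fun i => (k i : ℂ)) * (Wᴴ * U)
          - (Wᴴ * U) * diagonal (fun i => (l i : ℂ)))).trace := by
    have : Zᴴ * (diagonal (fun i => (k i : ℂ)) * (Wᴴ * U)
          - (Wᴴ * U) * diagonal (fun i => (l i : ℂ))) = (Zᴴ * Wᴴ * (σ - X)) * U := by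
      rw [← h'.diag_eq, ← h.diag_eq]
      have a1 : Wᴴ * σ * W * (Wᴴ * U) = Wᴴ * σ * U := by
        rw [Matrix.mul_assoc (Wᴴ * σ), ← Matrix.mul_assoc W, h'.mul_star, Matrix.one_mul]
      have a2 : Wᴴ * U * (Uᴴ * X * U) = Wᴴ * X * U := by
        rw [Matrix.mul_assoc Uᴴ, ← Matrix.mul_assoc (Wᴴ * U), Matrix.mul_assoc Wᴴ, h.mul_star,
          Matrix.mul_one, Matrix.mul_assoc]
      rw [a1, a2, ← Matrix.sub_mul, ← Matrix.mul_sub]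
      simp only [Matrix.mul_assoc]
    rw [this, trace_mul_comm _ U, conjTranspose_mul, conjTranspose_mul,
      conjTranspose_conjTranspose]
    simp only [Matrix.mul_assoc]
  have e2 : ((W * Z * Uᴴ)ᴴ * σ * (W * Z * Uᴴ)).trace
      = (Zᴴ * diagonal (fun i => (k i : ℂ)) * Z).trace := by
    rw [← h'.diag_eq, conjTranspose_mul, conjTranspose_mul, conjTranspose_conjTranspose]
    have : U * (Zᴴ * Wᴴ) * σ * (W * Z * Uᴴ) = (U * (Zᴴ * (Wᴴ * σ * W) * Z)) * Uᴴ := by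
      simp only [Matrix.mul_assoc]
    rw [this, trace_mul_comm, ← Matrix.mul_assoc, h.star_mul, Matrix.one_mul]
  have e3 : (W * Z * Uᴴ * X * (W * Z * Uᴴ)ᴴ).trace
      = (Zᴴᴴ * diagonal (fun i => (l i : ℂ)) * Zᴴ).trace := by
    rw [← h.diag_eq, conjTranspose_mul, conjTranspose_mul, conjTranspose_conjTranspose,
      conjTranspose_conjTranspose]
    have : W * Z * Uᴴ * X * (U * (Zᴴ * Wᴴ)) = (W * (Z * (Uᴴ * X * U) * Zᴴ)) * Wᴴ := by
      simp only [Matrix.mul_assoc]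
    rw [this, trace_mul_comm, ← Matrix.mul_assoc, h'.star_mul, Matrix.one_mul]
  have e4 : (Zᴴ * (diagonal (fun i => (k i : ℂ)) * (Wᴴ * U)
          - (Wᴴ * U) * diagonal (fun i => (l i : ℂ)))).trace.re
      = ∑ j, ∑ i, (k j - l i) * (star (Z j i) * (Wᴴ * U) j i).re := by
    rw [Finset.sum_comm]
    simp only [Matrix.trace, diag_apply, Matrix.mul_apply (M := Zᴴ), Complex.re_sum,
      Matrix.sub_apply, diagonal_mul, mul_diagonal, conjTranspose_apply]
    refine Finset.sum_congr rfl fun i _ => Finset.sum_congr rfl fun j _ => ?_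
    rw [show star (Z j i) * ((k j : ℂ) * (Wᴴ * U) j i - (Wᴴ * U) j i * (l i : ℂ))
      = ((k j - l i : ℝ) : ℂ) * (star (Z j i) * (Wᴴ * U) j i) by push_cast; ring,
      Complex.re_ofReal_mul]
  rw [dualFunctional, e1, e2, e3, e4, trace_conjTranspose_mul_diagonal,
    trace_conjTranspose_mul_diagonal, Finset.sum_comm (f := fun j i => l j * _), Finset.mul_sum,
    Finset.mul_sum]
  simp only [Finset.mul_sum, ← Finset.sum_sub_distrib]
  refine Finset.sum_congr rfl fun j _ => Finset.sum_congr rfl fun i _ => ?_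
  have : Complex.normSq (Zᴴ i j) = Complex.normSq (Z j i) := by
    rw [conjTranspose_apply]; exact Complex.normSq_conj _
  rw [this]
  ring

/-- Complete the square in `|c g - a z|² ≥ 0`. For `a = 0` the linear term must vanish too, and the
quotient on the right is zero by convention. -/
lemma two_mul_re_sub_le (z g : ℂ) {c a : ℝ} (ha : 0 ≤ a) (hc : a = 0 → c = 0) :
    2 * c * (star z * g).re - a * Complex.normSq z ≤ Complex.normSq g * (c ^ 2 / a) := by
  rcases ha.eq_or_lt with ha | ha
  · simp [hc ha.symm, ← ha]
  · have h1 : 0 ≤ Complex.normSq ((c : ℂ) * g - (a : ℂ) * z) := Complex.normSq_nonneg _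
    have h2 : Complex.normSq ((c : ℂ) * g - (a : ℂ) * z) = c ^ 2 * Complex.normSq g
        - 2 * c * a * (star z * g).re + a ^ 2 * Complex.normSq z := by
      simp [Complex.normSq_apply]; ring
    rw [h2] at h1
    rw [← mul_div_assoc, le_div_iff₀ ha]
    nlinarith

lemma dualFunctional_le (h : Diagonalizes U l X) (h' : Diagonalizes W k σ) (hl : ∀ i, 0 ≤ l i)
    (hk : ∀ j, 0 ≤ k j) (Y : Matrix n n ℂ) {t : ℝ} (ht : 0 < t) :
    dualFunctional Y X σ t ≤ quasiEntropy U l W k t := by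
  have hY : Y = W * (Wᴴ * Y * U) * Uᴴ := by
    calc Y = (W * Wᴴ) * Y * (U * Uᴴ) := by simp [h.mul_star, h'.mul_star]
      _ = _ := by simp only [Matrix.mul_assoc]
  rw [hY, dualFunctional_eq h h', quasiEntropy]
  refine Finset.sum_le_sum fun j _ => Finset.sum_le_sum fun i _ =>
    two_mul_re_sub_le _ _ (add_nonneg (hk j) (mul_nonneg ht.le (hl i))) fun h0 => ?_
  have h1 := mul_nonneg ht.le (hl i)
  have h2 : k j = 0 := by linarith [hk j]
  have h3 : t * l i = 0 := by linarith [hk j]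
  rw [h2, (mul_eq_zero.mp h3).resolve_left ht.ne', sub_zero]

lemma exists_dualFunctional_eq (h : Diagonalizes U l X) (h' : Diagonalizes W k σ)
    (t : ℝ) :
    ∃ Y, dualFunctional Y X σ t = quasiEntropy U l W k t := by
  -- The maximizer of each scalar problem. Where `k j + t * l i = 0`, the convention on division
  -- makes the entry and the quasi-entropy term zero.
  refine ⟨W * (Matrix.of fun j i => (((k j - l i) / (k j + t * l i) : ℝ) : ℂ) * (Wᴴ * U) j i) * Uᴴ,
    ?_⟩
  rw [dualFunctional_eq h h', quasiEntropy]
  refine Finset.sum_congr rfl fun j _ => Finset.sum_congr rfl fun i _ => ?_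
  rw [of_apply, Complex.normSq_mul, Complex.normSq_ofReal, overlap, star_mul',
    RCLike.star_def, Complex.conj_ofReal, mul_assoc (Complex.ofReal _),
    Complex.re_ofReal_mul, ← Complex.normSq_eq_conj_mul_self, Complex.ofReal_re]
  rcases eq_or_ne (k j + t * l i) 0 with h0 | h0
  · simp [h0]
  · field_simp
    ring

/-- A supremum of linear functionals is subadditive: the `Y` that is optimal for the sum is
admissible for each summand. -/
lemma quasiEntropy_sum_le {κ : Type*} [Fintype κ] {Xs σs Us Ws : κ → Matrix n n ℂ}
    {ls ks : κ → n → ℝ} (h : Diagonalizes U l (∑ x, Xs x)) (h' : Diagonalizes W k (∑ x, σs x))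
    (hs : ∀ x, Diagonalizes (Us x) (ls x) (Xs x)) (hs' : ∀ x, Diagonalizes (Ws x) (ks x) (σs x))
    (hls : ∀ x i, 0 ≤ ls x i) (hks : ∀ x j, 0 ≤ ks x j) {t : ℝ} (ht : 0 < t) :
    quasiEntropy U l W k t ≤ ∑ x, quasiEntropy (Us x) (ls x) (Ws x) (ks x) t := by
  obtain ⟨Y, hY⟩ := exists_dualFunctional_eq h h' t
  rw [← hY, dualFunctional_sum]
  exact Finset.sum_le_sum fun x _ => dualFunctional_le (hs x) (hs' x) (hls x) (hks x) Y ht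

/-- Joint convexity of the relative entropy. -/
lemma divergence_sum_le {κ : Type*} [Fintype κ] {Xs σs Us Ws : κ → Matrix n n ℂ}
    {ls ks : κ → n → ℝ} (h : Diagonalizes U l (∑ x, Xs x)) (h' : Diagonalizes W k (∑ x, σs x))
    (hs : ∀ x, Diagonalizes (Us x) (ls x) (Xs x)) (hs' : ∀ x, Diagonalizes (Ws x) (ks x) (σs x))
    (hl : ∀ i, 0 ≤ l i) (hk : ∀ j, 0 ≤ k j) (hls : ∀ x i, 0 ≤ ls x i) (hks : ∀ x j, 0 ≤ ks x j)
    (hS : SupportedOn (∑ x, Xs x) W k) (hSs : ∀ x, SupportedOn (Xs x) (Ws x) (ks x)) :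
    divergence U l W k ≤ ∑ x, divergence (Us x) (ls x) (Ws x) (ks x) := by
  simp only [← integral_quasiEntropy h hl hk hS,
    ← integral_quasiEntropy (hs _) (hls _) (hks _) (hSs _)]
  rw [← MeasureTheory.integral_finsetSum _ fun x _ =>
    integrableOn_quasiEntropy (hs x) (hls x) (hks x) (hSs x)]
  -- The inequality holds at every `t > 0` before integration.
  refine MeasureTheory.setIntegral_mono_on (integrableOn_quasiEntropy h hl hk hS)
    (MeasureTheory.integrable_finsetSum _ fun x _ =>
      integrableOn_quasiEntropy (hs x) (hls x) (hks x) (hSs x)) measurableSet_Ioi fun t ht => ?_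
  rw [← Finset.sum_div]
  exact div_le_div_of_nonneg_right (quasiEntropy_sum_le h h' hs hs' hls hks ht) (by positivity)

end Divergence

/-! ### Conditional entropy and strong subadditivity -/

section ConditionalEntropy

variable {B E κ : Type*} [Fintype B] [DecidableEq B] [Fintype E] [DecidableEq E]

/-- The partial trace over the first factor. -/
def trLeft (X : Matrix (B × E) (B × E) ℂ) : Matrix E E ℂ :=
  Matrix.of fun e e' => ∑ b, X (b, e) (b, e')

/-- The conditional entropy `S(BE) - S(E)`. -/
noncomputable def condEntropy (X : Matrix (B × E) (B × E) ℂ) : ℝ := entropy X - entropy (trLeft X)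

lemma trLeft_sum [Fintype κ] (X : κ → Matrix (B × E) (B × E) ℂ) :
    trLeft (∑ x, X x) = ∑ x, trLeft (X x) := by
  ext e e'
  simp only [trLeft, of_apply, Matrix.sum_apply]
  rw [Finset.sum_comm]

lemma trLeft_smul (c : ℂ) (X : Matrix (B × E) (B × E) ℂ) : trLeft (c • X) = c • trLeft X := by
  ext e e'
  simp [trLeft, Finset.mul_sum]

lemma trace_trLeft (X : Matrix (B × E) (B × E) ℂ) : (trLeft X).trace = X.trace := by
  simp only [Matrix.trace, diag_apply, trLeft, of_apply, Fintype.sum_prod_type]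
  rw [Finset.sum_comm]

lemma posSemidef_trLeft {X : Matrix (B × E) (B × E) ℂ} (h : X.PosSemidef) :
    (trLeft X).PosSemidef := by
  have : trLeft X = ∑ b, X.submatrix (fun e => (b, e)) (fun e => (b, e)) := by
    ext e e'; simp [trLeft, Matrix.sum_apply]
  rw [this]
  exact posSemidef_sum _ fun b _ => h.submatrix _

lemma conj_one_kronecker_diag (V : Matrix E E ℂ) (X : Matrix (B × E) (B × E) ℂ) (k : E) :
    (Vᴴ * trLeft X * V) k k
      = ∑ b, (((1 : Matrix B B ℂ) ⊗ₖ V)ᴴ * X * ((1 : Matrix B B ℂ) ⊗ₖ V)) (b, k) (b, k) := by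
  have h : ∀ b, (((1 : Matrix B B ℂ) ⊗ₖ V)ᴴ * X * ((1 : Matrix B B ℂ) ⊗ₖ V)) (b, k) (b, k)
      = ∑ e, ∑ e', star (V e' k) * X (b, e') (b, e) * V e k := by
    intro b
    simp only [Matrix.mul_apply, conjTranspose_apply, kroneckerMap_apply, Fintype.sum_prod_type,
      Finset.sum_mul, one_apply, ite_mul, mul_ite, one_mul, zero_mul, mul_zero, apply_ite star,
      star_zero, Finset.sum_ite_irrel, Finset.sum_const_zero, Finset.sum_ite_eq', Finset.mem_univ,
      if_true]
  simp only [h]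
  simp only [Matrix.mul_apply, conjTranspose_apply, trLeft, of_apply, Finset.sum_mul,
    Finset.mul_sum]
  rw [Finset.sum_comm (γ := B)]
  refine Finset.sum_congr rfl fun e _ => ?_
  rw [Finset.sum_comm]

/-- A kernel direction `e` of the marginal has `∑ b, ⟨b,e|X|b,e⟩ = 0` with nonnegative terms, so
each term vanishes. -/
lemma supportedOn_one_kronecker {X : Matrix (B × E) (B × E) ℂ} (hX : X.PosSemidef)
    {V : Matrix E E ℂ} {k : E → ℝ} (h : Diagonalizes V k (trLeft X)) :
    SupportedOn X ((1 : Matrix B B ℂ) ⊗ₖ V) (fun x => k x.2) := by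
  rintro ⟨b, e⟩ he
  have h1 := conj_one_kronecker_diag V X e
  rw [h.diag_eq, diagonal_apply_eq, show k e = 0 from he, Complex.ofReal_zero] at h1
  have h2 : ∀ b' ∈ Finset.univ, (0 : ℂ) ≤ (((1 : Matrix B B ℂ) ⊗ₖ V)ᴴ * X *
      ((1 : Matrix B B ℂ) ⊗ₖ V)) (b', e) (b', e) := fun b' _ =>
    (hX.conjTranspose_mul_mul_same _).diag_nonneg
  exact (Finset.sum_eq_zero_iff_of_nonneg h2).mp h1.symm b (Finset.mem_univ b)

lemma Diagonalizes.one_kronecker {σ V : Matrix E E ℂ} {k : E → ℝ} (h : Diagonalizes V k σ) :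
    Diagonalizes ((1 : Matrix B B ℂ) ⊗ₖ V) (fun x => k x.2) ((1 : Matrix B B ℂ) ⊗ₖ σ) := by
  simpa using diagonalizes_one.kronecker h

/-- Up to units and sign, the conditional entropy is the relative entropy of `X` to `1 ⊗ trLeft X`.
The last term corrects for the traces: `1 ⊗ trLeft X` has trace `|B| tr X`. -/
lemma condEntropy_eq_divergence {X U : Matrix (B × E) (B × E) ℂ} {V : Matrix E E ℂ}
    {l : B × E → ℝ} {k : E → ℝ} (h : Diagonalizes U l X) (h' : Diagonalizes V k (trLeft X)) :
    condEntropy X * Real.log 2 = -divergence U l ((1 : Matrix B B ℂ) ⊗ₖ V) (fun x => k x.2)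
      + (Fintype.card B - 1) * X.trace.re := by
  have h2 : Real.log 2 ≠ 0 := (Real.log_pos (by norm_num)).ne'
  have e1 : ∑ j : B × E, ((((1 : Matrix B B ℂ) ⊗ₖ V)ᴴ * X * ((1 : Matrix B B ℂ) ⊗ₖ V)) j j).re
      * Real.log (k j.2) = ∑ e, k e * Real.log (k e) := by
    rw [Fintype.sum_prod_type, Finset.sum_comm]
    refine Finset.sum_congr rfl fun e _ => ?_
    dsimp only
    rw [← Finset.sum_mul, ← Complex.re_sum, ← conj_one_kronecker_diag, h'.diag_eq]
    simp
  have e2 : ∑ j : B × E, k j.2 = Fintype.card B * ∑ e, k e := by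
    simp [Fintype.sum_prod_type]
  have e3 : ∑ e, k e = ∑ i, l i := by
    have := h'.trace_eq
    rw [trace_trLeft, h.trace_eq] at this
    exact_mod_cast this.symm
  rw [divergence_eq h h'.one_kronecker, e1, e2, e3, condEntropy, h.entropy_eq, h'.entropy_eq,
    h.trace_eq, Complex.ofReal_re]
  simp only [shannon_eq, Real.negMulLog, ← Finset.sum_div, neg_mul, Finset.sum_neg_distrib]
  field_simp
  ring

/-- Strong subadditivity: the conditional entropy is concave. -/
theorem sum_condEntropy_le [Fintype κ] {X : κ → Matrix (B × E) (B × E) ℂ}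
    (hX : ∀ x, (X x).PosSemidef) : ∑ x, condEntropy (X x) ≤ condEntropy (∑ x, X x) := by
  have hS : (∑ x, X x).PosSemidef := posSemidef_sum _ fun x _ => hX x
  have d := exists_diagonalizes hS.1
  have d' := exists_diagonalizes (posSemidef_trLeft hS).1
  have ds := fun x => exists_diagonalizes (hX x).1
  have ds' := fun x => exists_diagonalizes (posSemidef_trLeft (hX x)).1
  -- The reference operator is linear in `X`, so joint convexity applies to the pair.
  have hσ : (1 : Matrix B B ℂ) ⊗ₖ trLeft (∑ x, X x) = ∑ x, (1 : Matrix B B ℂ) ⊗ₖ trLeft (X x) := by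
    rw [trLeft_sum]
    ext i j
    simp [Matrix.sum_apply, kroneckerMap_apply, Finset.mul_sum]
  have key := divergence_sum_le d (hσ ▸ d'.one_kronecker) ds (fun x => (ds' x).one_kronecker)
    hS.eigenvalues_nonneg (fun j => (posSemidef_trLeft hS).eigenvalues_nonneg j.2)
    (fun x => (hX x).eigenvalues_nonneg)
    (fun x j => (posSemidef_trLeft (hX x)).eigenvalues_nonneg j.2)
    (supportedOn_one_kronecker hS d') (fun x => supportedOn_one_kronecker (hX x) (ds' x))
  have h2 : 0 < Real.log 2 := Real.log_pos (by norm_num)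
  refine le_of_mul_le_mul_right ?_ h2
  rw [Finset.sum_mul, condEntropy_eq_divergence d d']
  simp only [condEntropy_eq_divergence (ds _) (ds' _), Finset.sum_add_distrib,
    Finset.sum_neg_distrib, ← Finset.mul_sum, ← Complex.re_sum, ← trace_sum]
  linarith

lemma condEntropy_smul {X : Matrix (B × E) (B × E) ℂ} (hX : X.PosSemidef) (c : ℝ) :
    condEntropy ((c : ℂ) • X) = c * condEntropy X := by
  rw [condEntropy, condEntropy, trLeft_smul, entropy_smul hX.1,
    entropy_smul (posSemidef_trLeft hX).1, trace_trLeft]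
  ring

end ConditionalEntropy

/-! ### Concavity of the entropy -/

section Concavity

variable {n κ : Type*} [Fintype n] [DecidableEq n] [Fintype κ]

/-- A component of positive weight cannot leave the support of the mixture, since all terms of the
vanishing diagonal entry are nonnegative. -/
lemma supportedOn_of_sum {X : κ → Matrix n n ℂ} (hX : ∀ x, (X x).PosSemidef) {p : κ → ℝ}
    (hp : ∀ x, 0 ≤ p x) {W : Matrix n n ℂ} {k : n → ℝ}
    (h : Diagonalizes W k (∑ x, (p x : ℂ) • X x)) {x : κ} (hx : 0 < p x) :
    SupportedOn (X x) W k := by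
  intro j hj
  have h1 := congrFun (congrFun h.diag_eq j) j
  rw [diagonal_apply_eq, hj, Complex.ofReal_zero, Matrix.mul_sum, Matrix.sum_mul,
    Matrix.sum_apply] at h1
  simp only [Matrix.mul_smul, Matrix.smul_mul, Matrix.smul_apply, smul_eq_mul] at h1
  have h2 := (Finset.sum_eq_zero_iff_of_nonneg fun y _ => mul_nonneg
    (Complex.zero_le_real.mpr (hp y)) ((hX y).conjTranspose_mul_mul_same W).diag_nonneg).mp h1 x
    (Finset.mem_univ x)
  exact (mul_eq_zero.mp h2).resolve_left (by exact_mod_cast hx.ne')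

lemma isDensity_sum {p : κ → ℝ} (hp : ∀ x, 0 ≤ p x) (hp1 : ∑ x, p x = 1) {X : κ → Matrix n n ℂ}
    (hX : ∀ x, IsDensity (X x)) : IsDensity (∑ x, (p x : ℂ) • X x) := by
  refine ⟨posSemidef_sum _ fun x _ => (hX x).1.smul (Complex.zero_le_real.mpr (hp x)), ?_⟩
  simp only [trace_sum, trace_smul, (hX _).2, smul_eq_mul, mul_one]
  exact_mod_cast hp1

/-- Concavity of the entropy. -/
theorem sum_entropy_le {p : κ → ℝ} (hp : ∀ x, 0 ≤ p x) (hp1 : ∑ x, p x = 1) {X : κ → Matrix n n ℂ}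
    (hX : ∀ x, IsDensity (X x)) : ∑ x, p x * entropy (X x) ≤ entropy (∑ x, (p x : ℂ) • X x) := by
  have hS := isDensity_sum hp hp1 hX
  have d := exists_diagonalizes hS.1.1
  -- Klein's inequality against the eigenbasis of the average state. The right side is linear in `X
  -- x`, so its mean is exactly the entropy of the average.
  have h1 : ∀ x, p x * entropy (X x) ≤ p x * -∑ j, (((hS.1.1.eigenvectorUnitary : Matrix n n ℂ)ᴴ *
      X x * (hS.1.1.eigenvectorUnitary : Matrix n n ℂ)) j j).re *
        Real.logb 2 (hS.1.1.eigenvalues j) := by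
    intro x
    rcases (hp x).eq_or_lt with h0 | h0
    · simp [← h0]
    · refine mul_le_mul_of_nonneg_left ?_ h0.le
      refine neg_sum_mul_log_le (exists_diagonalizes (hX x).1.1) d (hX x).1.eigenvalues_nonneg
        hS.1.eigenvalues_nonneg (supportedOn_of_sum (fun x => (hX x).1) hp d h0) ?_
      rw [hS.sum_eigenvalues, (hX x).sum_eigenvalues]
  refine (Finset.sum_le_sum fun x _ => h1 x).trans_eq ?_
  rw [d.entropy_eq]
  simp only [mul_neg, Finset.mul_sum, Finset.sum_neg_distrib, shannon]
  congr 1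
  rw [Finset.sum_comm]
  refine Finset.sum_congr rfl fun j _ => ?_
  have h2 := congrArg Complex.re (congrFun (congrFun d.diag_eq j) j)
  rw [diagonal_apply_eq, Complex.ofReal_re, Matrix.mul_sum, Matrix.sum_mul, Matrix.sum_apply,
    Complex.re_sum] at h2
  rw [← h2, Finset.sum_mul]
  refine Finset.sum_congr rfl fun x _ => ?_
  rw [Matrix.mul_smul, Matrix.smul_mul, Matrix.smul_apply, smul_eq_mul, Complex.re_ofReal_mul,
    ← mul_assoc]

end Concavity

/-! ### Kraus operators and the action on purifications -/

section Ampliate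

variable {A B E F : Type*}

@[simp] lemma ketbra_apply (ψ : A → ℂ) (a a' : A) : ketbra ψ a a' = ψ a * star (ψ a') := rfl

lemma posSemidef_ketbra [Fintype A] (ψ : A → ℂ) : (ketbra ψ).PosSemidef :=
  posSemidef_vecMulVec_self_star ψ

lemma ketbra_smul (c : ℂ) (ψ : A → ℂ) :
    ketbra (c • ψ) = ((Complex.normSq c : ℝ) : ℂ) • ketbra ψ := by
  ext a a'
  simp [← Complex.mul_conj]
  ring

lemma ampliate_apply (Φ : Matrix A A ℂ →ₗ[ℂ] Matrix B B ℂ) (X : Matrix (A × E) (A × E) ℂ)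
    (x y : B × E) :
    ampliate Φ E X x y = Φ (Matrix.of fun a a' => X (a, x.2) (a', y.2)) x.1 y.1 := rfl

lemma ampliate_smul (Φ : Matrix A A ℂ →ₗ[ℂ] Matrix B B ℂ) (c : ℂ)
    (X : Matrix (A × E) (A × E) ℂ) : ampliate Φ E (c • X) = c • ampliate Φ E X := by
  ext x y
  rw [ampliate_apply, Matrix.smul_apply, ampliate_apply, ← Matrix.smul_apply, ← map_smul]
  rfl

variable [Fintype A] [DecidableEq A] [Fintype B] [DecidableEq B] [Fintype E] [DecidableEq E]

/-- `K` is a family of Kraus operators of `Φ`. -/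
def IsKraus {R : Type*} [Fintype R] (K : R → Matrix B A ℂ)
    (Φ : Matrix A A ℂ →ₗ[ℂ] Matrix B B ℂ) : Prop :=
  ∀ X, Φ X = ∑ r, K r * X * (K r)ᴴ

variable {Φ : Matrix A A ℂ →ₗ[ℂ] Matrix B B ℂ}

lemma map_apply_eq_sum (Φ : Matrix A A ℂ →ₗ[ℂ] Matrix B B ℂ) (X : Matrix A A ℂ) (b b' : B) :
    Φ X b b' = ∑ a, ∑ a', X a a' * Φ (single a a' 1) b b' := by
  conv_lhs => rw [matrix_eq_sum_single X]
  rw [map_sum, Matrix.sum_apply]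
  refine Finset.sum_congr rfl fun a _ => ?_
  rw [map_sum, Matrix.sum_apply]
  refine Finset.sum_congr rfl fun a' _ => ?_
  rw [← smul_eq_mul, ← Matrix.smul_apply, ← map_smul, smul_single, smul_eq_mul, mul_one]

/-- Choi's theorem: apply `Φ` to half of the unnormalized maximally entangled vector; the
eigenvectors of the result, scaled by the roots of the eigenvalues, are Kraus operators. They give
positivity for every finite reference system, not only `Fin k`. -/
lemma IsChannel.exists_isKraus (h : IsChannel Φ) :
    ∃ K : B × Fin (Fintype.card A) → Matrix B A ℂ, IsKraus K Φ := by
  let e := Fintype.equivFin A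
  have h1 := h.completely_positive _ (ketbra fun x : A × Fin (Fintype.card A) =>
    if e x.1 = x.2 then 1 else 0) (posSemidef_ketbra _)
  obtain ⟨U, hd⟩ : ∃ U, Diagonalizes U h1.1.eigenvalues _ := ⟨_, exists_diagonalizes h1.1⟩
  set l := h1.1.eigenvalues
  refine ⟨fun r => Matrix.of fun b a => (Real.sqrt (l r) : ℂ) * U (b, e a) r, fun X => ?_⟩
  have h2 : ∀ a a' b b', Φ (single a a' 1) b b'
      = ∑ r, (l r : ℂ) * U (b, e a) r * star (U (b', e a') r) := by
    intro a a' b b'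
    have h3 := congrFun (congrFun hd.eq (b, e a)) (b', e a')
    rw [Matrix.mul_apply] at h3
    simp only [mul_diagonal, conjTranspose_apply, ampliate_apply] at h3
    convert h3 using 1
    · refine congrArg (fun M => Φ M b b') ?_
      ext x y
      simp only [of_apply, ketbra_apply, EmbeddingLike.apply_eq_iff_eq, single_apply]
      by_cases hx : a = x <;> by_cases hy : a' = y <;> simp [hx, hy, eq_comm]
    · exact Finset.sum_congr rfl fun r _ => by ring
  ext b b'
  rw [map_apply_eq_sum, Matrix.sum_apply]
  simp only [h2, Matrix.mul_apply, conjTranspose_apply, of_apply, Finset.sum_mul, Finset.mul_sum]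
  rw [Finset.sum_congr rfl fun a _ => Finset.sum_comm, Finset.sum_comm]
  refine Finset.sum_congr rfl fun r _ => ?_
  rw [Finset.sum_comm]
  refine Finset.sum_congr rfl fun a' _ => Finset.sum_congr rfl fun a _ => ?_
  have h4 : (l r : ℂ) = (Real.sqrt (l r) : ℂ) * (Real.sqrt (l r) : ℂ) := by
    rw [← Complex.ofReal_mul, Real.mul_self_sqrt (h1.eigenvalues_nonneg r)]
  rw [h4, star_mul', RCLike.star_def, Complex.conj_ofReal]
  ring

lemma IsKraus.ampliate {R : Type*} [Fintype R] {K : R → Matrix B A ℂ} (h : IsKraus K Φ)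
    (X : Matrix (A × E) (A × E) ℂ) :
    ampliate Φ E X = ∑ r, (K r ⊗ₖ (1 : Matrix E E ℂ)) * X * (K r ⊗ₖ (1 : Matrix E E ℂ))ᴴ := by
  ext ⟨b, e⟩ ⟨b', e'⟩
  rw [ampliate_apply, h, Matrix.sum_apply, Matrix.sum_apply]
  refine Finset.sum_congr rfl fun r _ => ?_
  simp only [Matrix.mul_apply, conjTranspose_apply, kroneckerMap_apply, Fintype.sum_prod_type,
    one_apply, ite_mul, mul_ite, zero_mul, mul_zero, mul_one, apply_ite star,
    star_zero, Finset.sum_ite_eq, Finset.mem_univ, if_true, of_apply]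

lemma IsKraus.posSemidef_ampliate {R : Type*} [Fintype R] {K : R → Matrix B A ℂ}
    (h : IsKraus K Φ) {X : Matrix (A × E) (A × E) ℂ} (hX : X.PosSemidef) :
    (CECapacity.ampliate Φ E X).PosSemidef := by
  rw [h.ampliate]
  exact posSemidef_sum _ fun r _ => hX.mul_mul_conjTranspose_same _

lemma IsKraus.isChannel {R : Type*} [Fintype R] {K : R → Matrix B A ℂ} (h : IsKraus K Φ)
    (ht : ∀ X, (Φ X).trace = X.trace) : IsChannel Φ where
  completely_positive _ _ hX := h.posSemidef_ampliate hX
  trace_preserving := ht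

lemma IsChannel.posSemidef_ampliate (h : IsChannel Φ) {X : Matrix (A × E) (A × E) ℂ}
    (hX : X.PosSemidef) : (ampliate Φ E X).PosSemidef :=
  h.exists_isKraus.choose_spec.posSemidef_ampliate hX

lemma IsChannel.posSemidef (h : IsChannel Φ) {X : Matrix A A ℂ} (hX : X.PosSemidef) :
    (Φ X).PosSemidef := by
  obtain ⟨K, hK⟩ := h.exists_isKraus
  rw [hK]
  exact posSemidef_sum _ fun r _ => hX.mul_mul_conjTranspose_same _

lemma IsChannel.isDensity (h : IsChannel Φ) {ρ : Matrix A A ℂ} (hρ : IsDensity ρ) :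
    IsDensity (Φ ρ) :=
  ⟨h.posSemidef hρ.1, by rw [h.trace_preserving, hρ.2]⟩

lemma IsChannel.trLeft_ampliate (h : IsChannel Φ) (X : Matrix (A × E) (A × E) ℂ) :
    trLeft (ampliate Φ E X) = trLeft X := by
  ext e e'
  exact h.trace_preserving (Matrix.of fun a a' => X (a, e) (a', e'))

lemma IsChannel.isDensity_ampliate (h : IsChannel Φ) {X : Matrix (A × E) (A × E) ℂ}
    (hX : IsDensity X) : IsDensity (ampliate Φ E X) :=
  ⟨h.posSemidef_ampliate hX.1, by rw [← trace_trLeft, h.trLeft_ampliate, trace_trLeft, hX.2]⟩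

/-- The reduced state on `A` of the vector `ψ` of `A ⊗ E`. -/
def margin (ψ : A × E → ℂ) : Matrix A A ℂ := Matrix.of fun a a' => ∑ e, ketbra ψ (a, e) (a', e)

lemma isPurification_iff {ψ : A × E → ℂ} {ρ : Matrix A A ℂ} :
    IsPurification ψ ρ ↔ margin ψ = ρ :=
  ⟨fun h => by ext a a'; exact h a a', fun h a a' => by rw [← h]; rfl⟩

lemma margin_eq (ψ : A × E → ℂ) :
    margin ψ = (Matrix.of fun a e => ψ (a, e)) * (Matrix.of fun a e => ψ (a, e))ᴴ := by
  ext a a'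
  simp [margin, Matrix.mul_apply]

lemma trLeft_ketbra_eq (ψ : A × E → ℂ) : trLeft (ketbra ψ)
    = ((Matrix.of fun a e => ψ (a, e))ᴴ * (Matrix.of fun a e => ψ (a, e)))ᵀ := by
  ext e e'
  simp [trLeft, Matrix.mul_apply, mul_comm]

lemma posSemidef_margin (ψ : A × E → ℂ) : (margin ψ).PosSemidef := by
  rw [margin_eq]; exact posSemidef_self_mul_conjTranspose _

lemma entropy_margin (ψ : A × E → ℂ) : entropy (margin ψ) = entropy (trLeft (ketbra ψ)) := by
  rw [margin_eq, trLeft_ketbra_eq, entropy_transpose (isHermitian_conjTranspose_mul_self _),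
    entropy_mul_conjTranspose]

lemma trace_margin (ψ : A × E → ℂ) : (margin ψ).trace = (ketbra ψ).trace := by
  simp [Matrix.trace, margin, Fintype.sum_prod_type]

lemma isDensity_margin_iff {ψ : A × E → ℂ} : IsDensity (margin ψ) ↔ IsDensity (ketbra ψ) := by
  simp [IsDensity, posSemidef_margin, posSemidef_ketbra, trace_margin]

lemma isDensity_trLeft_ketbra_iff {ψ : A × E → ℂ} :
    IsDensity (trLeft (ketbra ψ)) ↔ IsDensity (ketbra ψ) := by
  simp [IsDensity, posSemidef_trLeft, posSemidef_ketbra, trace_trLeft]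

/-- The channel does not touch the reference state, whose entropy is that of the input. This turns
every expression of the problem into a conditional entropy. -/
lemma IsChannel.condEntropy_ampliate (h : IsChannel Φ) (ψ : A × E → ℂ) :
    condEntropy (ampliate Φ E (ketbra ψ))
      = entropy (ampliate Φ E (ketbra ψ)) - entropy (margin ψ) := by
  rw [condEntropy, h.trLeft_ampliate, entropy_margin]

lemma IsChannel.le_condEntropy_ampliate (h : IsChannel Φ) {ψ : A × E → ℂ}
    (hψ : IsDensity (margin ψ)) :
    -Real.logb 2 (Fintype.card A) ≤ condEntropy (ampliate Φ E (ketbra ψ)) := by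
  rw [h.condEntropy_ampliate]
  linarith [entropy_nonneg (h.isDensity_ampliate (isDensity_margin_iff.mp hψ)),
    entropy_le_logb_card hψ]

end Ampliate

/-! ### Invariance under relabelling of bases -/

section Reindex

variable {A B A' B' E F : Type*} [Fintype A] [DecidableEq A] [Fintype B] [DecidableEq B]
  [Fintype A'] [DecidableEq A'] [Fintype B'] [DecidableEq B']
  [Fintype E] [DecidableEq E] [Fintype F] [DecidableEq F]

/-- `Φ'` is the map `Φ` after a relabelling of the input and output bases. -/
def IsRelabelling (α : A' ≃ A) (β : B' ≃ B) (Φ : Matrix A A ℂ →ₗ[ℂ] Matrix B B ℂ)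
    (Φ' : Matrix A' A' ℂ →ₗ[ℂ] Matrix B' B' ℂ) : Prop :=
  ∀ X, Φ' (X.submatrix α α) = (Φ X).submatrix β β

lemma margin_comp (α : A' ≃ A) (f : F ≃ E) (ψ : A × E → ℂ) :
    margin (ψ ∘ Prod.map α f) = (margin ψ).submatrix α α := by
  ext a a'
  simp only [margin, of_apply, submatrix_apply, ketbra_apply, Function.comp_apply, Prod.map_apply]
  exact f.sum_comp (fun e => ψ (α a, e) * star (ψ (α a', e)))

lemma isDensity_submatrix (α : A' ≃ A) {ρ : Matrix A A ℂ} :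
    IsDensity (ρ.submatrix α α) ↔ IsDensity ρ := by
  have h1 : (ρ.submatrix α α).trace = ρ.trace := α.sum_comp fun a => ρ a a
  rw [IsDensity, IsDensity, posSemidef_submatrix_equiv, h1]

lemma trLeft_submatrix (α : A' ≃ A) (f : F ≃ E) (X : Matrix (A × E) (A × E) ℂ) :
    trLeft (X.submatrix (Prod.map α f) (Prod.map α f)) = (trLeft X).submatrix f f := by
  ext e e'
  simp only [trLeft, of_apply, submatrix_apply, Prod.map_apply]
  exact α.sum_comp (fun b => X (b, f e) (b, f e'))

lemma condEntropy_submatrix (α : A' ≃ A) (f : F ≃ E) {X : Matrix (A × E) (A × E) ℂ}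
    (hX : X.PosSemidef) :
    condEntropy (X.submatrix (Prod.map α f) (Prod.map α f)) = condEntropy X := by
  rw [condEntropy, condEntropy, trLeft_submatrix, entropy_submatrix f (posSemidef_trLeft hX).1]
  congr 1
  exact entropy_submatrix (α.prodCongr f) hX.1

variable {Φ : Matrix A A ℂ →ₗ[ℂ] Matrix B B ℂ} {Φ' : Matrix A' A' ℂ →ₗ[ℂ] Matrix B' B' ℂ}
  {α : A' ≃ A} {β : B' ≃ B}

lemma isRelabelling_refl (Φ : Matrix A A ℂ →ₗ[ℂ] Matrix B B ℂ) :
    IsRelabelling (Equiv.refl A) (Equiv.refl B) Φ Φ := fun _ => rfl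

lemma IsRelabelling.symm (h : IsRelabelling α β Φ Φ') : IsRelabelling α.symm β.symm Φ' Φ := by
  intro X
  have h1 := h (X.submatrix α.symm α.symm)
  rw [submatrix_submatrix] at h1
  simp only [Equiv.symm_comp_self, submatrix_id_id] at h1
  rw [h1, submatrix_submatrix]
  simp

lemma IsRelabelling.ampliate (h : IsRelabelling α β Φ Φ') (f : F ≃ E) (ψ : A × E → ℂ) :
    ampliate Φ' F (ketbra (ψ ∘ Prod.map α f))
      = (CECapacity.ampliate Φ E (ketbra ψ)).submatrix (Prod.map β f) (Prod.map β f) := by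
  ext x y
  rw [ampliate_apply, submatrix_apply, ampliate_apply]
  exact congrFun (congrFun (h (Matrix.of fun a a' => ketbra ψ (a, f x.2) (a', f y.2))) x.1) y.1

lemma IsRelabelling.condEntropy (h : IsRelabelling α β Φ Φ') (hΦ : IsChannel Φ) (f : F ≃ E)
    (ψ : A × E → ℂ) : condEntropy (CECapacity.ampliate Φ' F (ketbra (ψ ∘ Prod.map α f)))
      = condEntropy (CECapacity.ampliate Φ E (ketbra ψ)) := by
  rw [h.ampliate, condEntropy_submatrix β f (hΦ.posSemidef_ampliate (posSemidef_ketbra ψ))]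

end Reindex

/-! ### The sets of values behind the capacities -/

section Values

variable {A B A' B' : Type*} [Fintype A] [DecidableEq A] [Fintype B] [DecidableEq B]
  [Fintype A'] [DecidableEq A'] [Fintype B'] [DecidableEq B']
  {Φ : Matrix A A ℂ →ₗ[ℂ] Matrix B B ℂ} {Φ' : Matrix A' A' ℂ →ₗ[ℂ] Matrix B' B' ℂ}
  {α : A' ≃ A} {β : B' ≃ B}

/-- The values of the conditional entropy whose infimum is the minimal entropy gap. -/
def gapValues (Φ : Matrix A A ℂ →ₗ[ℂ] Matrix B B ℂ) (P : ℝ) : Set ℝ :=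
  {x | ∃ (k : ℕ) (ψ : A × Fin k → ℂ), IsDensity (margin ψ) ∧ entropy (margin ψ) ≤ P ∧
    x = condEntropy (ampliate Φ (Fin k) (ketbra ψ))}

lemma IsChannel.minEntropyGap_eq (h : IsChannel Φ) (P : ℝ) :
    minEntropyGap Φ P = sInf (gapValues Φ P) := by
  rw [minEntropyGap]
  congr 1
  ext x
  constructor
  · rintro ⟨ρ, k, ψ, hρ, hψ, hP, rfl⟩
    rw [isPurification_iff] at hψ
    subst hψ
    exact ⟨k, ψ, hρ, hP, (h.condEntropy_ampliate ψ).symm⟩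
  · rintro ⟨k, ψ, hρ, hP, rfl⟩
    exact ⟨_, k, ψ, hρ, isPurification_iff.mpr rfl, hP, h.condEntropy_ampliate ψ⟩

lemma IsChannel.bddBelow_gapValues (h : IsChannel Φ) (P : ℝ) : BddBelow (gapValues Φ P) := by
  refine ⟨-Real.logb 2 (Fintype.card A), ?_⟩
  rintro x ⟨k, ψ, hρ, hP, rfl⟩
  exact h.le_condEntropy_ampliate hρ

/-- Allows arbitrary finite reference systems and relabelled channels, such as powers indexed by a
subset of the uses, where the definition asks for `Fin k`. -/
lemma IsRelabelling.condEntropy_mem_gapValues (hr : IsRelabelling α β Φ Φ') (h : IsChannel Φ)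
    {E : Type*} [Fintype E] [DecidableEq E] {P : ℝ} {ψ : A × E → ℂ} (hψ : IsDensity (margin ψ))
    (hP : entropy (margin ψ) ≤ P) :
    CECapacity.condEntropy (CECapacity.ampliate Φ E (ketbra ψ)) ∈ gapValues Φ' P := by
  let f := (Fintype.equivFin E).symm
  refine ⟨Fintype.card E, ψ ∘ Prod.map α f, ?_, ?_, (hr.condEntropy h f ψ).symm⟩
  · rwa [margin_comp, isDensity_submatrix]
  · rwa [margin_comp, entropy_submatrix α (posSemidef_margin ψ).1]

/-- The values of the expression whose supremum is the assisted capacity. -/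
def assistedValues (Φ : Matrix A A ℂ →ₗ[ℂ] Matrix B B ℂ) (P : ℝ) : Set ℝ :=
  {x | ∃ (m : ℕ) (p : Fin m → ℝ) (k : Fin m → ℕ) (ψ : ∀ i, A × Fin (k i) → ℂ),
    (∀ i, 0 ≤ p i) ∧ ∑ i, p i = 1 ∧ (∀ i, IsDensity (margin (ψ i))) ∧
    ∑ i, p i * entropy (margin (ψ i)) ≤ P ∧
    x = entropy (Φ (∑ i, (p i : ℂ) • margin (ψ i)))
      - ∑ i, p i * condEntropy (ampliate Φ (Fin (k i)) (ketbra (ψ i)))}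

lemma IsChannel.oneShotAssisted_eq (h : IsChannel Φ) (P : ℝ) :
    oneShotAssisted Φ P = sSup (assistedValues Φ P) := by
  rw [oneShotAssisted]
  congr 1
  ext x
  constructor
  · rintro ⟨m, p, ρ, k, ψ, hρ, hψ, hP, rfl⟩
    simp only [isPurification_iff] at hψ
    obtain rfl : (fun i => margin (ψ i)) = ρ := funext hψ
    refine ⟨m, p, k, ψ, hρ.nonneg, hρ.sum_eq_one, hρ.density, hP, ?_⟩
    simp only [h.condEntropy_ampliate, mul_sub, Finset.sum_sub_distrib]
    ring
  · rintro ⟨m, p, k, ψ, h0, h1, hd, hP, rfl⟩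
    refine ⟨m, p, fun i => margin (ψ i), k, ψ, ⟨h0, h1, hd⟩, fun i => isPurification_iff.mpr rfl,
      hP, ?_⟩
    simp only [h.condEntropy_ampliate, mul_sub, Finset.sum_sub_distrib]
    ring

/-- Likewise for ensembles: any finite index type and any finite reference systems may be used. -/
lemma IsRelabelling.mem_assistedValues (hr : IsRelabelling α β Φ Φ') (h : IsChannel Φ)
    {ι : Type*} [Fintype ι] {E : ι → Type*} [∀ i, Fintype (E i)] [∀ i, DecidableEq (E i)]
    {P : ℝ} {p : ι → ℝ} {ψ : ∀ i, A × E i → ℂ} (hp : ∀ i, 0 ≤ p i) (hp1 : ∑ i, p i = 1)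
    (hψ : ∀ i, IsDensity (margin (ψ i))) (hP : ∑ i, p i * entropy (margin (ψ i)) ≤ P) :
    entropy (Φ (∑ i, (p i : ℂ) • margin (ψ i)))
      - ∑ i, p i * CECapacity.condEntropy (CECapacity.ampliate Φ (E i) (ketbra (ψ i)))
        ∈ assistedValues Φ' P := by
  let g := (Fintype.equivFin ι).symm
  let f := fun i => (Fintype.equivFin (E i)).symm
  refine ⟨Fintype.card ι, p ∘ g, fun i => Fintype.card (E (g i)),
    fun i => ψ (g i) ∘ Prod.map α (f (g i)), fun i => hp _, ?_, fun i => ?_, ?_, ?_⟩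
  · rw [← hp1]; exact g.sum_comp p
  · rw [margin_comp, isDensity_submatrix]; exact hψ _
  · simp only [margin_comp, entropy_submatrix α (posSemidef_margin _).1]
    rw [← g.sum_comp] at hP
    exact hP
  · simp only [hr.condEntropy h, margin_comp, Function.comp_apply]
    rw [g.sum_comp (fun i => p i * CECapacity.condEntropy
      (CECapacity.ampliate Φ (E i) (ketbra (ψ i)))),
      g.sum_comp (fun i => (p i : ℂ) • (margin (ψ i)).submatrix α α)]
    have h2 : ∑ i, (p i : ℂ) • (margin (ψ i)).submatrix α α
        = (∑ i, (p i : ℂ) • margin (ψ i)).submatrix α α := by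
      ext a a'; simp [Matrix.sum_apply]
    rw [h2, hr, entropy_submatrix]
    exact (h.isDensity (isDensity_sum hp hp1 hψ)).1.1

lemma IsChannel.bddAbove_assistedValues (h : IsChannel Φ) (P : ℝ) :
    BddAbove (assistedValues Φ P) := by
  refine ⟨Real.logb 2 (Fintype.card B) + Real.logb 2 (Fintype.card A), ?_⟩
  rintro x ⟨m, p, k, ψ, h0, h1, hd, hP, rfl⟩
  have e1 := entropy_le_logb_card (h.isDensity (isDensity_sum h0 h1 hd))
  have e2 : ∑ i, p i * -Real.logb 2 (Fintype.card A)
      ≤ ∑ i, p i * condEntropy (ampliate Φ (Fin (k i)) (ketbra (ψ i))) :=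
    Finset.sum_le_sum fun i _ =>
      mul_le_mul_of_nonneg_left (h.le_condEntropy_ampliate (hd i)) (h0 i)
  rw [← Finset.sum_mul, h1] at e2
  linarith

lemma IsRelabelling.assistedValues_subset (hr : IsRelabelling α β Φ Φ') (h : IsChannel Φ) (P : ℝ) :
    assistedValues Φ P ⊆ assistedValues Φ' P := by
  rintro x ⟨m, p, k, ψ, h0, h1, hd, hP, rfl⟩
  exact hr.mem_assistedValues h h0 h1 hd hP

lemma IsRelabelling.oneShotAssisted_eq (hr : IsRelabelling α β Φ Φ') (h : IsChannel Φ)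
    (h' : IsChannel Φ') (P : ℝ) : oneShotAssisted Φ P = oneShotAssisted Φ' P := by
  rw [h.oneShotAssisted_eq, h'.oneShotAssisted_eq]
  exact congrArg sSup ((hr.assistedValues_subset h P).antisymm (hr.symm.assistedValues_subset h' P))

end Values

/-! ### Tensor powers over arbitrary index types -/

section WordMap

variable {A B : Type*} [Fintype A] [DecidableEq A] [Fintype B] [DecidableEq B]

/-- The tensor power `Φ^{⊗ ι}` for an arbitrary finite index type `ι`. -/
def wordMap (Φ : Matrix A A ℂ →ₗ[ℂ] Matrix B B ℂ) (ι : Type*) [Fintype ι] [DecidableEq ι] :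
    Matrix (ι → A) (ι → A) ℂ →ₗ[ℂ] Matrix (ι → B) (ι → B) ℂ where
  toFun X := Matrix.of fun b b' => ∑ a : ι → A, ∑ a' : ι → A,
    X a a' * ∏ i, Φ (Matrix.single (a i) (a' i) (1 : ℂ)) (b i) (b' i)
  map_add' X Y := by
    ext b b'
    simp [add_mul, Finset.sum_add_distrib]
  map_smul' c X := by
    ext b b'
    simp [Finset.mul_sum, mul_assoc]

lemma tensorPower_eq_wordMap (Φ : Matrix A A ℂ →ₗ[ℂ] Matrix B B ℂ) (n : ℕ) :
    tensorPower Φ n = wordMap Φ (Fin n) := rfl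

variable {ι ι' : Type*} [Fintype ι] [DecidableEq ι] [Fintype ι'] [DecidableEq ι']

lemma wordMap_apply (Φ : Matrix A A ℂ →ₗ[ℂ] Matrix B B ℂ) (X : Matrix (ι → A) (ι → A) ℂ)
    (b b' : ι → B) : wordMap Φ ι X b b' = ∑ a : ι → A, ∑ a' : ι → A,
      X a a' * ∏ i, Φ (Matrix.single (a i) (a' i) (1 : ℂ)) (b i) (b' i) := rfl

lemma IsKraus.wordMap {Φ : Matrix A A ℂ →ₗ[ℂ] Matrix B B ℂ} {R : Type*} [Fintype R]
    {K : R → Matrix B A ℂ} (h : IsKraus K Φ) :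
    IsKraus (fun r : ι → R => piMat fun i => K (r i)) (wordMap Φ ι) := by
  intro X
  ext b b'
  have h1 : ∀ a a' b b', Φ (single a a' 1) b b' = ∑ r, K r b a * star (K r b' a') := by
    intro a a' b b'
    rw [h, Matrix.sum_apply]
    refine Finset.sum_congr rfl fun r _ => ?_
    rw [Matrix.mul_apply, Finset.sum_eq_single a']
    · simp [conjTranspose_apply]
    · intro x _ hx
      rw [mul_single_apply_of_ne (hbj := hx), zero_mul]
    · simp
  rw [wordMap_apply, Matrix.sum_apply]
  simp only [h1, Fintype.prod_sum, Matrix.mul_apply, conjTranspose_apply, piMat_apply,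
    Finset.mul_sum, Finset.sum_mul, Finset.prod_mul_distrib, star_prod]
  rw [Finset.sum_congr rfl fun a _ => Finset.sum_comm, Finset.sum_comm]
  refine Finset.sum_congr rfl fun r _ => ?_
  rw [Finset.sum_comm]
  exact Finset.sum_congr rfl fun a' _ => Finset.sum_congr rfl fun a _ => by ring

lemma IsChannel.trace_single {Φ : Matrix A A ℂ →ₗ[ℂ] Matrix B B ℂ} (h : IsChannel Φ) (a a' : A) :
    ∑ b, Φ (single a a' 1) b b = if a = a' then 1 else 0 := by
  have h1 := h.trace_preserving (single a a' 1)
  rw [Matrix.trace] at h1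
  simp only [diag_apply] at h1
  rw [h1]
  split_ifs with h2
  · subst h2; simp
  · exact trace_single_eq_of_ne _ _ _ h2

lemma IsChannel.wordMap {Φ : Matrix A A ℂ →ₗ[ℂ] Matrix B B ℂ} (h : IsChannel Φ) :
    IsChannel (wordMap Φ ι) := by
  obtain ⟨K, hK⟩ := h.exists_isKraus
  refine hK.wordMap.isChannel fun X => ?_
  simp only [Matrix.trace, diag_apply, wordMap_apply]
  rw [Finset.sum_comm]
  refine Finset.sum_congr rfl fun a _ => ?_
  rw [Finset.sum_comm, Finset.sum_eq_single a]
  · rw [← Finset.mul_sum, ← Fintype.prod_sum (fun i b => Φ (single (a i) (a i) 1) b b)]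
    simp [h.trace_single]
  · intro a' _ ha
    rw [← Finset.mul_sum, ← Fintype.prod_sum (fun i b => Φ (single (a i) (a' i) 1) b b)]
    obtain ⟨i, hi⟩ := Function.ne_iff.mp ha
    rw [Finset.prod_eq_zero (Finset.mem_univ i), mul_zero]
    rw [h.trace_single, if_neg hi.symm]
  · simp

lemma isRelabelling_wordMap (Φ : Matrix A A ℂ →ₗ[ℂ] Matrix B B ℂ) (e : ι ≃ ι') :
    IsRelabelling (e.symm.arrowCongr (Equiv.refl A)) (e.symm.arrowCongr (Equiv.refl B))
      (wordMap Φ ι) (wordMap Φ ι') := by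
  intro X
  ext b b'
  rw [wordMap_apply, submatrix_apply, wordMap_apply,
    ← (e.symm.arrowCongr (Equiv.refl A)).sum_comp]
  refine Finset.sum_congr rfl fun a _ => ?_
  rw [← (e.symm.arrowCongr (Equiv.refl A)).sum_comp]
  refine Finset.sum_congr rfl fun a' _ => ?_
  rw [submatrix_apply, ← e.prod_comp]
  rfl

lemma isRelabelling_wordMap_unique [Unique ι] (Φ : Matrix A A ℂ →ₗ[ℂ] Matrix B B ℂ) :
    IsRelabelling (Equiv.funUnique ι A) (Equiv.funUnique ι B) Φ (wordMap Φ ι) := by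
  intro X
  ext b b'
  rw [wordMap_apply, submatrix_apply, map_apply_eq_sum, ← (Equiv.funUnique ι A).sum_comp]
  refine Finset.sum_congr rfl fun a _ => ?_
  rw [← (Equiv.funUnique ι A).sum_comp]
  refine Finset.sum_congr rfl fun a' _ => ?_
  simp

lemma isChannel_tensorPower {Φ : Matrix A A ℂ →ₗ[ℂ] Matrix B B ℂ} (h : IsChannel Φ) (n : ℕ) :
    IsChannel (tensorPower Φ n) := h.wordMap

/-! ### Products of purified inputs -/

section Product

variable {E F : Type*} [Fintype E] [DecidableEq E] [Fintype F] [DecidableEq F]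

/-- The product of two purifications. -/
def prodVector (ψ : (ι → A) × E → ℂ) (φ : (ι' → A) × F → ℂ) : (ι ⊕ ι' → A) × (E × F) → ℂ :=
  fun x => ψ (fun i => x.1 (.inl i), x.2.1) * φ (fun i => x.1 (.inr i), x.2.2)

lemma margin_prodVector (ψ : (ι → A) × E → ℂ) (φ : (ι' → A) × F → ℂ) :
    margin (prodVector ψ φ) = (margin ψ ⊗ₖ margin φ).submatrix
      (Equiv.sumArrowEquivProdArrow ι ι' A) (Equiv.sumArrowEquivProdArrow ι ι' A) := by
  ext a a'
  simp only [margin, of_apply, ketbra_apply, prodVector, submatrix_apply, kroneckerMap_apply,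
    Finset.sum_mul_sum, Fintype.sum_prod_type, star_mul']
  refine Finset.sum_congr rfl fun e _ => Finset.sum_congr rfl fun f _ => ?_
  simp only [Equiv.sumArrowEquivProdArrow, Equiv.coe_fn_mk, Function.comp_def]
  ring

/-- The regrouping of the two outputs and of the two reference systems. -/
def prodEquiv (ι ι' B E F : Type*) :
    (ι ⊕ ι' → B) × (E × F) ≃ ((ι → B) × E) × ((ι' → B) × F) :=
  ((Equiv.sumArrowEquivProdArrow ι ι' B).prodCongr (Equiv.refl (E × F))).trans
    (Equiv.prodProdProdComm _ _ _ _)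

lemma ampliate_prodVector (Φ : Matrix A A ℂ →ₗ[ℂ] Matrix B B ℂ) (ψ : (ι → A) × E → ℂ)
    (φ : (ι' → A) × F → ℂ) : ampliate (wordMap Φ (ι ⊕ ι')) (E × F) (ketbra (prodVector ψ φ))
      = (ampliate (wordMap Φ ι) E (ketbra ψ) ⊗ₖ ampliate (wordMap Φ ι') F (ketbra φ)).submatrix
        (prodEquiv ι ι' B E F) (prodEquiv ι ι' B E F) := by
  ext ⟨b, e, f⟩ ⟨b', e', f'⟩
  simp only [ampliate_apply, wordMap_apply, submatrix_apply, kroneckerMap_apply, of_apply]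
  rw [← (Equiv.sumArrowEquivProdArrow ι ι' A).symm.sum_comp, Fintype.sum_prod_type,
    Finset.sum_mul_sum]
  refine Finset.sum_congr rfl fun a _ => Finset.sum_congr rfl fun c _ => ?_
  rw [← (Equiv.sumArrowEquivProdArrow ι ι' A).symm.sum_comp, Fintype.sum_prod_type,
    Finset.sum_mul_sum]
  refine Finset.sum_congr rfl fun a' _ => Finset.sum_congr rfl fun c' _ => ?_
  simp only [Fintype.prod_sum_type, ketbra_apply, prodVector, star_mul', prodEquiv,
    Equiv.trans_apply, Equiv.prodCongr_apply, Prod.map_apply, Equiv.prodProdProdComm_apply,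
    Equiv.sumArrowEquivProdArrow_apply_fst, Equiv.sumArrowEquivProdArrow_apply_snd,
    Equiv.sumArrowEquivProdArrow_symm_apply_inl, Equiv.sumArrowEquivProdArrow_symm_apply_inr,
    Equiv.refl_apply]
  ring

lemma IsDensity.kronecker {n m : Type*} [Fintype n] [Fintype m] {ρ : Matrix n n ℂ}
    {σ : Matrix m m ℂ} (h : IsDensity ρ) (h' : IsDensity σ) : IsDensity (ρ ⊗ₖ σ) :=
  ⟨h.1.kronecker h'.1, by rw [trace_kronecker, h.2, h'.2, mul_one]⟩

lemma IsDensity.entropy_kronecker {n m : Type*} [Fintype n] [DecidableEq n] [Fintype m]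
    [DecidableEq m] {ρ : Matrix n n ℂ} {σ : Matrix m m ℂ} (h : IsDensity ρ) (h' : IsDensity σ) :
    entropy (ρ ⊗ₖ σ) = entropy ρ + entropy σ := by
  rw [CECapacity.entropy_kronecker h.1.1 h'.1.1, h.2, h'.2]
  simp [add_comm]

variable {ψ : (ι → A) × E → ℂ} {φ : (ι' → A) × F → ℂ}

lemma isDensity_margin_prodVector (h : IsDensity (margin ψ)) (h' : IsDensity (margin φ)) :
    IsDensity (margin (prodVector ψ φ)) := by
  rw [margin_prodVector, isDensity_submatrix]
  exact h.kronecker h'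

lemma entropy_margin_prodVector (h : IsDensity (margin ψ)) (h' : IsDensity (margin φ)) :
    entropy (margin (prodVector ψ φ)) = entropy (margin ψ) + entropy (margin φ) := by
  rw [margin_prodVector, entropy_submatrix _ (h.kronecker h').1.1, h.entropy_kronecker h']

lemma IsChannel.condEntropy_prodVector {Φ : Matrix A A ℂ →ₗ[ℂ] Matrix B B ℂ} (hΦ : IsChannel Φ)
    (h : IsDensity (margin ψ)) (h' : IsDensity (margin φ)) :
    condEntropy (ampliate (CECapacity.wordMap Φ (ι ⊕ ι')) (E × F) (ketbra (prodVector ψ φ)))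
      = condEntropy (ampliate (CECapacity.wordMap Φ ι) E (ketbra ψ))
        + condEntropy (ampliate (CECapacity.wordMap Φ ι') F (ketbra φ)) := by
  have k := (hΦ.wordMap (ι := ι)).isDensity_ampliate (isDensity_margin_iff.mp h)
  have k' := (hΦ.wordMap (ι := ι')).isDensity_ampliate (isDensity_margin_iff.mp h')
  rw [hΦ.wordMap.condEntropy_ampliate, hΦ.wordMap.condEntropy_ampliate,
    hΦ.wordMap.condEntropy_ampliate, ampliate_prodVector, entropy_margin_prodVector h h',
    entropy_submatrix _ (k.kronecker k').1.1, k.entropy_kronecker k']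
  ring

end Product

lemma exists_pure_state [Nonempty A] : ∃ a : A → ℂ, IsDensity (ketbra a) := by
  obtain ⟨a⟩ := ‹Nonempty A›
  refine ⟨Pi.single a 1, posSemidef_ketbra _, ?_⟩
  simp [Matrix.trace, Pi.single_apply]

/-- The other marginal lives on a one-dimensional space. -/
lemma entropy_ketbra {n : Type*} [Fintype n] [DecidableEq n] {ψ : n → ℂ}
    (h : IsDensity (ketbra ψ)) : entropy (ketbra ψ) = 0 := by
  have h1 : ketbra ψ = (Matrix.of fun a (_ : Unit) => ψ a) * (Matrix.of fun a (_ : Unit) => ψ a)ᴴ := by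
    ext a a'; simp [Matrix.mul_apply]
  have h2 : IsDensity ((Matrix.of fun a (_ : Unit) => ψ a)ᴴ * (Matrix.of fun a (_ : Unit) => ψ a)) :=
    ⟨posSemidef_conjTranspose_mul_self _, by rw [trace_mul_comm, ← h1, h.2]⟩
  refine le_antisymm ?_ (entropy_nonneg h)
  rw [h1, entropy_mul_conjTranspose]
  simpa using entropy_le_logb_card h2

lemma margin_pure (a : A → ℂ) : margin (fun x : A × Fin 1 => a x.1) = ketbra a := by
  ext i j; simp [margin]

lemma gapValues_nonempty [Nonempty A] (Φ : Matrix A A ℂ →ₗ[ℂ] Matrix B B ℂ) {P : ℝ} (hP : 0 ≤ P) :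
    (gapValues Φ P).Nonempty := by
  obtain ⟨a, ha⟩ := exists_pure_state (A := A)
  exact ⟨_, 1, fun x => a x.1, by rwa [margin_pure], by rwa [margin_pure, entropy_ketbra ha], rfl⟩

/-- A product of admissible inputs is admissible for the joint power: assistance and conditional
entropies both add. -/
lemma IsChannel.minEntropyGap_add_le [Nonempty A] {Φ : Matrix A A ℂ →ₗ[ℂ] Matrix B B ℂ}
    (h : IsChannel Φ) {P : ℝ} (hP : 0 ≤ P) (m n : ℕ) :
    minEntropyGap (tensorPower Φ (m + n)) ((m + n : ℕ) * P)
      ≤ minEntropyGap (tensorPower Φ m) (m * P) + minEntropyGap (tensorPower Φ n) (n * P) := by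
  simp only [tensorPower_eq_wordMap, h.wordMap.minEntropyGap_eq]
  rw [← csInf_add (gapValues_nonempty _ (by positivity)) (h.wordMap.bddBelow_gapValues _)
    (gapValues_nonempty _ (by positivity)) (h.wordMap.bddBelow_gapValues _)]
  refine le_csInf ((gapValues_nonempty _ (by positivity)).add
    (gapValues_nonempty _ (by positivity))) ?_
  rintro _ ⟨_, ⟨k, ψ, hψ, hψP, rfl⟩, _, ⟨l, φ, hφ, hφP, rfl⟩, rfl⟩
  refine csInf_le (h.wordMap.bddBelow_gapValues _) ?_
  dsimp only
  rw [← h.condEntropy_prodVector hψ hφ]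
  refine (isRelabelling_wordMap Φ finSumFinEquiv).condEntropy_mem_gapValues h.wordMap
    (isDensity_margin_prodVector hψ hφ) ?_
  rw [entropy_margin_prodVector hψ hφ]
  push_cast
  linarith

end WordMap

/-! ### Subadditivity of the entropy on separable states -/

section Subadditivity

variable {ι A κ : Type*} [Fintype ι] [DecidableEq ι] [Fintype A] [DecidableEq A] [Fintype κ]

lemma isDensity_piMat {ρ : ι → Matrix A A ℂ} (h : ∀ i, IsDensity (ρ i)) : IsDensity (piMat ρ) :=
  ⟨posSemidef_piMat fun i => (h i).1, by simp [trace_piMat, (h _).2]⟩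

/-- Subadditivity of the entropy, for separable states. -/
theorem entropy_sum_piMat_le {p : κ → ℝ} (hp : ∀ x, 0 ≤ p x) (hp1 : ∑ x, p x = 1)
    {Y : κ → ι → Matrix A A ℂ} (hY : ∀ x i, IsDensity (Y x i)) :
    entropy (∑ x, (p x : ℂ) • piMat (Y x)) ≤ ∑ i, entropy (∑ x, (p x : ℂ) • Y x i) := by
  have hρ : ∀ i, IsDensity (∑ x, (p x : ℂ) • Y x i) := fun i =>
    isDensity_sum hp hp1 fun x => hY x i
  have hd := fun i => exists_diagonalizes (hρ i).1.1
  set U := fun i => ((hρ i).1.1.eigenvectorUnitary : Matrix A A ℂ)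
  set l := fun i => (hρ i).1.1.eigenvalues
  have hl : ∀ i a, 0 ≤ l i a := fun i => (hρ i).1.eigenvalues_nonneg
  have hX := isDensity_sum hp hp1 (fun x => isDensity_piMat (hY x))
  -- The distribution obtained by measuring `Y x i` in the eigenbasis of the `i`-th marginal; its
  -- mean over `x` is the spectrum of that marginal.
  let y : κ → ι → A → ℝ := fun x i a => ((U i)ᴴ * Y x i * U i) a a |>.re
  have hyc : ∀ x i a, ((U i)ᴴ * Y x i * U i) a a = (y x i a : ℂ) := by
    intro x i a
    have := ((hY x i).1.conjTranspose_mul_mul_same (U i)).diag_nonneg (i := a)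
    exact (Complex.ext rfl (Complex.nonneg_iff.mp this).2.symm)
  have hy0 : ∀ x i a, 0 ≤ y x i a := by
    intro x i a
    exact (Complex.nonneg_iff.mp
      (((hY x i).1.conjTranspose_mul_mul_same (U i)).diag_nonneg (i := a))).1
  have hy1 : ∀ x i, ∑ a, y x i a = 1 := by
    intro x i
    have h1 : ((U i)ᴴ * Y x i * U i).trace = 1 := by
      rw [trace_mul_comm, ← Matrix.mul_assoc, (hd i).mul_star, Matrix.one_mul, (hY x i).2]
    rw [Matrix.trace] at h1
    simp only [diag_apply, hyc] at h1
    exact_mod_cast h1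
  have hyl : ∀ i a, ∑ x, p x * y x i a = l i a := by
    intro i a
    have h1 := congrFun (congrFun (hd i).diag_eq a) a
    rw [diagonal_apply_eq, Matrix.mul_sum, Matrix.sum_mul, Matrix.sum_apply] at h1
    have h2 : ∀ x, ((U i)ᴴ * ((p x : ℂ) • Y x i) * U i) a a = ((p x * y x i a : ℝ) : ℂ) := by
      intro x
      rw [Matrix.mul_smul, Matrix.smul_mul, Matrix.smul_apply, hyc, smul_eq_mul]
      push_cast; rfl
    simp only [U] at h2
    simp only [h2] at h1
    exact_mod_cast h1
  have hw : ∀ j, ((piMat U)ᴴ * (∑ x, (p x : ℂ) • piMat (Y x)) * piMat U) j j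
      = ((∑ x, p x * ∏ i, y x i (j i) : ℝ) : ℂ) := by
    intro j
    rw [Matrix.mul_sum, Matrix.sum_mul, Matrix.sum_apply]
    push_cast
    refine Finset.sum_congr rfl fun x _ => ?_
    rw [Matrix.mul_smul, Matrix.smul_mul, Matrix.smul_apply, piMat_conjTranspose, piMat_mul,
      piMat_mul, piMat_apply, smul_eq_mul]
    simp only [hyc]
  have hz : ∀ j : ι → A, ∀ i, l i (j i) = 0 → ∀ x, p x * ∏ i, y x i (j i) = 0 := by
    intro j i hi x
    rw [← hyl, Finset.sum_eq_zero_iff_of_nonneg fun x _ => mul_nonneg (hp x) (hy0 _ _ _)] at hi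
    rcases mul_eq_zero.mp (hi x (Finset.mem_univ x)) with h0 | h0
    · rw [h0, zero_mul]
    · rw [Finset.prod_eq_zero (Finset.mem_univ i) h0, mul_zero]
  have hs : SupportedOn (∑ x, (p x : ℂ) • piMat (Y x)) (piMat U)
      (fun j => ∏ i, l i (j i)) := by
    intro j hj
    obtain ⟨i, -, hi⟩ := Finset.prod_eq_zero_iff.mp hj
    rw [hw, Finset.sum_eq_zero fun x _ => hz j i hi x, Complex.ofReal_zero]
  -- Klein's inequality against the tensor product of the marginals.
  refine (neg_sum_mul_log_le (exists_diagonalizes hX.1.1) (Diagonalizes.piMat hd)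
    hX.1.eigenvalues_nonneg (fun j => Finset.prod_nonneg fun i _ => hl i _) hs ?_).trans_eq ?_
  · rw [hX.sum_eigenvalues, ← Fintype.prod_sum (fun i a => l i a)]
    exact (Finset.prod_eq_one fun i _ => (hρ i).sum_eigenvalues).le
  have e1 : ∀ j : ι → A, (((piMat U)ᴴ * (∑ x, (p x : ℂ) • piMat (Y x)) * piMat U) j j).re
      * Real.logb 2 (∏ i, l i (j i))
      = ∑ i, ∑ x, p x * ((∏ i, y x i (j i)) * Real.logb 2 (l i (j i))) := by
    intro j
    rw [hw, Complex.ofReal_re]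
    by_cases h0 : ∃ i, l i (j i) = 0
    · obtain ⟨i, hi⟩ := h0
      simp only [← mul_assoc, hz j i hi]
      simp
    · push Not at h0
      rw [Real.logb_prod _ _ fun i _ => h0 i, Finset.mul_sum]
      refine Finset.sum_congr rfl fun i _ => ?_
      rw [Finset.sum_mul]
      exact Finset.sum_congr rfl fun x _ => by ring
  rw [Finset.sum_congr rfl fun j _ => e1 j, Finset.sum_comm, ← Finset.sum_neg_distrib]
  refine Finset.sum_congr rfl fun i _ => ?_
  rw [Finset.sum_comm, (hd i).entropy_eq]
  simp only [← Finset.mul_sum]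
  have e2 : ∀ x, ∑ j : ι → A, (∏ i, y x i (j i)) * Real.logb 2 (l i (j i))
      = ∑ a, y x i a * Real.logb 2 (l i a) := fun x =>
    sum_prod_mul_apply (fun i a => y x i a) i (fun a => Real.logb 2 (l i a)) fun i _ => hy1 x i
  simp only [e2, Finset.mul_sum]
  rw [Finset.sum_comm, ← Finset.sum_neg_distrib]
  refine Finset.sum_congr rfl fun a _ => ?_
  rw [shannon, show (hρ i).1.1.eigenvalues a = l i a from rfl, ← hyl i a, Finset.sum_mul]
  congr 1
  exact Finset.sum_congr rfl fun x _ => by ring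

end Subadditivity

/-! ### Channels with classical input: additivity of the Holevo quantity -/

section ClassicalInput

variable {A B κ ι : Type*} [Fintype A] [DecidableEq A] [Fintype B] [DecidableEq B] [Fintype κ]
  [DecidableEq κ] [Fintype ι] [DecidableEq ι]

lemma sum_sum_prod {V W : Type*} [Fintype V] [Fintype W] (f : ι → V → W → ℂ) :
    ∑ v : ι → V, ∑ w : ι → W, ∏ i, f i (v i) (w i) = ∏ i, ∑ v, ∑ w, f i v w := by
  simp only [Fintype.prod_sum]

/-- `⟨v| X |v⟩`. -/
def sandwich (v : A → ℂ) (X : Matrix A A ℂ) : ℂ := ∑ a, ∑ a', star (v a) * X a a' * v a'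

lemma sandwich_nonneg {X : Matrix A A ℂ} (hX : X.PosSemidef) (v : A → ℂ) : 0 ≤ sandwich v X := by
  have := hX.dotProduct_mulVec_nonneg v
  convert this using 1
  simp [sandwich, dotProduct, mulVec, Finset.mul_sum, mul_assoc]

/-- `Φ` measures its input, and prepares the state `T j` on the outcome `j`, which is certain
on the pure input state `v j`. -/
structure IsMeasurePrepare (v : κ → A → ℂ) (T : κ → Matrix B B ℂ)
    (Φ : Matrix A A ℂ →ₗ[ℂ] Matrix B B ℂ) : Prop where
  map_eq : ∀ X, Φ X = ∑ j, sandwich (v j) X • T j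
  map_ketbra : ∀ j, Φ (ketbra (v j)) = T j
  pure : ∀ j, IsDensity (ketbra (v j))

lemma HasClassicalInput.exists_isMeasurePrepare {Φ : Matrix A A ℂ →ₗ[ℂ] Matrix B B ℂ}
    (h : HasClassicalInput Φ) :
    ∃ (v : A → A → ℂ) (T : A → Matrix B B ℂ), IsMeasurePrepare v T Φ := by
  obtain ⟨e, he⟩ := h
  refine ⟨fun j a => e j a, fun j => Φ (ketbra fun a => e j a), ⟨fun X => ?_, fun _ => rfl,
    fun j => ⟨posSemidef_ketbra _, ?_⟩⟩⟩
  · rw [he X, map_sum]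
    refine Finset.sum_congr rfl fun j _ => ?_
    rw [← map_smul]
    congr 1
    ext a a'
    simp only [Matrix.mul_apply, ketbra_apply, Matrix.smul_apply, smul_eq_mul, sandwich,
      Finset.sum_mul]
    rw [Finset.sum_comm]
    exact Finset.sum_congr rfl fun b _ => Finset.sum_congr rfl fun b' _ => by ring
  · have h1 := e.orthonormal.1 j
    rw [EuclideanSpace.norm_eq, Real.sqrt_eq_one] at h1
    simp only [Matrix.trace, diag_apply, ketbra_apply, RCLike.star_def, Complex.mul_conj,
      Complex.normSq_eq_norm_sq]
    exact_mod_cast h1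

variable {v : κ → A → ℂ} {T : κ → Matrix B B ℂ} {Φ : Matrix A A ℂ →ₗ[ℂ] Matrix B B ℂ}

/-- The product of a family of vectors. -/
def wordVector (v : κ → A → ℂ) (x : ι → κ) (a : ι → A) : ℂ := ∏ i, v (x i) (a i)

lemma IsMeasurePrepare.wordMap (h : IsMeasurePrepare v T Φ) :
    IsMeasurePrepare (wordVector v) (fun x : ι → κ => piMat fun i => T (x i))
      (wordMap Φ ι) where
  map_eq X := by
    ext b b'
    have h1 : ∀ a a' b b', Φ (single a a' 1) b b'
        = ∑ j, star (v j a) * v j a' * T j b b' := by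
      intro a a' b b'
      rw [h.map_eq, Matrix.sum_apply]
      refine Finset.sum_congr rfl fun j _ => ?_
      rw [Matrix.smul_apply, smul_eq_mul, sandwich, Finset.sum_eq_single a,
        Finset.sum_eq_single a']
      · simp
      · intro c _ hc; simp [hc.symm]
      · simp
      · intro c _ hc; simp [hc.symm]
      · simp
    rw [wordMap_apply, Matrix.sum_apply]
    simp only [h1, Fintype.prod_sum, Matrix.smul_apply, smul_eq_mul, sandwich, Finset.sum_mul,
      Finset.mul_sum, piMat_apply, wordVector, Finset.prod_mul_distrib, star_prod]
    rw [Finset.sum_congr rfl fun a _ => Finset.sum_comm, Finset.sum_comm]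
    refine Finset.sum_congr rfl fun x _ => Finset.sum_congr rfl fun a _ =>
      Finset.sum_congr rfl fun a' _ => ?_
    ring
  map_ketbra x := by
    ext b b'
    rw [wordMap_apply, piMat_apply]
    simp only [← h.map_ketbra, map_apply_eq_sum Φ (ketbra _), ketbra_apply, wordVector,
      star_prod, ← Finset.prod_mul_distrib]
    exact sum_sum_prod fun i a a' =>
      v (x i) a * star (v (x i) a') * Φ (single a a' 1) (b i) (b' i)
  pure x := by
    refine ⟨posSemidef_ketbra _, ?_⟩
    have h1 : ketbra (wordVector v x) = piMat fun i => ketbra (v (x i)) := by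
      ext a a'; simp [wordVector, Finset.prod_mul_distrib]
    rw [h1, trace_piMat]
    simp [(h.pure _).2]

/-- The Holevo quantity of the ensemble `{p j, T j}`. -/
noncomputable def holevo (p : κ → ℝ) (T : κ → Matrix B B ℂ) : ℝ :=
  entropy (∑ j, (p j : ℂ) • T j) - ∑ j, p j * entropy (T j)

/-- The Holevo quantities of the ensembles of the states `T j`. -/
def holevoValues (T : κ → Matrix B B ℂ) : Set ℝ :=
  {x | ∃ p : κ → ℝ, (∀ j, 0 ≤ p j) ∧ ∑ j, p j = 1 ∧ x = holevo p T}

lemma bddAbove_holevoValues (hT : ∀ j, IsDensity (T j)) : BddAbove (holevoValues T) := by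
  refine ⟨Real.logb 2 (Fintype.card B), ?_⟩
  rintro _ ⟨p, hp, hp1, rfl⟩
  have h1 := entropy_le_logb_card (isDensity_sum hp hp1 hT)
  have h2 : 0 ≤ ∑ j, p j * entropy (T j) :=
    Finset.sum_nonneg fun j _ => mul_nonneg (hp j) (entropy_nonneg (hT j))
  rw [holevo]
  linarith

lemma holevoValues_nonempty [Nonempty κ] (T : κ → Matrix B B ℂ) : (holevoValues T).Nonempty := by
  obtain ⟨j⟩ := ‹Nonempty κ›
  refine ⟨_, Pi.single j 1, fun i => ?_, by simp, rfl⟩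
  by_cases h : i = j
  · subst h; simp
  · simp [h]

lemma IsMeasurePrepare.isDensity (h : IsMeasurePrepare v T Φ) (hΦ : IsChannel Φ) (j : κ) :
    IsDensity (T j) := by
  rw [← h.map_ketbra]; exact hΦ.isDensity (h.pure j)

lemma re_sandwich {X : Matrix A A ℂ} (hX : X.PosSemidef) (w : A → ℂ) :
    ((sandwich w X).re : ℂ) = sandwich w X :=
  Complex.ext rfl (Complex.nonneg_iff.mp (sandwich_nonneg hX w)).2

lemma IsMeasurePrepare.sum_sandwich (h : IsMeasurePrepare v T Φ) (hΦ : IsChannel Φ)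
    {ρ : Matrix A A ℂ} (hρ : IsDensity ρ) : ∑ j, (sandwich (v j) ρ).re = 1 := by
  have h1 := (hΦ.isDensity hρ).2
  rw [h.map_eq, trace_sum] at h1
  simp only [trace_smul, (h.isDensity hΦ _).2, smul_eq_mul, mul_one] at h1
  rw [← Complex.re_sum, h1, Complex.one_re]

lemma IsChannel.bddAbove_capacityValues (hΦ : IsChannel Φ) :
    BddAbove {x : ℝ | ∃ (m : ℕ) (p : Fin m → ℝ) (ρ : Fin m → Matrix A A ℂ), IsEnsemble p ρ ∧
      x = entropy (∑ i, (p i : ℂ) • Φ (ρ i)) - ∑ i, p i * entropy (Φ (ρ i))} := by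
  refine ⟨Real.logb 2 (Fintype.card B), ?_⟩
  rintro _ ⟨m, p, ρ, hρ, rfl⟩
  have h1 := entropy_le_logb_card (isDensity_sum hρ.nonneg hρ.sum_eq_one
    fun i => hΦ.isDensity (hρ.density i))
  have h2 : 0 ≤ ∑ i, p i * entropy (Φ (ρ i)) := Finset.sum_nonneg fun i _ =>
    mul_nonneg (hρ.nonneg i) (entropy_nonneg (hΦ.isDensity (hρ.density i)))
  linarith

/-- Replacing each input by the basis states with their outcome probabilities keeps the average
output and, by concavity of the entropy, does not increase the average output entropy. -/
lemma IsMeasurePrepare.oneShotCapacity_eq [Nonempty κ] (h : IsMeasurePrepare v T Φ)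
    (hΦ : IsChannel Φ) : oneShotCapacity Φ = sSup (holevoValues T) := by
  have hT := h.isDensity hΦ
  have hmem : ∀ x ∈ holevoValues T, x ∈ {x : ℝ | ∃ (m : ℕ) (p : Fin m → ℝ)
      (ρ : Fin m → Matrix A A ℂ), IsEnsemble p ρ ∧
      x = entropy (∑ i, (p i : ℂ) • Φ (ρ i)) - ∑ i, p i * entropy (Φ (ρ i))} := by
    rintro _ ⟨p, hp, hp1, rfl⟩
    let g := (Fintype.equivFin κ).symm
    refine ⟨Fintype.card κ, p ∘ g, fun i => ketbra (v (g i)),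
      ⟨fun i => hp _, (g.sum_comp p).trans hp1, fun i => h.pure _⟩, ?_⟩
    simp only [h.map_ketbra, Function.comp_apply]
    rw [g.sum_comp (fun j => (p j : ℂ) • T j), g.sum_comp (fun j => p j * entropy (T j))]
    rfl
  refine le_antisymm (csSup_le ((holevoValues_nonempty T).mono hmem) ?_)
    (csSup_le_csSup hΦ.bddAbove_capacityValues (holevoValues_nonempty T) hmem)
  rintro _ ⟨m, p, ρ, hρ, rfl⟩
  have hΦρ : ∀ i, Φ (ρ i) = ∑ j, ((sandwich (v j) (ρ i)).re : ℂ) • T j := by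
    intro i
    rw [h.map_eq]
    refine Finset.sum_congr rfl fun j _ => ?_
    rw [re_sandwich (hρ.density i).1]
  have hw0 : ∀ i j, 0 ≤ (sandwich (v j) (ρ i)).re := fun i j =>
    (Complex.nonneg_iff.mp (sandwich_nonneg (hρ.density i).1 _)).1
  refine le_trans ?_ (le_csSup (bddAbove_holevoValues hT)
    ⟨fun j => ∑ i, p i * (sandwich (v j) (ρ i)).re, fun j => Finset.sum_nonneg fun i _ =>
      mul_nonneg (hρ.nonneg i) (hw0 i j), ?_, rfl⟩)
  · have e1 : ∑ i, (p i : ℂ) • Φ (ρ i)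
        = ∑ j, ((∑ i, p i * (sandwich (v j) (ρ i)).re : ℝ) : ℂ) • T j := by
      simp only [hΦρ, Finset.smul_sum, smul_smul]
      rw [Finset.sum_comm]
      refine Finset.sum_congr rfl fun j _ => ?_
      push_cast
      rw [Finset.sum_smul]
    have e2 : ∑ j, (∑ i, p i * (sandwich (v j) (ρ i)).re) * entropy (T j)
        ≤ ∑ i, p i * entropy (Φ (ρ i)) := by
      simp only [Finset.sum_mul]
      rw [Finset.sum_comm]
      refine Finset.sum_le_sum fun i _ => ?_
      simp only [mul_assoc]
      rw [← Finset.mul_sum]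
      refine mul_le_mul_of_nonneg_left ?_ (hρ.nonneg i)
      rw [hΦρ]
      exact sum_entropy_le (hw0 i) (h.sum_sandwich hΦ (hρ.density i)) hT
    rw [holevo, ← e1]
    linarith
  · rw [Finset.sum_comm]
    simp only [← Finset.mul_sum, h.sum_sandwich hΦ (hρ.density _), mul_one, hρ.sum_eq_one]

/-- Additivity of the Holevo quantity for product states. -/
lemma sSup_holevoValues_piMat [Nonempty κ] (hT : ∀ j, IsDensity (T j)) :
    sSup (holevoValues fun x : ι → κ => piMat fun i => T (x i))
      = Fintype.card ι * sSup (holevoValues T) := by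
  have hpi : ∀ x : ι → κ, IsDensity (piMat fun i => T (x i)) := fun x =>
    isDensity_piMat fun i => hT _
  refine le_antisymm (csSup_le (holevoValues_nonempty _) ?_) ?_
  · rintro _ ⟨p, hp, hp1, rfl⟩
    -- Pass to the marginal distributions of the letters: the entropies of the product states add,
    -- and that of the mixture is subadditive.
    have h1 : holevo p (fun x : ι → κ => piMat fun i => T (x i))
        ≤ ∑ i, holevo (fun j => ∑ x : ι → κ, if x i = j then p x else 0) T := by
      have e1 : ∀ i, ∑ j, ((∑ x : ι → κ, if x i = j then p x else 0 : ℝ) : ℂ) • T j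
          = ∑ x, (p x : ℂ) • T (x i) := by
        intro i
        push_cast
        simp only [Finset.sum_smul]
        rw [Finset.sum_comm]
        refine Finset.sum_congr rfl fun x _ => ?_
        simp [apply_ite Complex.ofReal, ite_smul]
      have e2 : ∀ i, ∑ j, (∑ x : ι → κ, if x i = j then p x else 0) * entropy (T j)
          = ∑ x, p x * entropy (T (x i)) := by
        intro i
        simp only [Finset.sum_mul]
        rw [Finset.sum_comm]
        refine Finset.sum_congr rfl fun x _ => ?_
        simp [ite_mul]
      simp only [holevo, e1, e2, entropy_piMat fun i => hT _, Finset.sum_sub_distrib,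
        Finset.mul_sum]
      rw [Finset.sum_comm (γ := ι)]
      exact sub_le_sub_right (entropy_sum_piMat_le hp hp1 fun x i => hT _) _
    refine h1.trans ?_
    rw [← nsmul_eq_mul]
    refine Finset.sum_le_card_nsmul _ _ _ fun i _ => le_csSup (bddAbove_holevoValues hT) ?_
    refine ⟨_, fun j => Finset.sum_nonneg fun x _ => ?_, ?_, rfl⟩
    · split_ifs; exacts [hp x, le_rfl]
    · rw [Finset.sum_comm]
      simpa using hp1
  -- Independent, identically distributed letters attain the bound.
  · have h2 : ∀ x ∈ holevoValues T, Fintype.card ι * x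
        ∈ holevoValues fun x : ι → κ => piMat fun i => T (x i) := by
      rintro _ ⟨p, hp, hp1, rfl⟩
      refine ⟨fun x => ∏ i, p (x i), fun x => Finset.prod_nonneg fun i _ => hp _, ?_, ?_⟩
      · rw [← Fintype.prod_sum (fun _ j => p j)]
        simp [hp1]
      · have e1 : ∑ x : ι → κ, ((∏ i, p (x i) : ℝ) : ℂ) • piMat (fun i => T (x i))
            = piMat fun _ : ι => ∑ j, (p j : ℂ) • T j := by
          ext b b'
          simp only [Matrix.sum_apply, Matrix.smul_apply, piMat_apply, smul_eq_mul,
            Fintype.prod_sum]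
          push_cast
          simp only [Finset.prod_mul_distrib]
        have e2 : ∑ x : ι → κ, (∏ i, p (x i)) * ∑ i, entropy (T (x i))
            = Fintype.card ι * ∑ j, p j * entropy (T j) := by
          simp only [Finset.mul_sum]
          rw [Finset.sum_comm]
          simp only [sum_prod_mul_apply (fun _ j => p j) _ (fun j => entropy (T j))
            (fun _ _ => hp1)]
          simp [Finset.mul_sum]
        rw [holevo, holevo, e1, entropy_piMat fun _ => isDensity_sum hp hp1 hT]
        simp only [entropy_piMat fun i => hT _, e2]
        simp [mul_sub]
    rcases isEmpty_or_nonempty ι with hι | hι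
    · obtain ⟨x, hx⟩ := holevoValues_nonempty T
      simpa using le_csSup (bddAbove_holevoValues hpi) (h2 x hx)
    · have hc : (0 : ℝ) < Fintype.card ι := by exact_mod_cast Fintype.card_pos
      rw [← le_div_iff₀' hc]
      refine csSup_le (holevoValues_nonempty T) fun x hx => ?_
      rw [le_div_iff₀' hc]
      exact le_csSup (bddAbove_holevoValues hpi) (h2 x hx)

/-- Additivity makes the `n`-shot capacity independent of `n`; `n = 0` is excluded because of the
division by `n`. -/
lemma IsMeasurePrepare.nShotCapacity_eq [Nonempty κ] (h : IsMeasurePrepare v T Φ)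
    (hΦ : IsChannel Φ) {n : ℕ} (hn : n ≠ 0) : nShotCapacity Φ n = sSup (holevoValues T) := by
  have : (n : ℝ) ≠ 0 := by exact_mod_cast hn
  rw [nShotCapacity, tensorPower_eq_wordMap, h.wordMap.oneShotCapacity_eq hΦ.wordMap,
    sSup_holevoValues_piMat (h.isDensity hΦ), Fintype.card_fin]
  field_simp

lemma IsMeasurePrepare.tendsto_nShotCapacity [Nonempty κ] (h : IsMeasurePrepare v T Φ)
    (hΦ : IsChannel Φ) : Tendsto (nShotCapacity Φ) atTop (𝓝 (sSup (holevoValues T))) :=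
  tendsto_const_nhds.congr' ((eventually_ne_atTop 0).mono fun _ hn =>
    (h.nShotCapacity_eq hΦ hn).symm)

lemma IsMeasurePrepare.capacity_eq [Nonempty κ] (h : IsMeasurePrepare v T Φ)
    (hΦ : IsChannel Φ) : capacity Φ = sSup (holevoValues T) :=
  (h.tendsto_nShotCapacity hΦ).limUnder_eq

/-- The basis states are pure, so they can be purified with a trivial reference and consume no
assistance. -/
lemma IsMeasurePrepare.le_oneShotAssisted [Nonempty κ] (h : IsMeasurePrepare v T Φ)
    (hΦ : IsChannel Φ) : sSup (holevoValues T) ≤ oneShotAssisted Φ 0 := by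
  refine csSup_le (holevoValues_nonempty T) ?_
  rintro _ ⟨p, hp, hp1, rfl⟩
  rw [hΦ.oneShotAssisted_eq]
  refine le_csSup (hΦ.bddAbove_assistedValues 0) ?_
  have hm := (isRelabelling_refl Φ).mem_assistedValues hΦ (ι := κ) (E := fun _ => Fin 1) (P := 0)
    (ψ := fun j x => v j x.1) hp hp1 (fun j => by rw [margin_pure]; exact h.pure j)
    (by simp [margin_pure, entropy_ketbra (h.pure _)])
  have e1 : ∀ j, condEntropy (ampliate Φ (Fin 1) (ketbra fun x => v j x.1)) = entropy (T j) := by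
    intro j
    have e2 : ampliate Φ (Fin 1) (ketbra fun x => v j x.1)
        = (T j).submatrix (Equiv.prodUnique B (Fin 1)) (Equiv.prodUnique B (Fin 1)) := by
      rw [← h.map_ketbra]; rfl
    rw [hΦ.condEntropy_ampliate, margin_pure, entropy_ketbra (h.pure j), sub_zero, e2,
      entropy_submatrix _ (h.isDensity hΦ j).1.1]
  simp only [margin_pure, e1] at hm
  convert hm using 1
  simp [holevo, map_sum, h.map_ketbra]

end ClassicalInput

/-! ### Monotonicity and concavity in the assistance -/

section Assisted

variable {A B : Type*} [Fintype A] [DecidableEq A] [Fintype B] [DecidableEq B]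
  {Φ : Matrix A A ℂ →ₗ[ℂ] Matrix B B ℂ}

lemma assistedValues_nonempty [Nonempty A] (hΦ : IsChannel Φ) {P : ℝ} (hP : 0 ≤ P) :
    (assistedValues Φ P).Nonempty := by
  obtain ⟨a, ha⟩ := exists_pure_state (A := A)
  exact ⟨_, (isRelabelling_refl Φ).mem_assistedValues hΦ (ι := Unit) (E := fun _ => Fin 1)
    (p := fun _ => 1) (ψ := fun _ x => a x.1) (by simp) (by simp)
    (fun _ => by rwa [margin_pure]) (by simpa [margin_pure, entropy_ketbra ha])⟩

lemma IsChannel.oneShotAssisted_mono [Nonempty A] (hΦ : IsChannel Φ) {P Q : ℝ} (hP : 0 ≤ P)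
    (hPQ : P ≤ Q) : oneShotAssisted Φ P ≤ oneShotAssisted Φ Q := by
  rw [hΦ.oneShotAssisted_eq, hΦ.oneShotAssisted_eq]
  refine csSup_le_csSup (hΦ.bddAbove_assistedValues Q) (assistedValues_nonempty hΦ hP) ?_
  rintro _ ⟨m, p, k, ψ, h0, h1, hd, hle, rfl⟩
  exact ⟨m, p, k, ψ, h0, h1, hd, hle.trans hPQ, rfl⟩

/-- Beyond `log₂ |A|`, more assistance has no effect. -/
lemma IsChannel.oneShotAssisted_eq_of_le (hΦ : IsChannel Φ) {P : ℝ}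
    (hP : Real.logb 2 (Fintype.card A) ≤ P) :
    oneShotAssisted Φ P = oneShotAssisted Φ (Real.logb 2 (Fintype.card A)) := by
  rw [hΦ.oneShotAssisted_eq, hΦ.oneShotAssisted_eq]
  congr 1
  ext x
  constructor
  · rintro ⟨m, p, k, ψ, h0, h1, hd, hle, rfl⟩
    refine ⟨m, p, k, ψ, h0, h1, hd, ?_, rfl⟩
    refine (Finset.sum_le_sum fun i _ => mul_le_mul_of_nonneg_left
      (entropy_le_logb_card (hd i)) (h0 i)).trans ?_
    rw [← Finset.sum_mul, h1, one_mul]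
  · rintro ⟨m, p, k, ψ, h0, h1, hd, hle, rfl⟩
    exact ⟨m, p, k, ψ, h0, h1, hd, hle.trans hP, rfl⟩

/-- Merge the two ensembles with weights `s` and `t`. All terms are linear in the ensemble except
the entropy of the average output, which is concave. -/
lemma exists_assistedValues_ge (hΦ : IsChannel Φ) {P Q s t x y : ℝ} (hs : 0 ≤ s) (ht : 0 ≤ t)
    (hst : s + t = 1) (hx : x ∈ assistedValues Φ P) (hy : y ∈ assistedValues Φ Q) :
    ∃ z ∈ assistedValues Φ (s * P + t * Q), s * x + t * y ≤ z := by
  obtain ⟨m, p, k, ψ, h0, h1, hd, hle, rfl⟩ := hx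
  obtain ⟨m', p', k', ψ', h0', h1', hd', hle', rfl⟩ := hy
  let r : Fin m ⊕ Fin m' → ℝ := Sum.elim (fun i => s * p i) (fun i => t * p' i)
  let χ : ∀ i : Fin m ⊕ Fin m', A × Fin (Sum.elim k k' i) → ℂ := fun i =>
    match i with
    | .inl i => ψ i
    | .inr i => ψ' i
  have hr0 : ∀ i, 0 ≤ r i := by
    rintro (i | i)
    exacts [mul_nonneg hs (h0 i), mul_nonneg ht (h0' i)]
  have hr1 : ∑ i, r i = 1 := by
    simp [r, Fintype.sum_sum_type, ← Finset.mul_sum, h1, h1', hst]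
  have hχ : ∀ i, IsDensity (margin (χ i)) := by
    rintro (i | i)
    exacts [hd i, hd' i]
  refine ⟨_, (isRelabelling_refl Φ).mem_assistedValues hΦ hr0 hr1 hχ ?_, ?_⟩
  · rw [Fintype.sum_sum_type]
    simp only [r, χ, Sum.elim_inl, Sum.elim_inr, mul_assoc, ← Finset.mul_sum]
    exact add_le_add (mul_le_mul_of_nonneg_left hle hs) (mul_le_mul_of_nonneg_left hle' ht)
  · rw [Fintype.sum_sum_type, Fintype.sum_sum_type]
    simp only [r, χ, Sum.elim_inl, Sum.elim_inr, mul_assoc, ← Finset.mul_sum,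
      Complex.ofReal_mul, mul_smul, ← Finset.smul_sum, map_add, map_smul]
    have hc := sum_entropy_le (κ := Fin 2) (p := ![s, t])
      (X := ![Φ (∑ i, (p i : ℂ) • margin (ψ i)), Φ (∑ i, (p' i : ℂ) • margin (ψ' i))])
      (by intro i; fin_cases i <;> simpa) (by simpa [Fin.sum_univ_two])
      (by
        intro i
        fin_cases i
        exacts [hΦ.isDensity (isDensity_sum h0 h1 hd), hΦ.isDensity (isDensity_sum h0' h1' hd')])
    simp only [Fin.sum_univ_two, Matrix.cons_val_zero, Matrix.cons_val_one] at hc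
    have hle : s * (entropy (Φ (∑ i, (p i : ℂ) • margin (ψ i)))
          - ∑ i, p i * condEntropy (ampliate Φ (Fin (k i)) (ketbra (ψ i))))
        + t * (entropy (Φ (∑ i, (p' i : ℂ) • margin (ψ' i)))
          - ∑ i, p' i * condEntropy (ampliate Φ (Fin (k' i)) (ketbra (ψ' i))))
        ≤ entropy ((s : ℂ) • Φ (∑ i, (p i : ℂ) • margin (ψ i))
            + (t : ℂ) • Φ (∑ i, (p' i : ℂ) • margin (ψ' i)))
          - (s * ∑ i, p i * condEntropy (ampliate Φ (Fin (k i)) (ketbra (ψ i)))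
            + t * ∑ i, p' i * condEntropy (ampliate Φ (Fin (k' i)) (ketbra (ψ' i)))) := by
      linarith
    exact hle

lemma IsChannel.concaveOn_oneShotAssisted [Nonempty A] (hΦ : IsChannel Φ) :
    ConcaveOn ℝ (Set.Ici 0) (oneShotAssisted Φ) := by
  refine ⟨convex_Ici 0, fun P hP Q hQ s t hs ht hst => ?_⟩
  simp only [Set.mem_Ici, smul_eq_mul] at *
  rw [hΦ.oneShotAssisted_eq, hΦ.oneShotAssisted_eq, hΦ.oneShotAssisted_eq]
  refine le_of_forall_pos_lt_add fun ε hε => ?_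
  obtain ⟨x, hx, hxε⟩ := exists_lt_of_lt_csSup (assistedValues_nonempty hΦ hP)
    (sub_lt_self (sSup (assistedValues Φ P)) (half_pos hε))
  obtain ⟨y, hy, hyε⟩ := exists_lt_of_lt_csSup (assistedValues_nonempty hΦ hQ)
    (sub_lt_self (sSup (assistedValues Φ Q)) (half_pos hε))
  obtain ⟨z, hz, hxyz⟩ := exists_assistedValues_ge hΦ hs ht hst hx hy
  have h1 := le_csSup (hΦ.bddAbove_assistedValues _) hz
  have h2 : s * (sSup (assistedValues Φ P) - ε / 2) ≤ s * x := mul_le_mul_of_nonneg_left hxε.le hs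
  have h3 : t * (sSup (assistedValues Φ Q) - ε / 2) ≤ t * y := mul_le_mul_of_nonneg_left hyε.le ht
  have h4 : s * (ε / 2) + t * (ε / 2) = ε / 2 := by rw [← add_mul, hst, one_mul]
  linarith

/-- An isometric embedding of inputs can only increase the assisted capacity. -/
lemma oneShotAssisted_le_of_isometry {A' : Type*} [Fintype A'] [DecidableEq A'] [Nonempty A']
    {Φ' : Matrix A' A' ℂ →ₗ[ℂ] Matrix B B ℂ} (hΦ : IsChannel Φ) (hΦ' : IsChannel Φ')
    {J : Matrix A A' ℂ} (hJ : Jᴴ * J = 1) (h : ∀ X, Φ (J * X * Jᴴ) = Φ' X) {P : ℝ} (hP : 0 ≤ P) :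
    oneShotAssisted Φ' P ≤ oneShotAssisted Φ P := by
  rw [hΦ.oneShotAssisted_eq, hΦ'.oneShotAssisted_eq]
  refine csSup_le_csSup (hΦ.bddAbove_assistedValues P) (assistedValues_nonempty hΦ' hP) ?_
  rintro _ ⟨m, p, k, ψ, h0, h1, hd, hle, rfl⟩
  let χ : ∀ i, A × Fin (k i) → ℂ := fun i x => ∑ a, J x.1 a * ψ i (a, x.2)
  have e0 : ∀ i e e', (Matrix.of fun a a' => ketbra (χ i) (a, e) (a', e'))
      = J * (Matrix.of fun a a' => ketbra (ψ i) (a, e) (a', e')) * Jᴴ := by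
    intro i e e'
    ext a a'
    simp only [of_apply, ketbra_apply, χ, Matrix.mul_apply, conjTranspose_apply, star_sum,
      star_mul']
    rw [Finset.sum_mul_sum, Finset.sum_comm]
    refine Finset.sum_congr rfl fun b' _ => ?_
    rw [Finset.sum_mul]
    exact Finset.sum_congr rfl fun b _ => by ring
  have e1 : ∀ i, margin (χ i) = J * margin (ψ i) * Jᴴ := by
    intro i
    have e3 : ∀ (ψ : A × Fin (k i) → ℂ), margin ψ
        = ∑ e, Matrix.of fun a a' => ketbra ψ (a, e) (a', e) := by
      intro ψ; ext a a'; simp [margin, Matrix.sum_apply]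
    have e3' : ∀ (ψ : A' × Fin (k i) → ℂ), margin ψ
        = ∑ e, Matrix.of fun a a' => ketbra ψ (a, e) (a', e) := by
      intro ψ; ext a a'; simp [margin, Matrix.sum_apply]
    rw [e3, e3', Matrix.mul_sum, Matrix.sum_mul]
    exact Finset.sum_congr rfl fun e _ => e0 i e e
  -- The isometry acts on the input only, so normalization and input entropy can be read off from
  -- the unchanged reference state.
  have e2 : ∀ i, trLeft (ketbra (χ i)) = trLeft (ketbra (ψ i)) := by
    intro i
    ext e e'
    change (Matrix.of fun a a' => ketbra (χ i) (a, e) (a', e')).trace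
      = (Matrix.of fun a a' => ketbra (ψ i) (a, e) (a', e')).trace
    rw [e0, trace_mul_comm, ← Matrix.mul_assoc, hJ, Matrix.one_mul]
  have e4 : ∀ i, ampliate Φ (Fin (k i)) (ketbra (χ i)) = ampliate Φ' (Fin (k i)) (ketbra (ψ i)) := by
    intro i
    ext x y
    rw [ampliate_apply, ampliate_apply, e0, h]
  refine ⟨m, p, k, χ, h0, h1, fun i => ?_, ?_, ?_⟩
  · rw [isDensity_margin_iff, ← isDensity_trLeft_ketbra_iff, e2, isDensity_trLeft_ketbra_iff,
      ← isDensity_margin_iff]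
    exact hd i
  · simpa only [entropy_margin, e2] using hle
  · simp only [e4, e1]
    congr 2
    rw [← h, Matrix.mul_sum, Matrix.sum_mul]
    simp only [Matrix.mul_smul, Matrix.smul_mul]

end Assisted

/-! ### The conditional channel and achievability -/

section CondChannel

variable {A B : Type*} [Fintype A] [DecidableEq A] [Fintype B] [DecidableEq B]
  {ι : Type*} [Fintype ι] [DecidableEq ι]

lemma condChannel_apply (N₀ N₁ : Matrix A A ℂ →ₗ[ℂ] Matrix B B ℂ)
    (X : Matrix (Fin 2 × A) (Fin 2 × A) ℂ) :
    condChannel N₀ N₁ X = N₀ (X.submatrix (Prod.mk 0) (Prod.mk 0))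
      + N₁ (X.submatrix (Prod.mk 1) (Prod.mk 1)) := rfl

lemma isChannel_condChannel {N₀ N₁ : Matrix A A ℂ →ₗ[ℂ] Matrix B B ℂ} (h₀ : IsChannel N₀)
    (h₁ : IsChannel N₁) : IsChannel (condChannel N₀ N₁) where
  completely_positive k X hX := by
    have h : ampliate (condChannel N₀ N₁) (Fin k) X
        = ampliate N₀ (Fin k) (X.submatrix (Prod.map (Prod.mk 0) id) (Prod.map (Prod.mk 0) id))
        + ampliate N₁ (Fin k) (X.submatrix (Prod.map (Prod.mk 1) id) (Prod.map (Prod.mk 1) id)) := by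
      ext x y; rfl
    rw [h]
    exact (h₀.posSemidef_ampliate (hX.submatrix _)).add (h₁.posSemidef_ampliate (hX.submatrix _))
  trace_preserving X := by
    rw [condChannel_apply, trace_add, h₀.trace_preserving, h₁.trace_preserving]
    simp [Matrix.trace, Fintype.sum_prod_type, Fin.sum_univ_two]

/-- The isometry `|a⟩ ↦ |c⟩|a⟩`. -/
def blockInclusion (A : Type*) [DecidableEq A] (c : Fin 2) : Matrix (Fin 2 × A) A ℂ :=
  Matrix.of fun w a => if w = (c, a) then 1 else 0

lemma blockInclusion_isometry (c : Fin 2) :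
    (blockInclusion A c)ᴴ * blockInclusion A c = 1 := by
  ext a a'
  rw [Matrix.mul_apply, Finset.sum_eq_single (c, a)]
  · simp [blockInclusion, one_apply, conjTranspose_apply]
  · intro w _ hw; simp [blockInclusion, conjTranspose_apply, hw]
  · simp

lemma blockInclusion_conj_submatrix (c d : Fin 2) (X : Matrix A A ℂ) :
    (blockInclusion A c * X * (blockInclusion A c)ᴴ).submatrix (Prod.mk d) (Prod.mk d)
      = if d = c then X else 0 := by
  ext a a'
  by_cases h : d = c
  · subst h
    simp [blockInclusion, Matrix.mul_apply, conjTranspose_apply, apply_ite star]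
  · simp [blockInclusion, Matrix.mul_apply, conjTranspose_apply, h]

lemma condChannel_block_zero (N₀ N₁ : Matrix A A ℂ →ₗ[ℂ] Matrix B B ℂ) (X : Matrix A A ℂ) :
    condChannel N₀ N₁ (blockInclusion A 0 * X * (blockInclusion A 0)ᴴ) = N₀ X := by
  rw [condChannel_apply, blockInclusion_conj_submatrix, blockInclusion_conj_submatrix]
  simp

lemma condChannel_block_one (N₀ N₁ : Matrix A A ℂ →ₗ[ℂ] Matrix B B ℂ) (X : Matrix A A ℂ) :
    condChannel N₀ N₁ (blockInclusion A 1 * X * (blockInclusion A 1)ᴴ) = N₁ X := by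
  rw [condChannel_apply, blockInclusion_conj_submatrix, blockInclusion_conj_submatrix]
  simp

lemma wordMap_conj {A' : Type*} [Fintype A'] [DecidableEq A']
    {Φ : Matrix A A ℂ →ₗ[ℂ] Matrix B B ℂ} {Φ' : Matrix A' A' ℂ →ₗ[ℂ] Matrix B B ℂ}
    {J : Matrix A A' ℂ} (h : ∀ X, Φ (J * X * Jᴴ) = Φ' X) (X : Matrix (ι → A') (ι → A') ℂ) :
    wordMap Φ ι ((piMat fun _ : ι => J) * X * (piMat fun _ : ι => J)ᴴ) = wordMap Φ' ι X := by
  ext b b'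
  have h1 : ∀ c c' b b', Φ' (single c c' 1) b b'
      = ∑ a, ∑ a', J a c * star (J a' c') * Φ (single a a' 1) b b' := by
    intro c c' b b'
    rw [← h, map_apply_eq_sum]
    refine Finset.sum_congr rfl fun a _ => Finset.sum_congr rfl fun a' _ => ?_
    congr 1
    rw [Matrix.mul_apply, Finset.sum_eq_single c']
    · simp [conjTranspose_apply]
    · intro x _ hx
      rw [mul_single_apply_of_ne (hbj := hx), zero_mul]
    · simp
  rw [wordMap_apply, wordMap_apply]
  simp only [h1, ← sum_sum_prod, Matrix.mul_apply, conjTranspose_apply, piMat_apply,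
    Finset.mul_sum, Finset.sum_mul, Finset.prod_mul_distrib, star_prod]
  calc _ = ∑ a : ι → A, ∑ a' : ι → A, ∑ c : ι → A', ∑ c' : ι → A',
        (∏ i, J (a i) (c i)) * X c c' * (∏ i, star (J (a' i) (c' i))) *
          ∏ i, Φ (single (a i) (a' i) 1) (b i) (b' i) :=
        Finset.sum_congr rfl fun a _ => Finset.sum_congr rfl fun a' _ => Finset.sum_comm
    _ = ∑ a : ι → A, ∑ c : ι → A', ∑ c' : ι → A', ∑ a' : ι → A,
        (∏ i, J (a i) (c i)) * X c c' * (∏ i, star (J (a' i) (c' i))) *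
          ∏ i, Φ (single (a i) (a' i) 1) (b i) (b' i) := by
        refine Finset.sum_congr rfl fun a _ => ?_
        rw [Finset.sum_comm]
        exact Finset.sum_congr rfl fun c _ => Finset.sum_comm
    _ = _ := by
        rw [Finset.sum_comm]
        refine Finset.sum_congr rfl fun c _ => ?_
        rw [Finset.sum_comm]
        refine Finset.sum_congr rfl fun c' _ => Finset.sum_congr rfl fun a _ =>
          Finset.sum_congr rfl fun a' _ => ?_
        ring

lemma piMat_isometry {A' : Type*} [Fintype A'] [DecidableEq A'] {J : Matrix A A' ℂ}
    (hJ : Jᴴ * J = 1) : (piMat fun _ : ι => J)ᴴ * (piMat fun _ : ι => J) = 1 := by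
  rw [piMat_conjTranspose, piMat_mul]
  simp only [hJ, piMat_one]

/-- Time sharing between the two branches of a conditional channel. -/
lemma IsMeasurePrepare.timeSharing_le_nShotAssisted [Nonempty A] {κ : Type*} [Fintype κ]
    [DecidableEq κ] [Nonempty κ] {v : κ → A → ℂ} {T : κ → Matrix B B ℂ}
    {N₀ N₁ : Matrix A A ℂ →ₗ[ℂ] Matrix B B ℂ}
    (h : IsMeasurePrepare v T N₀) (h₀ : IsChannel N₀) (h₁ : IsChannel N₁) {n : ℕ} (hn : n ≠ 0)
    {q Q P : ℝ} (hq : 0 ≤ q) (hq1 : q ≤ 1) (hQ : 0 ≤ Q) (hP : (1 - q) * Q = P) :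
    q * sSup (holevoValues T) + (1 - q) * nShotAssisted N₁ Q n
      ≤ nShotAssisted (condChannel N₀ N₁) P n := by
  have hn0 : (0 : ℝ) < n := by exact_mod_cast Nat.pos_of_ne_zero hn
  have hN := isChannel_condChannel h₀ h₁
  -- The branch `N₀` is used with zero assistance.
  have e0 : n * sSup (holevoValues T) ≤ oneShotAssisted (tensorPower (condChannel N₀ N₁) n) 0 := by
    refine le_trans ?_ (oneShotAssisted_le_of_isometry (isChannel_tensorPower hN n)
      (isChannel_tensorPower h₀ n) (piMat_isometry (blockInclusion_isometry 0))
      (wordMap_conj (condChannel_block_zero N₀ N₁)) le_rfl)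
    have := (h.wordMap (ι := Fin n)).le_oneShotAssisted h₀.wordMap
    rwa [sSup_holevoValues_piMat (h.isDensity h₀), Fintype.card_fin] at this
  have e1 : oneShotAssisted (tensorPower N₁ n) (n * Q)
      ≤ oneShotAssisted (tensorPower (condChannel N₀ N₁) n) (n * Q) :=
    oneShotAssisted_le_of_isometry (isChannel_tensorPower hN n)
      (isChannel_tensorPower h₁ n) (piMat_isometry (blockInclusion_isometry 1))
      (wordMap_conj (condChannel_block_one N₀ N₁)) (by positivity)
  -- Concavity between total assistance `0`, with weight `q`, and `n * Q`, with weight `1 - q`.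
  have hc := (isChannel_tensorPower hN n).concaveOn_oneShotAssisted.2 (x := 0) (y := n * Q)
    (Set.mem_Ici.mpr le_rfl) (Set.mem_Ici.mpr (by positivity)) hq (sub_nonneg.mpr hq1)
    (add_sub_cancel _ _)
  simp only [smul_eq_mul, mul_zero, zero_add] at hc
  rw [show (1 - q) * (n * Q) = n * P by rw [← hP]; ring] at hc
  have e2 := mul_le_mul_of_nonneg_left e0 hq
  have e3 := mul_le_mul_of_nonneg_left e1 (sub_nonneg.mpr hq1)
  rw [nShotAssisted, nShotAssisted, le_div_iff₀ hn0, add_mul]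
  have e4 : (1 - q) * (oneShotAssisted (tensorPower N₁ n) (n * Q) / n) * n
      = (1 - q) * oneShotAssisted (tensorPower N₁ n) (n * Q) := by field_simp
  rw [e4]
  linarith

end CondChannel

/-! ### Expansion over branches and the entropy bound -/

section Branches

variable {A B κ ι E : Type*} [Fintype A] [DecidableEq A] [Fintype B] [DecidableEq B] [Fintype κ]
  [DecidableEq κ] [Fintype ι] [DecidableEq ι] [Fintype E] [DecidableEq E]

/-- The functional on the input that is read off when the letter `some j` is measured. -/
def branchCoeff (v : κ → A → ℂ) : Option κ → Fin 2 × A → ℂ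
  | none, _ => 0
  | some j, w => if w.1 = 0 then star (v j w.2) else 0

/-- The state prepared when the letter `some j` is measured. -/
def branchOutput (T : κ → Matrix B B ℂ) : Option κ → Matrix B B ℂ
  | none => 0
  | some j => T j

/-- The term of the conditional channel that belongs to the letter `s`: `none` stands for the use
of `N₁`, and `some j` for the use of `N₀` with the outcome `j`. -/
def branchTerm (v : κ → A → ℂ) (T : κ → Matrix B B ℂ) (N₁ : Matrix A A ℂ →ₗ[ℂ] Matrix B B ℂ)
    (s : Option κ) (w w' : Fin 2 × A) (b b' : B) : ℂ :=
  if s = none then ∑ a, ∑ a', blockInclusion A 1 w a * star (blockInclusion A 1 w' a') *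
    N₁ (single a a' 1) b b'
  else branchCoeff v s w * star (branchCoeff v s w') * branchOutput T s b b'

variable {v : κ → A → ℂ} {T : κ → Matrix B B ℂ} {N₀ N₁ : Matrix A A ℂ →ₗ[ℂ] Matrix B B ℂ}

lemma sandwich_single (v : A → ℂ) (a a' : A) (c : ℂ) :
    sandwich v (single a a' c) = star (v a) * c * v a' := by
  rw [sandwich, Finset.sum_eq_single a, Finset.sum_eq_single a']
  · simp
  · intro c _ hc; simp [hc.symm]
  · simp
  · intro c _ hc; simp [hc.symm]
  · simp

lemma single_submatrix_mk (c : Fin 2) (w w' : Fin 2 × A) :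
    (single w w' (1 : ℂ)).submatrix (Prod.mk c) (Prod.mk c)
      = single w.2 w'.2 (if w.1 = c ∧ w'.1 = c then 1 else 0) := by
  obtain ⟨m, a⟩ := w
  obtain ⟨m', a'⟩ := w'
  ext x x'
  simp only [submatrix_apply, single_apply, Prod.mk.injEq]
  by_cases h1 : m = c <;> by_cases h2 : m' = c <;> simp [h1, h2]

/-- Only the two diagonal blocks of the register matter; the block `0` splits further over the
outcomes of `N₀`. -/
lemma IsMeasurePrepare.condChannel_single (h : IsMeasurePrepare v T N₀) (w w' : Fin 2 × A)
    (b b' : B) :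
    condChannel N₀ N₁ (single w w' 1) b b' = ∑ s, branchTerm v T N₁ s w w' b b' := by
  rw [condChannel_apply, Fintype.sum_option, single_submatrix_mk, single_submatrix_mk, h.map_eq,
    Matrix.add_apply, add_comm]
  congr 1
  · rw [branchTerm, if_pos rfl]
    obtain ⟨m, a⟩ := w
    obtain ⟨m', a'⟩ := w'
    dsimp only
    by_cases hm : m = 1
    · by_cases hm' : m' = 1
      · simp only [blockInclusion, hm, hm', of_apply, Prod.mk.injEq, true_and, apply_ite star,
          star_one, star_zero, ite_mul, one_mul, zero_mul, mul_ite, mul_zero, and_self, if_true]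
        simp
      · simp [blockInclusion, hm']
    · simp [blockInclusion, hm]
  · rw [Matrix.sum_apply]
    refine Finset.sum_congr rfl fun j _ => ?_
    rw [branchTerm, if_neg (Option.some_ne_none j), sandwich_single, Matrix.smul_apply, smul_eq_mul]
    by_cases h1 : w.1 = 0 <;> by_cases h2 : w'.1 = 0 <;>
      simp [branchCoeff, branchOutput, h1, h2]

/-- The (unnormalized) vector on the remaining uses of `N₁` in the branch `x`. -/
def branchVector (v : κ → A → ℂ) (x : ι → Option κ) (ψ : (ι → Fin 2 × A) × E → ℂ) :
    ({i // x i = none} → A) × E → ℂ :=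
  fun y => ∑ w : ι → Fin 2 × A, (∏ i : {i // ¬ x i = none}, branchCoeff v (x i) (w i)) *
    (∏ i : {i // x i = none}, blockInclusion A 1 (w i) (y.1 i)) * ψ (w, y.2)

/-- The output on the uses of `N₁` in the branch `x`. -/
def branchCore (v : κ → A → ℂ) (N₁ : Matrix A A ℂ →ₗ[ℂ] Matrix B B ℂ) (x : ι → Option κ)
    (ψ : (ι → Fin 2 × A) × E → ℂ) :
    Matrix (({i // x i = none} → B) × E) (({i // x i = none} → B) × E) ℂ :=
  ampliate (wordMap N₁ {i // x i = none}) E (ketbra (branchVector v x ψ))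

/-- The regrouping of the output letters according to the branch. -/
def branchEquiv (B E : Type*) (x : ι → Option κ) :
    (ι → B) × E ≃ ({i // ¬ x i = none} → B) × (({i // x i = none} → B) × E) :=
  (((Equiv.piEquivPiSubtypeProd (fun i => x i = none) (fun _ => B)).trans
    (Equiv.prodComm _ _)).prodCongr (Equiv.refl E)).trans (Equiv.prodAssoc _ _ _)

/-- The output in the branch `x`. -/
def branchState (v : κ → A → ℂ) (T : κ → Matrix B B ℂ) (N₁ : Matrix A A ℂ →ₗ[ℂ] Matrix B B ℂ)
    (x : ι → Option κ) (ψ : (ι → Fin 2 × A) × E → ℂ) : Matrix ((ι → B) × E) ((ι → B) × E) ℂ :=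
  ((piMat fun i : {i // ¬ x i = none} => branchOutput T (x i)) ⊗ₖ
    branchCore v N₁ x ψ).submatrix (branchEquiv B E x) (branchEquiv B E x)

lemma branchState_apply (x : ι → Option κ) (ψ : (ι → Fin 2 × A) × E → ℂ) (b b' : ι → B)
    (e e' : E) : branchState v T N₁ x ψ (b, e) (b', e')
      = (∏ i : {i // ¬ x i = none}, branchOutput T (x i) (b i) (b' i)) *
        branchCore v N₁ x ψ (fun i => b i, e) (fun i => b' i, e') := rfl

/-- Splits the positions according to the branch. The default values at `none` never enter, since
those products run over the other positions. -/
lemma prod_branchTerm (x : ι → Option κ) (w w' : ι → Fin 2 × A) (b b' : ι → B) :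
    ∏ i, branchTerm v T N₁ (x i) (w i) (w' i) (b i) (b' i)
      = (∏ i : {i // ¬ x i = none}, branchCoeff v (x i) (w i)) *
        (∏ i : {i // ¬ x i = none}, star (branchCoeff v (x i) (w' i))) *
        (∏ i : {i // ¬ x i = none}, branchOutput T (x i) (b i) (b' i)) *
        ∑ a : {i // x i = none} → A, ∑ a' : {i // x i = none} → A,
          (∏ i : {i // x i = none}, blockInclusion A 1 (w i) (a i)) *
            (∏ i : {i // x i = none}, star (blockInclusion A 1 (w' i) (a' i))) *
            ∏ i, N₁ (single (a i) (a' i) 1) (b i) (b' i) := by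
  rw [← Fintype.prod_subtype_mul_prod_subtype (fun i => x i = none), mul_comm]
  simp only [← Finset.prod_mul_distrib]
  rw [sum_sum_prod (fun (i : {i // x i = none}) a a' => blockInclusion A 1 (w i) a *
    star (blockInclusion A 1 (w' i) a') * N₁ (single a a' 1) (b i) (b' i))]
  congr 1
  · exact Finset.prod_congr rfl fun i _ => by rw [branchTerm, if_neg i.2]
  · exact Finset.prod_congr rfl fun i _ => by rw [branchTerm, if_pos i.2]

/-- The output of a tensor power of a conditional channel is the sum over the branches. -/
lemma IsMeasurePrepare.ampliate_condChannel (h : IsMeasurePrepare v T N₀)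
    (ψ : (ι → Fin 2 × A) × E → ℂ) :
    ampliate (CECapacity.wordMap (condChannel N₀ N₁) ι) E (ketbra ψ)
      = ∑ x : ι → Option κ, branchState v T N₁ x ψ := by
  ext ⟨b, e⟩ ⟨b', e'⟩
  rw [ampliate_apply, wordMap_apply, Matrix.sum_apply]
  simp only [h.condChannel_single, Fintype.prod_sum, Finset.mul_sum, of_apply]
  rw [Finset.sum_congr rfl fun w _ => Finset.sum_comm, Finset.sum_comm]
  refine Finset.sum_congr rfl fun x _ => ?_
  rw [branchState_apply, branchCore, ampliate_apply, wordMap_apply]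
  simp only [prod_branchTerm, of_apply, ketbra_apply, branchVector, star_sum, star_mul',
    star_prod, Finset.sum_mul_sum]
  simp only [Finset.mul_sum, Finset.sum_mul]
  calc _ = ∑ w : ι → Fin 2 × A, ∑ a : {i // x i = none} → A, ∑ a' : {i // x i = none} → A,
        ∑ w' : ι → Fin 2 × A,
        ψ (w, e) * star (ψ (w', e')) *
        ((∏ i : {i // ¬ x i = none}, branchCoeff v (x i) (w i)) *
        (∏ i : {i // ¬ x i = none}, star (branchCoeff v (x i) (w' i))) *
        (∏ i : {i // ¬ x i = none}, branchOutput T (x i) (b i) (b' i)) *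
          ((∏ i : {i // x i = none}, blockInclusion A 1 (w i) (a i)) *
            (∏ i : {i // x i = none}, star (blockInclusion A 1 (w' i) (a' i))) *
            ∏ i, N₁ (single (a i) (a' i) 1) (b i) (b' i))) := by
        refine Finset.sum_congr rfl fun w _ => ?_
        rw [Finset.sum_comm]
        exact Finset.sum_congr rfl fun a _ => Finset.sum_comm
    _ = _ := by
        rw [Finset.sum_comm]
        refine Finset.sum_congr rfl fun a _ => ?_
        rw [Finset.sum_comm]
        refine Finset.sum_congr rfl fun a' _ => Finset.sum_congr rfl fun w _ =>
          Finset.sum_congr rfl fun w' _ => ?_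
        ring

lemma posSemidef_branchCore (h₁ : IsChannel N₁) (x : ι → Option κ)
    (ψ : (ι → Fin 2 × A) × E → ℂ) : (branchCore v N₁ x ψ).PosSemidef :=
  h₁.wordMap.posSemidef_ampliate (posSemidef_ketbra _)

lemma isDensity_branchOutput (hT : ∀ j, IsDensity (T j)) {s : Option κ} (hs : ¬ s = none) :
    IsDensity (branchOutput T s) := by
  cases s with
  | none => exact absurd rfl hs
  | some j => exact hT j

lemma posSemidef_branchState (hT : ∀ j, IsDensity (T j)) (h₁ : IsChannel N₁) (x : ι → Option κ)
    (ψ : (ι → Fin 2 × A) × E → ℂ) : (branchState v T N₁ x ψ).PosSemidef :=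
  ((posSemidef_piMat fun i : {i // ¬ x i = none} => (isDensity_branchOutput hT i.2).1).kronecker
    (posSemidef_branchCore h₁ x ψ)).submatrix _

/-- The states `T j` have trace one, so tracing them out leaves the part on the uses of `N₁`. -/
lemma trLeft_branchState (hT : ∀ j, IsDensity (T j)) (x : ι → Option κ)
    (ψ : (ι → Fin 2 × A) × E → ℂ) :
    trLeft (branchState v T N₁ x ψ) = trLeft (branchCore v N₁ x ψ) := by
  ext e e'
  simp only [trLeft, of_apply]
  rw [← (Equiv.piEquivPiSubtypeProd (fun i => x i = none) (fun _ => B)).symm.sum_comp,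
    Fintype.sum_prod_type]
  refine Finset.sum_congr rfl fun b _ => ?_
  have h1 : ∀ c : {i // ¬ x i = none} → B, branchState v T N₁ x ψ
      ((Equiv.piEquivPiSubtypeProd (fun i => x i = none) (fun _ => B)).symm (b, c), e)
      ((Equiv.piEquivPiSubtypeProd (fun i => x i = none) (fun _ => B)).symm (b, c), e')
      = (piMat fun i : {i // ¬ x i = none} => branchOutput T (x i)) c c *
        branchCore v N₁ x ψ (b, e) (b, e') := by
    intro c
    have h2 := (Equiv.piEquivPiSubtypeProd (fun i => x i = none) (fun _ => B)).apply_symm_apply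
      (b, c)
    simp only [branchState, submatrix_apply, branchEquiv, Equiv.trans_apply,
      Equiv.prodCongr_apply, Prod.map_apply, h2]
    rfl
  simp only [h1, ← Finset.sum_mul]
  have h3 := (isDensity_piMat fun i : {i // ¬ x i = none} => isDensity_branchOutput hT i.2).2
  rw [Matrix.trace] at h3
  simp only [diag_apply] at h3
  rw [h3, one_mul]

/-- Entropies of a product add, each weighted by the trace of the other factor; the core is
unnormalized, and its trace is the weight of the branch. -/
lemma condEntropy_branchState (hT : ∀ j, IsDensity (T j)) (h₁ : IsChannel N₁) (x : ι → Option κ)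
    (ψ : (ι → Fin 2 × A) × E → ℂ) :
    condEntropy (branchState v T N₁ x ψ) = (branchCore v N₁ x ψ).trace.re *
      ∑ i : {i // ¬ x i = none}, entropy (branchOutput T (x i))
        + condEntropy (branchCore v N₁ x ψ) := by
  have hd := fun i : {i // ¬ x i = none} => isDensity_branchOutput hT i.2
  have hc := posSemidef_branchCore (v := v) h₁ x ψ
  rw [condEntropy, trLeft_branchState hT, branchState,
    entropy_submatrix _ ((posSemidef_piMat fun i => (hd i).1).kronecker hc).1,
    entropy_kronecker (posSemidef_piMat fun i => (hd i).1).1 hc.1, (isDensity_piMat hd).2,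
    entropy_piMat hd, condEntropy, Complex.one_re]
  ring

lemma exists_normalized {ψ : A × E → ℂ} (h : 0 < (ketbra ψ).trace.re) :
    ∃ φ : A × E → ℂ, IsDensity (margin φ) ∧ ketbra ψ = ((ketbra ψ).trace.re : ℂ) • ketbra φ := by
  set w := (ketbra ψ).trace.re with hw
  have hw' : (ketbra ψ).trace = (w : ℂ) :=
    (Complex.ext rfl (Complex.nonneg_iff.mp (posSemidef_ketbra ψ).trace_nonneg).2.symm)
  have hs : Complex.normSq ((Real.sqrt w)⁻¹ : ℝ) = w⁻¹ := by
    rw [Complex.normSq_ofReal, ← mul_inv, Real.mul_self_sqrt h.le]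
  have hk : ketbra ((((Real.sqrt w)⁻¹ : ℝ) : ℂ) • ψ) = ((w⁻¹ : ℝ) : ℂ) • ketbra ψ := by
    rw [ketbra_smul, hs]
  have hne : (w : ℂ) ≠ 0 := by exact_mod_cast h.ne'
  refine ⟨(((Real.sqrt w)⁻¹ : ℝ) : ℂ) • ψ, ?_, ?_⟩
  · rw [isDensity_margin_iff]
    refine ⟨posSemidef_ketbra _, ?_⟩
    rw [hk, trace_smul, hw', smul_eq_mul]
    push_cast
    exact inv_mul_cancel₀ hne
  · rw [hk, smul_smul]
    push_cast
    rw [mul_inv_cancel₀ hne, one_smul]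

/-- The conditional entropy of a branch is bounded by the minimal entropy gaps of the powers
of `N₁` and the output entropies of `N₀`. -/
lemma exists_le_condEntropy_branchState (hT : ∀ j, IsDensity (T j)) (h₁ : IsChannel N₁)
    {μ : ℝ} (hμ : ∀ j, μ ≤ entropy (T j)) {g : ℝ → ℝ}
    (hg : ∀ k ≤ Fintype.card ι, ∀ S, 0 ≤ S →
      g S ≤ (Fintype.card ι - k) * μ + minEntropyGap (tensorPower N₁ k) S)
    (x : ι → Option κ) {ψ : (ι → Fin 2 × A) × E → ℂ} (hψ : IsDensity (margin ψ)) :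
    ∃ (w : ℝ) (σ : Matrix E E ℂ), 0 ≤ w ∧ IsDensity σ ∧
      trLeft (branchState v T N₁ x ψ) = (w : ℂ) • σ ∧
      w * g (entropy σ) ≤ condEntropy (branchState v T N₁ x ψ) := by
  have hps := posSemidef_ketbra (branchVector v x ψ)
  -- A branch of weight zero vanishes, and any density matrix can serve as `σ`.
  rcases (Complex.nonneg_iff.mp hps.trace_nonneg).1.eq_or_lt with h0 | h0
  · have h2 : (ketbra (branchVector v x ψ)).trace = 0 :=
      Complex.ext h0.symm (Complex.nonneg_iff.mp hps.trace_nonneg).2.symm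
    rw [hps.trace_eq_zero_iff] at h2
    have h3 : branchCore v N₁ x ψ = 0 := by
      rw [branchCore, h2]
      have := ampliate_smul (E := E) (wordMap N₁ {i // x i = none}) 0 0
      simpa using this
    have h4 : branchState v T N₁ x ψ = 0 := by rw [branchState, h3, kronecker_zero]; rfl
    refine ⟨0, trLeft (ketbra ψ), le_rfl, isDensity_trLeft_ketbra_iff.mpr
      (isDensity_margin_iff.mp hψ), ?_, ?_⟩
    · rw [h4]; ext; simp [trLeft]
    · rw [h4, zero_mul]
      have h5 : trLeft (0 : Matrix ((ι → B) × E) ((ι → B) × E) ℂ) = 0 := by ext; simp [trLeft]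
      rw [condEntropy, h5, entropy_zero, entropy_zero, sub_zero]
  · obtain ⟨φ, hφ, hφe⟩ := exists_normalized h0
    set w := (ketbra (branchVector v x ψ)).trace.re
    have hcore : branchCore v N₁ x ψ
        = (w : ℂ) • ampliate (wordMap N₁ {i // x i = none}) E (ketbra φ) := by
      rw [branchCore, hφe, ampliate_smul]
    have hφk := isDensity_margin_iff.mp hφ
    have hch := h₁.wordMap (ι := {i // x i = none})
    have hσ := isDensity_trLeft_ketbra_iff.mpr hφk
    refine ⟨w, trLeft (ketbra φ), h0.le, hσ, ?_, ?_⟩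
    · rw [trLeft_branchState hT, hcore, trLeft_smul, hch.trLeft_ampliate]
    · rw [condEntropy_branchState hT h₁, hcore,
        condEntropy_smul (hch.posSemidef_ampliate hφk.1), trace_smul,
        (hch.isDensity_ampliate hφk).2, smul_eq_mul, mul_one, Complex.ofReal_re, ← mul_add]
      refine mul_le_mul_of_nonneg_left ?_ h0.le
      have hk : Fintype.card {i // x i = none} ≤ Fintype.card ι := Fintype.card_subtype_le _
      refine (hg _ hk _ (entropy_nonneg hσ)).trans (add_le_add ?_ ?_)
      · have h6 : (Fintype.card ι - Fintype.card {i // x i = none} : ℝ)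
            = Fintype.card {i // ¬ x i = none} := by
          rw [Fintype.card_subtype_compl, Nat.cast_sub hk]
        rw [h6, ← nsmul_eq_mul]
        refine Finset.card_nsmul_le_sum _ _ _ fun i _ => ?_
        obtain ⟨j, hj⟩ := Option.ne_none_iff_exists'.mp i.2
        rw [hj]
        exact hμ j
      -- The normalized branch vector purifies an input of the power of `N₁`, with reference state
      -- `σ`, hence competes in the minimal gap.
      · rw [(isChannel_tensorPower h₁ _).minEntropyGap_eq]
        refine csInf_le ((isChannel_tensorPower h₁ _).bddBelow_gapValues _) ?_
        exact (isRelabelling_wordMap N₁ (Fintype.equivFin {i // x i = none})).condEntropy_mem_gapValues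
          hch hφ (entropy_margin φ).le

/-- A lower bound on the conditional entropy at the output of a power of a conditional channel. -/
theorem IsMeasurePrepare.le_condEntropy_condChannel (h : IsMeasurePrepare v T N₀)
    (h₀ : IsChannel N₀) (h₁ : IsChannel N₁) {μ : ℝ} (hμ : ∀ j, μ ≤ entropy (T j)) {g : ℝ → ℝ}
    (hg : ∀ k ≤ Fintype.card ι, ∀ S, 0 ≤ S →
      g S ≤ (Fintype.card ι - k) * μ + minEntropyGap (tensorPower N₁ k) S)
    (hconv : ConvexOn ℝ (Set.Ici 0) g) (hanti : AntitoneOn g (Set.Ici 0))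
    {ψ : (ι → Fin 2 × A) × E → ℂ} (hψ : IsDensity (margin ψ)) :
    g (entropy (margin ψ))
      ≤ condEntropy (ampliate (CECapacity.wordMap (condChannel N₀ N₁) ι) E (ketbra ψ)) := by
  have hT := h.isDensity h₀
  choose w σ hw hσ hwσ hle using fun x =>
    exists_le_condEntropy_branchState (v := v) hT h₁ hμ hg x hψ
  have hch := (isChannel_condChannel h₀ h₁).wordMap (ι := ι)
  -- The channel preserves the reference state, which is therefore the mixture of the branch
  -- reference states.
  have hsum : trLeft (ketbra ψ) = ∑ x, (w x : ℂ) • σ x := by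
    rw [← hch.trLeft_ampliate, h.ampliate_condChannel, trLeft_sum]
    exact Finset.sum_congr rfl fun x _ => hwσ x
  have hw1 : ∑ x, w x = 1 := by
    have h1 := (isDensity_trLeft_ketbra_iff.mpr (isDensity_margin_iff.mp hψ)).2
    rw [hsum, trace_sum] at h1
    simp only [trace_smul, (hσ _).2, smul_eq_mul, mul_one] at h1
    exact_mod_cast h1
  rw [entropy_margin, hsum, h.ampliate_condChannel]
  -- Strong subadditivity adds up the branches; convexity of `g` then averages the entropies, and
  -- concavity of the entropy with `g` antitone compares with the whole reference state.
  refine le_trans ?_ (sum_condEntropy_le fun x => posSemidef_branchState hT h₁ x ψ)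
  refine le_trans ?_ (Finset.sum_le_sum fun x _ => hle x)
  have h2 := hconv.map_sum_le (t := Finset.univ) (w := w) (p := fun x => entropy (σ x))
    (fun x _ => hw x) hw1 (fun x _ => entropy_nonneg (hσ x))
  refine le_trans (hanti ?_ ?_ ?_) h2
  · exact Finset.sum_nonneg fun x _ => mul_nonneg (hw x) (entropy_nonneg (hσ x))
  · exact entropy_nonneg (isDensity_sum hw hw1 hσ)
  · exact sum_entropy_le hw hw1 hσ

/-- The output entropy is at most `n log₂ |B|`, and Jensen's inequality for `g` averages the
conditional entropy bound over the ensemble. -/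
theorem IsMeasurePrepare.oneShotAssisted_condChannel_le [Nonempty A] (h : IsMeasurePrepare v T N₀)
    (h₀ : IsChannel N₀) (h₁ : IsChannel N₁) {μ : ℝ} (hμ : ∀ j, μ ≤ entropy (T j)) {g : ℝ → ℝ}
    {n : ℕ} (hg : ∀ k ≤ n, ∀ S, 0 ≤ S →
      g S ≤ (n - k) * μ + minEntropyGap (tensorPower N₁ k) S)
    (hconv : ConvexOn ℝ (Set.Ici 0) g) (hanti : AntitoneOn g (Set.Ici 0)) {P : ℝ} (hP : 0 ≤ P) :
    oneShotAssisted (tensorPower (condChannel N₀ N₁) n) P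
      ≤ n * Real.logb 2 (Fintype.card B) - g P := by
  have hch := isChannel_tensorPower (isChannel_condChannel h₀ h₁) n
  rw [hch.oneShotAssisted_eq]
  refine csSup_le (assistedValues_nonempty hch hP) ?_
  rintro _ ⟨m, p, k, ψ, h0, h1, hd, hle, rfl⟩
  have e1 := entropy_le_logb_card (hch.isDensity (isDensity_sum h0 h1 hd))
  rw [Fintype.card_fun, Fintype.card_fin, Nat.cast_pow, Real.logb_pow] at e1
  have e2 : ∑ i, p i * g (entropy (margin (ψ i))) ≤ ∑ i, p i * condEntropy
      (ampliate (tensorPower (condChannel N₀ N₁) n) (Fin (k i)) (ketbra (ψ i))) :=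
    Finset.sum_le_sum fun i _ => mul_le_mul_of_nonneg_left
      (h.le_condEntropy_condChannel h₀ h₁ hμ (by simpa using hg) hconv hanti (hd i)) (h0 i)
  have e3 := hconv.map_sum_le (t := Finset.univ) (w := p) (p := fun i => entropy (margin (ψ i)))
    (fun i _ => h0 i) h1 (fun i _ => entropy_nonneg (hd i))
  simp only [smul_eq_mul] at e3
  have e4 : g P ≤ g (∑ i, p i * entropy (margin (ψ i))) :=
    hanti (Finset.sum_nonneg fun i _ => mul_nonneg (h0 i) (entropy_nonneg (hd i))) hP hle
  linarith

end Branches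

/-! ### Properties of the time-sharing supremum -/

section TimeSharing

variable {c K : ℝ} {F : ℝ → ℝ}

/-- The properties of an assisted capacity, as a function of the assistance, that time sharing
depends on. -/
structure IsAssistanceCurve (F : ℝ → ℝ) (K : ℝ) : Prop where
  concave : ConcaveOn ℝ (Set.Ici 0) F
  mono : MonotoneOn F (Set.Ici 0)
  nonneg : 0 ≤ K
  const : ∀ P, K ≤ P → F P = F K

lemma IsAssistanceCurve.le (h : IsAssistanceCurve F K) {P : ℝ} (hP : 0 ≤ P) : F P ≤ F K := by
  rw [← h.const (max P K) (le_max_right _ _)]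
  exact h.mono hP (hP.trans (le_max_left _ _)) (le_max_left _ _)

lemma IsAssistanceCurve.bddAbove (h : IsAssistanceCurve F K) (c P : ℝ) :
    BddAbove (timeSharingValues c F P) := by
  refine ⟨max c (F K), ?_⟩
  rintro _ ⟨q, P', hq, hq1, hP', -, rfl⟩
  have h1 := mul_le_mul_of_nonneg_left (le_max_left c (F K)) hq
  have h2 := mul_le_mul_of_nonneg_left ((h.le hP').trans (le_max_right c (F K)))
    (sub_nonneg.mpr hq1)
  linarith

lemma timeSharingValues_nonempty (c : ℝ) (F : ℝ → ℝ) {P : ℝ} (hP : 0 ≤ P) :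
    (timeSharingValues c F P).Nonempty :=
  ⟨_, 0, P, le_rfl, zero_le_one, hP, by ring, rfl⟩

lemma IsAssistanceCurve.timeSharing_le (h : IsAssistanceCurve F K) {q P P' : ℝ} (hq : 0 ≤ q)
    (hq1 : q ≤ 1) (hP' : 0 ≤ P') (hP : (1 - q) * P' = P) :
    q * c + (1 - q) * F P' ≤ sSup (timeSharingValues c F P) :=
  le_csSup (h.bddAbove c P) ⟨q, P', hq, hq1, hP', hP, rfl⟩

/-- For `P > 0` the choice `q = 1` violates `(1 - q) P' = P`, so `c` is only approached, by `q → 1`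
with `F P' ≥ F 0`. -/
lemma IsAssistanceCurve.le_sSup (h : IsAssistanceCurve F K) {P : ℝ} (hP : 0 ≤ P) :
    c ≤ sSup (timeSharingValues c F P) := by
  have h1 : Tendsto (fun q : ℝ => q * c + (1 - q) * F 0) (𝓝[<] 1) (𝓝 c) := by
    have : Continuous fun q : ℝ => q * c + (1 - q) * F 0 := by fun_prop
    have h2 := (this.tendsto 1).mono_left (nhdsWithin_le_nhds (s := Set.Iio 1))
    simpa using h2
  refine le_of_tendsto h1 ?_
  filter_upwards [Ioo_mem_nhdsLT (zero_lt_one' ℝ)] with q hq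
  have hq2 : 0 < 1 - q := sub_pos.mpr hq.2
  have hP' : 0 ≤ P / (1 - q) := div_nonneg hP hq2.le
  refine le_trans ?_ (h.timeSharing_le (c := c) hq.1.le hq.2.le hP' (mul_div_cancel₀ P hq2.ne'))
  have := mul_le_mul_of_nonneg_left (h.mono Set.self_mem_Ici hP' hP') hq2.le
  linarith

lemma IsAssistanceCurve.monotoneOn_sSup (h : IsAssistanceCurve F K) (c : ℝ) :
    MonotoneOn (fun P => sSup (timeSharingValues c F P)) (Set.Ici 0) := by
  intro P hP Q hQ hPQ
  refine csSup_le (timeSharingValues_nonempty c F hP) ?_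
  rintro _ ⟨q, P', hq, hq1, hP', hPP', rfl⟩
  rcases hq1.eq_or_lt with rfl | hq1
  · simpa using h.le_sSup (c := c) hQ
  · have hq2 : 0 < 1 - q := sub_pos.mpr hq1
    have hQ' : 0 ≤ Q / (1 - q) := div_nonneg hQ hq2.le
    refine le_trans ?_ (h.timeSharing_le hq hq1.le hQ' (mul_div_cancel₀ Q hq2.ne'))
    have : P' ≤ Q / (1 - q) := by rw [le_div_iff₀ hq2, mul_comm, hPP']; exact hPQ
    have := mul_le_mul_of_nonneg_left (h.mono hP' hQ' this) hq2.le
    linarith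

lemma IsAssistanceCurve.concaveOn_sSup (h : IsAssistanceCurve F K) (c : ℝ) :
    ConcaveOn ℝ (Set.Ici 0) (fun P => sSup (timeSharingValues c F P)) := by
  refine ⟨convex_Ici 0, fun P hP Q hQ s t hs ht hst => ?_⟩
  simp only [smul_eq_mul]
  have key : ∀ x ∈ timeSharingValues c F P, ∀ y ∈ timeSharingValues c F Q,
      s * x + t * y ≤ sSup (timeSharingValues c F (s * P + t * Q)) := by
    rintro _ ⟨q, P', hq, hq1, hP', hPP', rfl⟩ _ ⟨r, Q', hr, hr1, hQ', hQQ', rfl⟩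
    -- In the mixture of the two strategies, `N₁` is used with weights `a` and `b`. Concavity of `F`
    -- merges these uses into one with assistance `(a P' + b Q') / (a + b)`.
    have ha : 0 ≤ s * (1 - q) := mul_nonneg hs (sub_nonneg.mpr hq1)
    have hb : 0 ≤ t * (1 - r) := mul_nonneg ht (sub_nonneg.mpr hr1)
    set a := s * (1 - q)
    set b := t * (1 - r)
    have hab : 1 - (s * q + t * r) = a + b := by rw [← hst]; simp only [a, b]; ring
    have hSP : s * P + t * Q = a * P' + b * Q' := by rw [← hPP', ← hQQ']; simp only [a, b]; ring
    have hv : s * (q * c + (1 - q) * F P') + t * (r * c + (1 - r) * F Q')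
        = (s * q + t * r) * c + (a * F P' + b * F Q') := by simp only [a, b]; ring
    rw [hv, hSP]
    -- If `N₁` is not used at all, the value is `c`.
    rcases (add_nonneg ha hb).eq_or_lt with h0 | h0
    · have ha0 : a = 0 := by linarith
      have hb0 : b = 0 := by linarith
      rw [ha0, hb0, add_zero] at hab
      rw [ha0, hb0]
      rw [show s * q + t * r = 1 by linarith]
      simpa using h.le_sSup (c := c) le_rfl
    · have hR : 0 ≤ (a * P' + b * Q') / (a + b) :=
        div_nonneg (add_nonneg (mul_nonneg ha hP') (mul_nonneg hb hQ')) h0.le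
      have h1 := h.timeSharing_le (c := c) (q := s * q + t * r) (P := a * P' + b * Q')
        (add_nonneg (mul_nonneg hs hq) (mul_nonneg ht hr)) (by linarith) hR
        (by rw [hab]; exact mul_div_cancel₀ _ h0.ne')
      rw [hab] at h1
      have h2 := h.concave.2 (x := P') (y := Q') hP' hQ' (div_nonneg ha h0.le)
        (div_nonneg hb h0.le) (by rw [← add_div, div_self h0.ne'])
      simp only [smul_eq_mul] at h2
      have h3 : a / (a + b) * P' + b / (a + b) * Q' = (a * P' + b * Q') / (a + b) := by ring
      rw [h3] at h2
      have h4 := mul_le_mul_of_nonneg_left h2 h0.le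
      have h5 : (a + b) * (a / (a + b) * F P' + b / (a + b) * F Q') = a * F P' + b * F Q' := by
        field_simp
      linarith
  have h1 : ∀ x ∈ timeSharingValues c F P, s * x + t * sSup (timeSharingValues c F Q)
      ≤ sSup (timeSharingValues c F (s * P + t * Q)) := by
    intro x hx
    rcases ht.eq_or_lt with rfl | ht
    · obtain ⟨y, hy⟩ := timeSharingValues_nonempty c F hQ
      have := key x hx y hy
      simpa using this
    · have : sSup (timeSharingValues c F Q)
          ≤ (sSup (timeSharingValues c F (s * P + t * Q)) - s * x) / t :=
        csSup_le (timeSharingValues_nonempty c F hQ) fun y hy => by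
          rw [le_div_iff₀ ht]; linarith [key x hx y hy]
      rw [le_div_iff₀ ht] at this
      linarith
  rcases hs.eq_or_lt with rfl | hs
  · obtain ⟨x, hx⟩ := timeSharingValues_nonempty c F hP
    have := h1 x hx
    simpa using this
  · have : sSup (timeSharingValues c F P)
        ≤ (sSup (timeSharingValues c F (s * P + t * Q)) - t * sSup (timeSharingValues c F Q)) / s :=
      csSup_le (timeSharingValues_nonempty c F hP) fun x hx => by
        rw [le_div_iff₀ hs]; linarith [h1 x hx]
    rw [le_div_iff₀ hs] at this
    linarith

/-- For `P > 0` put `t = 1 - q` and `P' = P / t`. Once `P' ≥ K`, the value is affine in `t` with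
slope `F K - c ≥ 0`, so small `t` can be discarded and a continuous function on a compact interval
remains. For `P = 0` either `q = 1` or `P' = 0`. -/
lemma IsAssistanceCurve.sSup_mem (h : IsAssistanceCurve F K) {P : ℝ} (hP : 0 ≤ P)
    (hc : P = 0 ∨ ∃ P' : ℝ, 0 ≤ P' ∧ c ≤ F P') :
    sSup (timeSharingValues c F P) ∈ timeSharingValues c F P := by
  suffices ∃ x, IsGreatest (timeSharingValues c F P) x by
    obtain ⟨x, hx⟩ := this
    rw [hx.csSup_eq]
    exact hx.1
  rcases hP.eq_or_lt with rfl | hP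
  · refine ⟨max c (F 0), ?_, ?_⟩
    · rcases le_total c (F 0) with h0 | h0
      · exact ⟨0, 0, le_rfl, zero_le_one, le_rfl, by ring, by rw [max_eq_right h0]; ring⟩
      · exact ⟨1, 0, zero_le_one, le_rfl, le_rfl, by ring, by rw [max_eq_left h0]; ring⟩
    · rintro _ ⟨q, P', hq, hq1, hP', hPP', rfl⟩
      rcases mul_eq_zero.mp hPP' with h0 | rfl
      · rw [h0, show q = 1 by linarith]
        simp
      · have h1 := mul_le_mul_of_nonneg_left (le_max_left c (F 0)) hq
        have h2 := mul_le_mul_of_nonneg_left (le_max_right c (F 0)) (sub_nonneg.mpr hq1)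
        linarith
  obtain ⟨P₁, hP₁, hcP₁⟩ := hc.resolve_left hP.ne'
  have hcK : c ≤ F K := hcP₁.trans (h.le hP₁)
  set R := max K P
  have hR : 0 < R := hP.trans_le (le_max_right _ _)
  have ht0 : 0 < P / R := div_pos hP hR
  have ht1 : P / R ≤ 1 := (div_le_one hR).mpr (le_max_right _ _)
  have hF : ContinuousOn F (Set.Ioi 0) :=
    (h.concave.subset Set.Ioi_subset_Ici_self (convex_Ioi 0)).continuousOn isOpen_Ioi
  have hcont : ContinuousOn (fun t : ℝ => (1 - t) * c + t * F (P / t)) (Set.Icc (P / R) 1) := by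
    refine ContinuousOn.add (by fun_prop) (continuousOn_id.mul (hF.comp ?_ ?_))
    · exact continuousOn_const.div continuousOn_id fun t ht => (ht0.trans_le ht.1).ne'
    · exact fun t ht => div_pos hP (ht0.trans_le ht.1)
  obtain ⟨t, ht, hmax⟩ := isCompact_Icc.exists_isMaxOn ⟨1, ht1, le_rfl⟩ hcont
  have htpos := ht0.trans_le ht.1
  refine ⟨(1 - t) * c + t * F (P / t), ⟨1 - t, P / t, by linarith [ht.2], by linarith,
    (div_pos hP htpos).le, ?_, by ring⟩, ?_⟩
  · rw [sub_sub_cancel, mul_div_cancel₀ _ htpos.ne']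
  · rintro _ ⟨q, P', hq, hq1, hP', hPP', rfl⟩
    have hq2 : 0 < 1 - q := by
      refine (sub_nonneg.mpr hq1).lt_of_ne fun h0 => ?_
      rw [← h0, zero_mul] at hPP'
      exact hP.ne hPP'
    have hP'e : P' = P / (1 - q) := by rw [← hPP', mul_div_cancel_left₀ _ hq2.ne']
    rcases le_total (P / R) (1 - q) with h1 | h1
    · have h2 := hmax (show 1 - q ∈ Set.Icc (P / R) 1 from ⟨h1, by linarith⟩)
      simp only [Set.mem_ofPred_eq, sub_sub_cancel, ← hP'e] at h2
      exact h2
    · have h2 := hmax (show P / R ∈ Set.Icc (P / R) 1 from ⟨le_rfl, ht1⟩)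
      simp only [Set.mem_ofPred_eq, div_div_cancel₀ hP.ne'] at h2
      rw [h.const R (le_max_left _ _)] at h2
      have h3 := mul_le_mul_of_nonneg_left (h.le hP') hq2.le
      have h4 := mul_nonneg (sub_nonneg.mpr h1) (sub_nonneg.mpr hcK)
      linarith

/-- Using `N₁` in `k` of `n` uses is time sharing with `q = (n - k) / n`. For `k = 0` the
meaningless `F (S / 0)` has coefficient zero. -/
lemma IsAssistanceCurve.mix_le (h : IsAssistanceCurve F K) {k n : ℕ} (hn : n ≠ 0) (hk : k ≤ n)
    {S : ℝ} (hS : 0 ≤ S) :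
    (n - k) * c + k * F (S / k) ≤ n * sSup (timeSharingValues c F (S / n)) := by
  have hn0 : (0 : ℝ) < n := by exact_mod_cast Nat.pos_of_ne_zero hn
  rcases Nat.eq_zero_or_pos k with rfl | hk0
  · simpa using mul_le_mul_of_nonneg_left (h.le_sSup (c := c) (div_nonneg hS hn0.le)) hn0.le
  · have hk0' : (0 : ℝ) < k := by exact_mod_cast hk0
    have hkn : (k : ℝ) ≤ n := by exact_mod_cast hk
    have e1 : 1 - ((n : ℝ) - k) / n = k / n := by field_simp; ring
    have h1 := h.timeSharing_le (c := c) (q := ((n : ℝ) - k) / n) (P' := S / k) (P := S / n)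
      (div_nonneg (sub_nonneg.mpr hkn) hn0.le) ((div_le_one hn0).mpr (by linarith))
      (div_nonneg hS hk0'.le) (by rw [e1]; field_simp)
    rw [e1] at h1
    have h2 := mul_le_mul_of_nonneg_left h1 hn0.le
    have e2 : (n : ℝ) * (((n : ℝ) - k) / n * c + k / n * F (S / k))
        = (n - k) * c + k * F (S / k) := by field_simp
    linarith

end TimeSharing

/-! ### Convergence of the assisted capacities and the converse -/

section Assisted

variable {A B : Type*} [Fintype A] [DecidableEq A] [Nonempty A] [Fintype B] [DecidableEq B]
  {Φ : Matrix A A ℂ →ₗ[ℂ] Matrix B B ℂ}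

lemma logb_card_nonneg (A : Type*) [Fintype A] [Nonempty A] : 0 ≤ Real.logb 2 (Fintype.card A) :=
  Real.logb_nonneg one_lt_two (by exact_mod_cast Fintype.card_pos)

lemma IsChannel.nShotAssisted_one (h : IsChannel Φ) (P : ℝ) :
    nShotAssisted Φ P 1 = oneShotAssisted Φ P := by
  rw [nShotAssisted, Nat.cast_one, one_mul, div_one]
  exact ((isRelabelling_wordMap_unique (ι := Fin 1) Φ).oneShotAssisted_eq h
    (isChannel_tensorPower h 1) P).symm

lemma IsChannel.isAssistanceCurve_nShotAssisted (h : IsChannel Φ) (n : ℕ) :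
    IsAssistanceCurve (fun P => nShotAssisted Φ P n) (Real.logb 2 (Fintype.card A)) where
  concave := by
    have hc := (isChannel_tensorPower h n).concaveOn_oneShotAssisted
    refine ⟨convex_Ici 0, fun P hP Q hQ s t hs ht hst => ?_⟩
    have h1 := hc.2 (x := n * P) (y := n * Q) (Set.mem_Ici.mpr (mul_nonneg n.cast_nonneg hP))
      (Set.mem_Ici.mpr (mul_nonneg n.cast_nonneg hQ)) hs ht hst
    simp only [smul_eq_mul, nShotAssisted] at h1 ⊢
    rw [← mul_div_assoc, ← mul_div_assoc, ← add_div]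
    refine div_le_div_of_nonneg_right ?_ n.cast_nonneg
    rwa [show (n : ℝ) * (s * P + t * Q) = s * (n * P) + t * (n * Q) by ring]
  mono P hP Q _ hPQ := div_le_div_of_nonneg_right
    ((isChannel_tensorPower h n).oneShotAssisted_mono (mul_nonneg n.cast_nonneg hP)
      (mul_le_mul_of_nonneg_left hPQ n.cast_nonneg)) n.cast_nonneg
  nonneg := logb_card_nonneg A
  const P hP := by
    have e : Real.logb 2 (Fintype.card (Fin n → A)) = n * Real.logb 2 (Fintype.card A) := by
      rw [Fintype.card_fun, Fintype.card_fin, Nat.cast_pow, Real.logb_pow]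
    have hc := isChannel_tensorPower h n
    simp only [nShotAssisted]
    rw [hc.oneShotAssisted_eq_of_le (P := n * P), e]
    rw [e]
    exact mul_le_mul_of_nonneg_left hP n.cast_nonneg

lemma IsChannel.isAssistanceCurve_oneShotAssisted (h : IsChannel Φ) :
    IsAssistanceCurve (oneShotAssisted Φ) (Real.logb 2 (Fintype.card A)) := by
  have := h.isAssistanceCurve_nShotAssisted 1
  simpa only [h.nShotAssisted_one] using this

/-- The conditions are closed under pointwise limits because the saturation point `K` is the same
for all members. -/
lemma IsAssistanceCurve.of_tendsto {f : ℕ → ℝ → ℝ} {F : ℝ → ℝ} {K : ℝ}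
    (hf : ∀ n, IsAssistanceCurve (f n) K)
    (h : ∀ P, 0 ≤ P → Tendsto (fun n => f n P) atTop (𝓝 (F P))) : IsAssistanceCurve F K where
  concave := by
    refine ⟨convex_Ici 0, fun P hP Q hQ s t hs ht hst => ?_⟩
    refine le_of_tendsto_of_tendsto' (((h P hP).const_mul s).add ((h Q hQ).const_mul t))
      (h _ (add_nonneg (mul_nonneg hs hP) (mul_nonneg ht hQ))) fun n => ?_
    exact (hf n).concave.2 hP hQ hs ht hst
  mono P hP Q hQ hPQ := le_of_tendsto_of_tendsto' (h P hP) (h Q hQ) fun n => (hf n).mono hP hQ hPQ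
  nonneg := (hf 0).nonneg
  const P hP := by
    have hK := (hf 0).nonneg
    refine tendsto_nhds_unique (h P (hK.trans hP)) ?_
    simpa only [(hf _).const P hP] using h K hK

lemma IsChannel.le_minEntropyGap_tensorPower (h : IsChannel Φ) (n : ℕ) {P : ℝ} (hP : 0 ≤ P) :
    -(n * Real.logb 2 (Fintype.card A)) ≤ minEntropyGap (tensorPower Φ n) P := by
  have hc := isChannel_tensorPower h n
  rw [hc.minEntropyGap_eq]
  refine le_csInf (gapValues_nonempty _ hP) ?_
  rintro _ ⟨k, ψ, hψ, -, rfl⟩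
  have := hc.le_condEntropy_ampliate hψ
  rwa [Fintype.card_fun, Fintype.card_fin, Nat.cast_pow, Real.logb_pow] at this

/-- If the assisted capacities are given by the minimal entropy gaps, then they converge to their
supremum. -/
lemma IsChannel.tendsto_nShotAssisted (h : IsChannel Φ) {d P : ℝ} (hP : 0 ≤ P)
    (hgap : ∀ n : ℕ, 1 ≤ n →
      nShotAssisted Φ P n = d - 1 / n * minEntropyGap (tensorPower Φ n) (n * P)) :
    Tendsto (nShotAssisted Φ P) atTop (𝓝 (assistedCapacity Φ P)) ∧
      ∀ n : ℕ, 1 ≤ n → nShotAssisted Φ P n ≤ assistedCapacity Φ P := by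
  -- Fekete's lemma gives convergence of the gaps per use to their infimum.
  have hsub : Subadditive fun n : ℕ => minEntropyGap (tensorPower Φ n) (n * P) :=
    fun m n => h.minEntropyGap_add_le hP m n
  have hbdd : BddBelow (Set.range fun n : ℕ => minEntropyGap (tensorPower Φ n) (n * P) / n) := by
    refine ⟨-Real.logb 2 (Fintype.card A), ?_⟩
    rintro _ ⟨n, rfl⟩
    rcases Nat.eq_zero_or_pos n with rfl | hn
    · simpa using logb_card_nonneg A
    · have hn' : (0 : ℝ) < n := by exact_mod_cast hn
      dsimp only
      rw [le_div_iff₀ hn']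
      linarith [h.le_minEntropyGap_tensorPower n (mul_nonneg hn'.le hP)]
  have hlim : Tendsto (nShotAssisted Φ P) atTop (𝓝 (d - hsub.lim)) := by
    refine ((hsub.tendsto_lim hbdd).const_sub d).congr' ?_
    filter_upwards [eventually_ge_atTop 1] with n hn
    rw [hgap n hn]
    ring
  have he : assistedCapacity Φ P = d - hsub.lim := hlim.limUnder_eq
  rw [he]
  refine ⟨hlim, fun n hn => ?_⟩
  have := hsub.lim_le_div hbdd (Nat.one_le_iff_ne_zero.mp hn)
  rw [hgap n hn]
  have e : 1 / (n : ℝ) * minEntropyGap (tensorPower Φ n) (n * P)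
      = minEntropyGap (tensorPower Φ n) (n * P) / n := by ring
  linarith

variable {N₀ N₁ : Matrix A A ℂ →ₗ[ℂ] Matrix B B ℂ} {κ : Type*} [Fintype κ] [DecidableEq κ]
  [Nonempty κ] {v : κ → A → ℂ} {T : κ → Matrix B B ℂ}

lemma IsMeasurePrepare.minOutputEntropy_le (h : IsMeasurePrepare v T N₀) (h₀ : IsChannel N₀)
    (j : κ) : minOutputEntropy N₀ ≤ entropy (T j) := by
  refine csInf_le ⟨0, ?_⟩ ⟨ketbra (v j), h.pure j, by rw [h.map_ketbra]⟩
  rintro _ ⟨ρ, hρ, rfl⟩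
  exact entropy_nonneg (h₀.isDensity hρ)

/-- The converse bound: no code for the conditional channel is better than time sharing. -/
lemma IsMeasurePrepare.nShotAssisted_condChannel_le (h : IsMeasurePrepare v T N₀)
    (h₀ : IsChannel N₀) (h₁ : IsChannel N₁) {c : ℝ}
    (hc : c = Real.logb 2 (Fintype.card B) - minOutputEntropy N₀)
    (hgap : ∀ n : ℕ, 1 ≤ n → ∀ P : ℝ, 0 ≤ P → nShotAssisted N₁ P n =
      Real.logb 2 (Fintype.card B) - 1 / n * minEntropyGap (tensorPower N₁ n) (n * P))
    {F : ℝ → ℝ} {K : ℝ} (hF : IsAssistanceCurve F K) {n : ℕ} (hn : n ≠ 0)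
    (hle : ∀ k : ℕ, 1 ≤ k → k ≤ n → ∀ P, 0 ≤ P → nShotAssisted N₁ P k ≤ F P) {P : ℝ} (hP : 0 ≤ P) :
    nShotAssisted (condChannel N₀ N₁) P n ≤ sSup (timeSharingValues c F P) := by
  have hn0 : (0 : ℝ) < n := by exact_mod_cast Nat.pos_of_ne_zero hn
  set d := Real.logb 2 (Fintype.card B)
  have hdiv : ∀ {x : ℝ}, 0 ≤ x → 0 ≤ x / n := fun hx => div_nonneg hx hn0.le
  have hb := h.oneShotAssisted_condChannel_le (N₁ := N₁) h₀ h₁ (μ := minOutputEntropy N₀)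
    (h.minOutputEntropy_le h₀) (n := n)
    -- The bound for which the conclusion becomes `n` times the time-sharing supremum; its convexity
    -- and antitonicity come from concavity and monotonicity of that supremum.
    (g := fun S => n * d - n * sSup (timeSharingValues c F (S / n))) ?_ ?_ ?_
    (P := n * P) (mul_nonneg hn0.le hP)
  · rw [nShotAssisted, div_le_iff₀ hn0]
    rw [mul_div_cancel_left₀ P hn0.ne'] at hb
    linarith
  · intro k hk S hS
    have h1 := hF.mix_le (c := c) hn hk hS
    have h2 : k * d - k * F (S / k) ≤ minEntropyGap (tensorPower N₁ k) S := by
      -- For `k = 0` the input space is one-dimensional, and the claim is that its gap is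
      -- nonnegative.
      rcases Nat.eq_zero_or_pos k with rfl | hk0
      · simpa using h₁.le_minEntropyGap_tensorPower 0 hS
      · have hk0' : (0 : ℝ) < k := by exact_mod_cast hk0
        have h3 := hgap k hk0 (S / k) (div_nonneg hS hk0'.le)
        have h4 := hle k hk0 hk (S / k) (div_nonneg hS hk0'.le)
        rw [h3, mul_div_cancel₀ S hk0'.ne'] at h4
        have h5 := mul_le_mul_of_nonneg_left h4 hk0'.le
        have h6 : (k : ℝ) * (d - 1 / k * minEntropyGap (tensorPower N₁ k) S)
            = k * d - minEntropyGap (tensorPower N₁ k) S := by field_simp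
        linarith
    have h7 : ((n : ℝ) - k) * minOutputEntropy N₀ = (n - k) * d - (n - k) * c := by rw [hc]; ring
    linarith
  · refine ⟨convex_Ici 0, fun x hx y hy s t hs ht hst => ?_⟩
    have h1 := (hF.concaveOn_sSup c).2 (x := x / n) (y := y / n) (hdiv hx) (hdiv hy) hs ht hst
    simp only [smul_eq_mul] at h1 ⊢
    rw [show s * (x / n) + t * (y / n) = (s * x + t * y) / n by ring] at h1
    have h2 := mul_le_mul_of_nonneg_left h1 hn0.le
    have h3 : s * (n * d) + t * (n * d) = n * d := by rw [← add_mul, hst, one_mul]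
    linarith
  · intro x hx y hy hxy
    have h1 := hF.monotoneOn_sSup c (hdiv hx) (hdiv hy) (div_le_div_of_nonneg_right hxy hn0.le)
    have h2 := mul_le_mul_of_nonneg_left h1 hn0.le
    linarith

end Assisted

end CECapacity

/-! ### The main theorem -/

theorem lemma3 {A B : Type*} [Fintype A] [DecidableEq A] [Nonempty A] [Fintype B] [DecidableEq B]
    (N₀ N₁ : Matrix A A ℂ →ₗ[ℂ] Matrix B B ℂ)
    (hN₀ : IsChannel N₀) (hN₁ : IsChannel N₁)
    (hclassical : HasClassicalInput N₀)
    (h01 : capacity N₀ = Real.logb 2 (Fintype.card B) - minOutputEntropy N₀)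
    (h12 : ∀ n : ℕ, 1 ≤ n → ∀ P : ℝ, 0 ≤ P →
      nShotAssisted N₁ P n =
        Real.logb 2 (Fintype.card B) - 1 / n * minEntropyGap (tensorPower N₁ n) (n * P))
    (P : ℝ) (hP : 0 ≤ P) :
    -- the limits that define the regularized capacities exist
    (Tendsto (nShotCapacity N₀) atTop (𝓝 (capacity N₀)) ∧
      (∀ P' : ℝ, 0 ≤ P' →
        Tendsto (nShotAssisted N₁ P') atTop (𝓝 (assistedCapacity N₁ P'))) ∧
      Tendsto (nShotAssisted (condChannel N₀ N₁) P) atTop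
        (𝓝 (assistedCapacity (condChannel N₀ N₁) P))) ∧
    -- the one-shot formula
    (IsLUB (timeSharingValues (capacity N₀) (oneShotAssisted N₁) P)
        (oneShotAssisted (condChannel N₀ N₁) P) ∧
      ((P = 0 ∨ ∃ P' : ℝ, 0 ≤ P' ∧ capacity N₀ ≤ oneShotAssisted N₁ P') →
        IsGreatest (timeSharingValues (capacity N₀) (oneShotAssisted N₁) P)
          (oneShotAssisted (condChannel N₀ N₁) P))) ∧
    -- the regularized formula
    (IsLUB (timeSharingValues (capacity N₀) (assistedCapacity N₁) P)
        (assistedCapacity (condChannel N₀ N₁) P) ∧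
      ((P = 0 ∨ ∃ P' : ℝ, 0 ≤ P' ∧ capacity N₀ ≤ assistedCapacity N₁ P') →
        IsGreatest (timeSharingValues (capacity N₀) (assistedCapacity N₁) P)
          (assistedCapacity (condChannel N₀ N₁) P))) := by
  obtain ⟨v, T, hmp⟩ := hclassical.exists_isMeasurePrepare
  have hc : sSup (holevoValues T) = capacity N₀ := (hmp.capacity_eq hN₀).symm
  have hN := isChannel_condChannel hN₀ hN₁
  have hF₁ := hN₁.isAssistanceCurve_oneShotAssisted
  have hlim := fun P' (hP' : 0 ≤ P') =>
    hN₁.tendsto_nShotAssisted hP' fun n hn => h12 n hn P' hP'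
  have hF : IsAssistanceCurve (assistedCapacity N₁) (Real.logb 2 (Fintype.card A)) :=
    .of_tendsto (fun n => hN₁.isAssistanceCurve_nShotAssisted n) fun P' hP' => (hlim P' hP').1
  -- The one-shot formula is the case `n = 1`, where the converse only asks for the bound at `k =
  -- 1`.
  have hone : oneShotAssisted (condChannel N₀ N₁) P
      = sSup (timeSharingValues (capacity N₀) (oneShotAssisted N₁) P) := by
    rw [← hN.nShotAssisted_one]
    refine le_antisymm (hmp.nShotAssisted_condChannel_le hN₀ hN₁ h01 h12 hF₁ one_ne_zero ?_ hP)
      (csSup_le (timeSharingValues_nonempty _ _ hP) ?_)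
    · intro k hk hk1 Q _
      rw [le_antisymm hk1 hk, hN₁.nShotAssisted_one]
    · rintro _ ⟨q, Q, hq, hq1, hQ, hQP, rfl⟩
      rw [← hN₁.nShotAssisted_one, ← hc]
      exact hmp.timeSharing_le_nShotAssisted hN₀ hN₁ one_ne_zero hq hq1 hQ hQP
  have htend : Tendsto (nShotAssisted (condChannel N₀ N₁) P) atTop
      (𝓝 (sSup (timeSharingValues (capacity N₀) (assistedCapacity N₁) P))) := by
    -- From below, fix a nearly optimal pair `(q, Q)` and let `n` grow; from above, the converse
    -- holds for every `n ≥ 1`, because the limit curve dominates all `k`-shot capacities of `N₁`.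
    refine tendsto_order.mpr ⟨fun a ha => ?_, fun a ha => ?_⟩
    · obtain ⟨_, ⟨q, Q, hq, hq1, hQ, hQP, rfl⟩, hlt⟩ :=
        exists_lt_of_lt_csSup (timeSharingValues_nonempty _ _ hP) ha
      have h1 := ((hlim Q hQ).1.const_mul (1 - q)).const_add (q * capacity N₀)
      filter_upwards [h1.eventually_const_lt hlt, eventually_ne_atTop 0] with n hn hn0
      refine hn.trans_le ?_
      rw [← hc]
      exact hmp.timeSharing_le_nShotAssisted hN₀ hN₁ hn0 hq hq1 hQ hQP
    · filter_upwards [eventually_ne_atTop 0] with n hn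
      exact (hmp.nShotAssisted_condChannel_le hN₀ hN₁ h01 h12 hF hn
        (fun k hk _ Q hQ => (hlim Q hQ).2 k hk) hP).trans_lt ha
  have hreg : assistedCapacity (condChannel N₀ N₁) P
      = sSup (timeSharingValues (capacity N₀) (assistedCapacity N₁) P) := htend.limUnder_eq
  have hlub₁ := isLUB_csSup (timeSharingValues_nonempty (capacity N₀) (oneShotAssisted N₁) hP)
    (hF₁.bddAbove (capacity N₀) P)
  have hlub := isLUB_csSup (timeSharingValues_nonempty (capacity N₀) (assistedCapacity N₁) hP)
    (hF.bddAbove (capacity N₀) P)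
  rw [hone, hreg]
  exact ⟨⟨hc ▸ hmp.tendsto_nShotCapacity hN₀, fun P' hP' => (hlim P' hP').1, htend⟩,
    ⟨hlub₁, fun h => ⟨hF₁.sSup_mem hP h, hlub₁.1⟩⟩, ⟨hlub, fun h => ⟨hF.sSup_mem hP h, hlub.1⟩⟩⟩
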